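/- Let $0<T<\infty$ and write $z=(x,p)\in\mathbb{R}^3\times\mathbb{R}^3=\mathbb{R}^6$. Let $g\in C([0,T[;L^\infty(\mathbb{R}^6)\text{-}w^*)$ be a density with $g\ge 0$ whose support is compact, locally uniformly in time (for every $t_1<T$ there is $R$ such that $g(t)=0$ a.e. outside the ball of radius $R$ for all $t\in[0,t_1]$). Let $\Phi(t,\cdot):\mathbb{R}^3\to\mathbb{R}$ and $A(t,\cdot):\mathbb{R}^3\to\mathbb{R}^3$, $t\in[0,T[$, be bounded (measurable) potentials induced by $g$ (with the speed of light equal to $1$), i.e. $$\Phi(t,x)=\int_{\mathbb{R}^3}\rho(t,y)\frac{dy}{|y-x|},\qquad A(t,x)=\frac12\int_{\mathbb{R}^3}[\mathrm{id}+\omega\otimes\omega]\,j_A(t,y)\frac{dy}{|y-x|},\qquad \omega=\frac{y-x}{|y-x|},$$ $$\rho(t,x)=\int_{\mathbb{R}^3} g(t,x,p)\,dp,\qquad j_A(t,x)=\int_{\mathbb{R}^3} v_A(t,x,p)\,g(t,x,p)\,dp,\qquad v_A(t,x,p)=\frac{p-A(t,x)}{\sqrt{1+|p-A(t,x)|^2}}.$$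 Then $\Phi(t,\cdot)$ and $A(t,\cdot)$ are of class $C^1$ for every $t\in[0,T[$, and the following hold. (1) For every $t\in[0,T[$ and $z\in\mathbb{R}^6$ the characteristic system $$\dot x=v_A(s,x,p),\qquad \dot p=\Big[-\nabla\Phi+\sum_{i=1}^3 v_A^i\nabla A^i\Big](s,x,p)$$ has a solution $s\mapsto Z(s,t,z)=(X,P)(s,t,z)$ on $[0,T[$ with $Z(t,t,z)=z$, and any solution on an interval $J\subset[0,T[$ containing $t$ which equals $z$ at time $t$ coincides with $Z(\cdot,t,z)$ on $J$. Moreover $Z(r,s,Z(s,t,z))=Z(r,t,z)$ for all $r,s,t\in[0,T[$ and all $z$. (2) For all $s,t\in[0,T[$ the map $z\mapsto Z(s,t,z)$ preserves Lebesgue measure on $\mathbb{R}^6$. (3) Let $f_0\in L^1\cap L^\infty(\mathbb{R}^6)$, $f_0\ge0$. A weak solution on $[0,T[$ of the linear Vlasov equation $$\partial_t f+v_A\cdot\nabla_x f-\Big[\nabla\Phi-\sum_{i=1}^3 v_A^i\nabla A^i\Big]\cdot\nabla_p f=0$$ with initial datum $f_0$ is a function $f\in C([0,T[;L^\infty(\mathbb{R}^6)\text{-}w^*)$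 with $f\ge0$, $\int f(t,z)\,dz=\int f_0(z)\,dz$ for all $t\in[0,T[$, and $$\int_0^T\!\!\int_{\mathbb{R}^6} f\Big\{\partial_t\varphi+v_A\cdot\nabla_x\varphi-\Big[\nabla\Phi-\sum_{i=1}^3 v_A^i\nabla A^i\Big]\cdot\nabla_p\varphi\Big\}\,dz\,dt=-\int_{\mathbb{R}^6}f_0(z)\,\varphi(0,z)\,dz$$ for all $\varphi\in C^\infty_0([0,T[\times\mathbb{R}^6)$ (smooth with compact support in $[0,T[\times\mathbb{R}^6$). Then $f(t,z)=f_0(Z(0,t,z))$ is a weak solution with initial datum $f_0$, and every weak solution $f$ with initial datum $f_0$ satisfies, for every $t\in[0,T[$, $f(t,z)=f_0(Z(0,t,z))$ for almost every $z\in\mathbb{R}^6$. In particular the measure $f(t,z)\,dz$ is the push-forward of $f_0(z)\,dz$ by $z\mapsto Z(t,0,z)$. -/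

import Mathlib

open MeasureTheory Set
open scoped ContDiff

namespace VlasovDarwin

/-- Three-dimensional Euclidean space (positions and generalized momenta). -/
abbrev E3 : Type := EuclideanSpace ℝ (Fin 3)

/-- Phase space, with points `z = (x, p)`; its `volume` is Lebesgue measure `dx dp`. -/
abbrev Phase : Type := E3 × E3

noncomputable section

/-- The map `g ↦ g / √(1 + |g|²)` (speed of light equal to one). -/
def relVel (g : E3) : E3 := (Real.sqrt (1 + ‖g‖ ^ 2))⁻¹ • g

/-- The relativistic velocity `v_A(t, x, p)`. -/
def velocity (A : ℝ → E3 → E3) (t : ℝ) (z : Phase) : E3 := relVel (z.2 - A t z.1)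

/-- The charge density `ρ(t, x) = ∫ f(t, x, p) dp`. -/
def chargeDensity (f : ℝ → Phase → ℝ) (t : ℝ) (x : E3) : ℝ := ∫ p : E3, f t (x, p)

/-- The current density `j_A(t, x) = ∫ v_A(t, x, p) f(t, x, p) dp`. -/
def currentDensity (f : ℝ → Phase → ℝ) (A : ℝ → E3 → E3) (t : ℝ) (x : E3) : E3 :=
  ∫ p : E3, f t (x, p) • velocity A t (x, p)

/-- The unit vector `ω = (y - x) / |y - x|`. -/
def direction (x y : E3) : E3 := ‖y - x‖⁻¹ • (y - x)

/-- `[id + ω ⊗ ω] j / |y - x|` for a vector `j`. -/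
def darwinKernel (x y j : E3) : E3 :=
  ‖y - x‖⁻¹ • (j + (inner ℝ (direction x y) j) • direction x y)

/-- `f ∈ C([0,T[, L^∞(ℝ⁶)-w*)`: each `f t` is in `L^∞`, and `t ↦ ∫ f(t) g` is continuous on
`[0,T[` for every `g ∈ L¹`. -/
structure WeakStarContinuous (T : ℝ) (f : ℝ → Phase → ℝ) : Prop where
  memLp : ∀ t ∈ Ico 0 T, MemLp (f t) ⊤ volume
  continuousOn : ∀ g : Phase → ℝ, Integrable g volume →
    ContinuousOn (fun t => ∫ z, f t z * g z) (Ico 0 T)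

/-- The phase space densities that induce the potentials: weak-* continuous in time, nonnegative,
and with compact support, locally uniformly in time. -/
structure IsCompactDensity (T : ℝ) (f : ℝ → Phase → ℝ) : Prop where
  weakStar : WeakStarContinuous T f
  nonneg : ∀ t ∈ Ico 0 T, 0 ≤ᵐ[volume] f t
  support : ∀ t₁ ∈ Ico 0 T, ∃ R : ℝ, ∀ t ∈ Icc 0 t₁, ∀ᵐ z : Phase, R < ‖z‖ → f t z = 0

/-- `Φ` and `A` are bounded potentials induced by `f` on `[0,T[`. As `j_A` depends on `A`, the last
field is a nonlinear integral equation for `A`. -/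
structure IsInducedPotentials (T : ℝ) (f : ℝ → Phase → ℝ) (Φ : ℝ → E3 → ℝ)
    (A : ℝ → E3 → E3) : Prop where
  measurable_vector : ∀ t ∈ Ico 0 T, Measurable (A t)
  bounded_scalar : ∀ t ∈ Ico 0 T, ∃ C : ℝ, ∀ x, |Φ t x| ≤ C
  bounded_vector : ∀ t ∈ Ico 0 T, ∃ C : ℝ, ∀ x, ‖A t x‖ ≤ C
  scalar_eq : ∀ t ∈ Ico 0 T, ∀ x, Φ t x = ∫ y : E3, chargeDensity f t y / ‖y - x‖
  vector_eq : ∀ t ∈ Ico 0 T, ∀ x,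
    A t x = (1 / 2 : ℝ) • ∫ y : E3, darwinKernel x y (currentDensity f A t y)

/-- The force `-∇Φ + ∑ i, v_A^i ∇A^i`. -/
def force (Φ : ℝ → E3 → ℝ) (A : ℝ → E3 → E3) (t : ℝ) (z : Phase) : E3 :=
  -gradient (Φ t) z.1 + ∑ i : Fin 3, (velocity A t z) i • gradient (fun y => A t y i) z.1

/-- The right-hand side `(v_A, -∇Φ + ∑ i, v_A^i ∇A^i)` of the characteristic system. -/
def charField (Φ : ℝ → E3 → ℝ) (A : ℝ → E3 → E3) (t : ℝ) (z : Phase) : Phase :=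
  (velocity A t z, force Φ A t z)

/-- `ζ = (x, p)` solves the characteristic system on the time interval `J`
(one-sided derivatives at end points of `J`). -/
def IsCharacteristic (Φ : ℝ → E3 → ℝ) (A : ℝ → E3 → E3) (J : Set ℝ) (ζ : ℝ → Phase) : Prop :=
  ∀ s ∈ J, HasDerivWithinAt ζ (charField Φ A s (ζ s)) J s

/-- `Z s t z` is, on `[0,T[`, the unique solution at time `s` of the characteristic system that
passes through `z` at time `t`; uniqueness holds on every interval `J ⊆ [0,T[` around `t`. -/
structure IsCharacteristicFlow (T : ℝ) (Φ : ℝ → E3 → ℝ) (A : ℝ → E3 → E3)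
    (Z : ℝ → ℝ → Phase → Phase) : Prop where
  initial : ∀ t ∈ Ico 0 T, ∀ z, Z t t z = z
  solves : ∀ t ∈ Ico 0 T, ∀ z, IsCharacteristic Φ A (Ico 0 T) (fun s => Z s t z)
  unique : ∀ t ∈ Ico 0 T, ∀ z, ∀ J : Set ℝ, J.OrdConnected → J ⊆ Ico 0 T → t ∈ J →
    ∀ ζ : ℝ → Phase, IsCharacteristic Φ A J ζ → ζ t = z → ∀ s ∈ J, ζ s = Z s t z

/-- Test functions: restrictions to `[0,T[ × ℝ⁶` of smooth functions, with compact support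
in `[0,T[ × ℝ⁶`. They need not vanish at time `0`. -/
structure IsTestFunction (T : ℝ) (φ : ℝ × Phase → ℝ) : Prop where
  smooth : ContDiff ℝ ∞ φ
  compact : HasCompactSupport φ
  support : tsupport φ ⊆ Iio T ×ˢ univ

/-- `f` is a weak solution on `[0,T[` of the linear Vlasov equation with potentials `Φ`, `A` and
initial datum `f₀`. Here `fderiv ℝ φ (t, z) (1, charField Φ A t z)` is
`∂ₜφ + v_A · ∇ₓφ - [∇Φ - ∑ i, v_A^i ∇A^i] · ∇ₚφ` at `(t, z)`. -/
structure IsWeakSolution (T : ℝ) (Φ : ℝ → E3 → ℝ) (A : ℝ → E3 → E3) (f₀ : Phase → ℝ)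
    (f : ℝ → Phase → ℝ) : Prop where
  weakStar : WeakStarContinuous T f
  nonneg : ∀ t ∈ Ico 0 T, 0 ≤ᵐ[volume] f t
  integrable : ∀ t ∈ Ico 0 T, Integrable (f t) volume
  mass : ∀ t ∈ Ico 0 T, ∫ z, f t z = ∫ z, f₀ z
  equation : ∀ φ : ℝ × Phase → ℝ, IsTestFunction T φ →
    ∫ t in Ioo 0 T, ∫ z, f t z * fderiv ℝ φ (t, z) (1, charField Φ A t z)
      = -∫ z, f₀ z * φ (0, z)

/-- The measure `g(z) dz` of a nonnegative density `g`. -/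
def densityMeasure (g : Phase → ℝ) : Measure Phase :=
  volume.withDensity (fun z => ENNReal.ofReal (g z))

end

end VlasovDarwin

open VlasovDarwin

/-! The potentials are integrals of bounded, compactly supported densities against kernels of size
1/|y - x|. They are therefore C¹, but their derivatives are in general only log-Lipschitz, so
neither the Lipschitz theory of ODEs nor a differentiable flow with a Jacobian is at hand. The
modulus of continuity is kept in the form C (N ‖z - w‖ + e⁻ᴺ) for every N ≥ 0; choosing N = log(1/‖z
- w‖) for small distances gives the usual r log(1/r). In this form the Osgood argument
(`norm_le_osgood`) yields uniqueness, convergence of mollified approximations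
(`LogLipField.exists_solution`) and a flow that is Hölder in space with exponent e^{-Cτ} over a time
τ (`IsOdeFlow.dist_le_osgood`).

Conservation of volume rests on the Hamiltonian structure. The field (v, w) satisfies ∂ₓv = -(∂ₚw)*,
and both derivatives exist although second derivatives of A need not. Over a step of length h,
integrating the field in time at a frozen point w gives two points U w and V w, each altered in one
variable only, and the maps U and V push one measure ν to Lebesgue measure
(`measurePreserving_generating`). The flow takes U w to V w up to h² log(1/h). After transport by
the remaining Hölder flow the error is still of order h to a power above one, so integrals of
transported Lipschitz functions have zero time derivative (`IsOdeFlow.measurePreserving`).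

Given the flow Z and its invariance, f₀(Z 0 t z) is a weak solution by a change of variables. For
the converse a weak solution is mollified at width δ = e⁻ᴺ and followed along characteristics, where
it changes only by a commutator (`LiouvilleFlow.mollified_sub_eq`). The gradient of the mollifier
costs 1/δ, the oscillation of b gives back δ (N + 1), and since the field is divergence free the
transported test function enters only through its oscillation, a power of δ. The product tends to
zero (`LiouvilleFlow.integral_mul_eq_comp`).

The bounds on the potentials come from regularised kernels id + β n ⊗ n over √(δ² + |z|²), with β =
0 for Φ and β = 1 for A (`exists_potential_bounds`). Their dependence on time is delicate for A,
because its equation is nonlinear and continuity is not assumed. Two signs decide: p ↦ v is firmly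
monotone (`norm_relVel_sub_sq_le`), and the Darwin kernel is positive
(`integral_inner_potential_nonneg`), being a superposition of Gaussian kernels that are
autocorrelations. Together they bound the quadratic mean of a change of velocity by the change of a
potential with frozen velocities, which weak-* continuity controls
(`IsInducedPotentials.continuousOn_vector`). -/

namespace VlasovDarwin

open Filter Topology Function

/-! ### Log-Lipschitz vector fields: stability -/

/-- The Osgood modulus: a supersolution of `u' = C (N u + e⁻ᴺ) + e⁻ᴺ⁰`, at a suitable `N`
depending on time, with initial value `e⁻ᴺ⁰`. -/
noncomputable def osgood (C τ N : ℝ) : ℝ := (1 + (C + 2) * τ) * Real.exp (-N * Real.exp (-C * τ))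

theorem osgood_mono {C τ τ' N : ℝ} (hC : 0 ≤ C) (hτ : 0 ≤ τ) (h : τ ≤ τ') (hN : 0 ≤ N) :
    osgood C τ N ≤ osgood C τ' N := by
  unfold osgood
  have h1 : Real.exp (-C * τ') ≤ Real.exp (-C * τ) := Real.exp_le_exp.2 (by nlinarith)
  have h2 : Real.exp (-N * Real.exp (-C * τ)) ≤ Real.exp (-N * Real.exp (-C * τ')) :=
    Real.exp_le_exp.2 (by nlinarith)
  have h3 : 0 ≤ τ' := hτ.trans h
  gcongr

theorem osgood_nonneg {C τ : ℝ} (hC : 0 ≤ C) (hτ : 0 ≤ τ) (N : ℝ) : 0 ≤ osgood C τ N := by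
  unfold osgood; positivity

theorem tendsto_osgood (C τ : ℝ) : Tendsto (osgood C τ) atTop (𝓝 0) := by
  unfold osgood
  rw [← mul_zero (1 + (C + 2) * τ)]
  refine Tendsto.const_mul _ (Real.tendsto_exp_atBot.comp ?_)
  have : Tendsto (fun N : ℝ => N * Real.exp (-C * τ)) atTop atTop :=
    tendsto_id.atTop_mul_const (Real.exp_pos _)
  simp only [neg_mul] at this ⊢
  exact tendsto_neg_atTop_atBot.comp this

section Stability

variable {E : Type*} [NormedAddCommGroup E] [NormedSpace ℝ E]

theorem norm_le_osgood_right {f f' : ℝ → E} {a c C N₀ : ℝ} (hC : 0 ≤ C) (hN₀ : 0 ≤ N₀)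
    (hf : ContinuousOn f (Icc a c))
    (hf' : ∀ s ∈ Ico a c, HasDerivWithinAt f (f' s) (Ici s) s)
    (hb : ∀ s ∈ Ico a c, ∀ N, 0 ≤ N →
      ‖f' s‖ ≤ C * (N * ‖f s‖ + Real.exp (-N)) + Real.exp (-N₀))
    (ha : ‖f a‖ ≤ Real.exp (-N₀)) {t : ℝ} (ht : t ∈ Icc a c) :
    ‖f t‖ ≤ osgood C (t - a) N₀ := by
  have hB : ∀ s : ℝ, HasDerivAt (fun s => osgood C (s - a) N₀)
      ((C + 2) * Real.exp (-N₀ * Real.exp (-C * (s - a))) +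
        C * (N₀ * Real.exp (-C * (s - a))) * osgood C (s - a) N₀) s := by
    intro s
    unfold osgood
    have h0 : HasDerivAt (fun s => s - a) 1 s := (hasDerivAt_id s).sub_const a
    have h1 := (h0.const_mul (C + 2)).const_add 1
    have h2 := ((h0.const_mul (-C)).exp.const_mul (-N₀)).exp
    refine (h1.mul h2).congr_deriv ?_
    ring
  refine image_norm_le_of_norm_deriv_right_lt_deriv_boundary' hf hf'
    (B := fun s => osgood C (s - a) N₀) (by simpa [osgood] using ha)
    (fun x _ => (hB x).continuousAt.continuousWithinAt)
    (fun x _ => (hB x).hasDerivWithinAt) ?_ ht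
  intro s hs hfs
  -- At contact ‖f s‖ equals the barrier, and the modulus is used with N = N₀ e^{-C(s-a)}. The term
  -- C N ‖f s‖ is then matched exactly by the derivative of the exponential, while C e⁻ᴺ + e^{-N₀} ≤
  -- (C + 1) e⁻ᴺ stays strictly below the (C + 2) e⁻ᴺ produced by the linear factor.
  have hN : 0 ≤ N₀ * Real.exp (-C * (s - a)) := by positivity
  refine (hb s hs _ hN).trans_lt ?_
  rw [hfs]
  have h1 : Real.exp (-C * (s - a)) ≤ 1 := by
    rw [Real.exp_le_one_iff]; nlinarith [hs.1]
  have h2 : Real.exp (-N₀) ≤ Real.exp (-N₀ * Real.exp (-C * (s - a))) :=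
    Real.exp_le_exp.2 (by nlinarith)
  have h3 : 0 < Real.exp (-N₀ * Real.exp (-C * (s - a))) := Real.exp_pos _
  rw [← neg_mul]
  nlinarith

theorem norm_le_osgood {f f' : ℝ → E} {t₀ t C N₀ : ℝ} (hC : 0 ≤ C) (hN₀ : 0 ≤ N₀)
    (hf : ∀ s ∈ uIcc t₀ t, HasDerivWithinAt f (f' s) (uIcc t₀ t) s)
    (hb : ∀ s ∈ uIcc t₀ t, ∀ N, 0 ≤ N →
      ‖f' s‖ ≤ C * (N * ‖f s‖ + Real.exp (-N)) + Real.exp (-N₀))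
    (ha : ‖f t₀‖ ≤ Real.exp (-N₀)) : ‖f t‖ ≤ osgood C |t - t₀| N₀ := by
  rcases le_total t₀ t with h | h
  · rw [uIcc_of_le h] at hf hb
    rw [abs_of_nonneg (sub_nonneg.2 h)]
    refine norm_le_osgood_right hC hN₀ (fun s hs => (hf s hs).continuousWithinAt)
      (fun s hs => ?_) (fun s hs => hb s ⟨hs.1, hs.2.le⟩) ha ⟨h, le_rfl⟩
    exact (hf s ⟨hs.1, hs.2.le⟩).mono_of_mem_nhdsWithin (Icc_mem_nhdsGE_of_mem hs)
  · rw [uIcc_of_ge h] at hf hb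
    rw [abs_of_nonpos (sub_nonpos.2 h)]
    have hder : ∀ s ∈ Icc (-t₀) (-t),
        HasDerivWithinAt (fun s => f (-s)) (-f' (-s)) (Icc (-t₀) (-t)) s := by
      intro s hs
      have h1 : -s ∈ Icc t t₀ := ⟨by linarith [hs.2], by linarith [hs.1]⟩
      have := (hf (-s) h1).scomp s
        ((hasDerivAt_neg s).hasDerivWithinAt (s := Icc (-t₀) (-t)))
        (fun r hr => ⟨by linarith [hr.2], by linarith [hr.1]⟩)
      simpa [Function.comp_def] using this
    have key := norm_le_osgood_right (f := fun s => f (-s)) (f' := fun s => -f' (-s))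
      (a := -t₀) (c := -t) (t := -t) hC hN₀
      (fun s hs => (hder s hs).continuousWithinAt)
      (fun s hs => (hder s ⟨hs.1, hs.2.le⟩).mono_of_mem_nhdsWithin (Icc_mem_nhdsGE_of_mem hs))
      (fun s hs => by
        rw [norm_neg]
        exact hb (-s) ⟨by linarith [hs.2], by linarith [hs.1]⟩)
      (by simpa using ha) ⟨by linarith, le_rfl⟩
    simpa [neg_add_eq_sub] using key

end Stability

/-- A bounded vector field on the time interval `I`, continuous in time and space, and
log-Lipschitz in space. -/
structure LogLipField {E : Type*} [NormedAddCommGroup E] (I : Set ℝ) (C : ℝ)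
    (b : ℝ → E → E) : Prop where
  nonneg : 0 ≤ C
  cont : ContinuousOn (uncurry b) (I ×ˢ univ)
  bound : ∀ t ∈ I, ∀ z, ‖b t z‖ ≤ C
  logLip : ∀ t ∈ I, ∀ N, 0 ≤ N → ∀ z w, ‖b t z - b t w‖ ≤ C * (N * ‖z - w‖ + Real.exp (-N))

namespace LogLipField

variable {E : Type*} [NormedAddCommGroup E]
  {I : Set ℝ} {C : ℝ} {b : ℝ → E → E}

theorem continuous_slice (hb : LogLipField I C b) {t : ℝ} (ht : t ∈ I) : Continuous (b t) := by
  rw [← continuousOn_univ]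
  exact hb.cont.comp (f := fun z => (t, z)) (by fun_prop) (fun z _ => ⟨ht, mem_univ z⟩)

variable [NormedSpace ℝ E]

theorem dist_le (hb : LogLipField I C b) {t₀ t N₀ : ℝ} (hI : uIcc t₀ t ⊆ I) {x y : ℝ → E}
    (hN₀ : 0 ≤ N₀)
    (hx : ∀ s ∈ uIcc t₀ t, HasDerivWithinAt x (b s (x s)) (uIcc t₀ t) s)
    (hy : ∀ s ∈ uIcc t₀ t, HasDerivWithinAt y (b s (y s)) (uIcc t₀ t) s)
    (h0 : ‖x t₀ - y t₀‖ ≤ Real.exp (-N₀)) : ‖x t - y t‖ ≤ osgood C |t - t₀| N₀ := by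
  refine norm_le_osgood (f := fun s => x s - y s) (f' := fun s => b s (x s) - b s (y s))
    hb.nonneg hN₀ (fun s hs => (hx s hs).sub (hy s hs)) (fun s hs N hN => ?_) h0
  have := hb.logLip s (hI hs) N hN (x s) (y s)
  have h2 := Real.exp_pos (-N₀)
  linarith

/-- Equal initial values meet the hypothesis of `dist_le` for every N₀ ≥ 0, and the Osgood bound
tends to zero as N₀ grows. -/
theorem unique (hb : LogLipField I C b) {t₀ t : ℝ} (hI : uIcc t₀ t ⊆ I) {x y : ℝ → E}
    (hx : ∀ s ∈ uIcc t₀ t, HasDerivWithinAt x (b s (x s)) (uIcc t₀ t) s)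
    (hy : ∀ s ∈ uIcc t₀ t, HasDerivWithinAt y (b s (y s)) (uIcc t₀ t) s)
    (h0 : x t₀ = y t₀) : x t = y t := by
  have h : ‖x t - y t‖ ≤ 0 := by
    refine ge_of_tendsto (tendsto_osgood C |t - t₀|) ?_
    filter_upwards [eventually_ge_atTop 0] with N hN
    exact hb.dist_le hI hN hx hy (by simpa [h0] using (Real.exp_pos _).le)
  exact sub_eq_zero.1 (norm_le_zero_iff.1 h)

/-! ### Existence of solutions by mollifying the field -/

variable [FiniteDimensional ℝ E]

open scoped Convolution in
/-- Mollification in space gives Lipschitz fields close to a log-Lipschitz one. -/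
theorem exists_lipschitz_approx (hb : LogLipField I C b) {ε : ℝ} (hε : 0 < ε) :
    ∃ (b' : ℝ → E → E) (K : NNReal), (∀ t ∈ I, LipschitzWith K (b' t)) ∧
      (∀ z, ContinuousOn (b' · z) I) ∧ (∀ t ∈ I, ∀ z, ‖b' t z - b t z‖ ≤ ε) := by
  let : MeasurableSpace E := borel E
  have : BorelSpace E := ⟨rfl⟩
  let μ : Measure E := Measure.addHaar
  -- Over a distance e⁻ᴺ the field varies by at most C (N e⁻ᴺ + e⁻ᴺ), which tends to zero, so one
  -- radius of mollification serves all times in `I`.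
  obtain ⟨r, hr, hbr⟩ : ∃ r : ℝ, 0 < r ∧ ∀ t ∈ I, ∀ z w, ‖z - w‖ ≤ r → ‖b t z - b t w‖ ≤ ε := by
    have h1 : Tendsto (fun N : ℝ => C * (2 * (N * Real.exp (-N)) + 2 * Real.exp (-N))) atTop
        (𝓝 (C * (2 * 0 + 2 * 0))) := by
      have e1 : Tendsto (fun N : ℝ => N * Real.exp (-N)) atTop (𝓝 0) := by
        simpa using Real.tendsto_pow_mul_exp_neg_atTop_nhds_zero 1
      have e2 : Tendsto (fun N : ℝ => Real.exp (-N)) atTop (𝓝 0) :=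
        Real.tendsto_exp_neg_atTop_nhds_zero
      exact ((e1.const_mul 2).add (e2.const_mul 2)).const_mul C
    rw [mul_zero, add_zero, mul_zero] at h1
    obtain ⟨N, hN0, hN⟩ := ((eventually_ge_atTop 0).and (h1.eventually (gt_mem_nhds hε))).exists
    refine ⟨Real.exp (-N), Real.exp_pos _, fun t ht z w hzw => ?_⟩
    refine (hb.logLip t ht N hN0 z w).trans (le_trans ?_ hN.le)
    have hp := Real.exp_pos (-N)
    have : N * ‖z - w‖ ≤ N * Real.exp (-N) := by gcongr
    have h3 : 0 ≤ N * Real.exp (-N) := by positivity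
    exact mul_le_mul_of_nonneg_left (by linarith) hb.nonneg
  let φ : ContDiffBump (0 : E) := ⟨r / 2, r, by positivity, by linarith⟩
  obtain ⟨L, hL⟩ : ∃ L, LipschitzWith L (φ.normed μ) :=
    ContDiff.lipschitzWith_of_hasCompactSupport φ.hasCompactSupport_normed
      (φ.contDiff_normed (n := 1)) (by simp)
  let b' : ℝ → E → E := fun t z => ∫ y, φ.normed μ (z - y) • b t y ∂μ
  have hint : ∀ t ∈ I, ∀ z, Integrable (fun y => φ.normed μ (z - y) • b t y) μ := by
    intro t ht z
    refine Continuous.integrable_of_hasCompactSupport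
      ((φ.continuous_normed.comp (by fun_prop)).smul (hb.continuous_slice ht)) ?_
    exact (φ.hasCompactSupport_normed.comp_homeomorph (Homeomorph.subLeft z)).smul_right
  refine ⟨b', (L * Real.toNNReal C * (2 * (μ (Metric.closedBall 0 r)).toNNReal)),
    fun t ht => ?_, fun z => ?_, fun t ht z => ?_⟩
  · refine LipschitzWith.of_dist_le_mul fun z w => ?_
    rw [dist_eq_norm, dist_eq_norm]
    have hsub : b' t z - b' t w = ∫ y, (φ.normed μ (z - y) - φ.normed μ (w - y)) • b t y ∂μ := by
      simp only [b', sub_smul]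
      rw [integral_sub (hint t ht z) (hint t ht w)]
    rw [hsub]
    -- The two translated kernels live on balls of radius r, and their difference is at most L ‖z -
    -- w‖. Integrating over the union gives a Lipschitz constant that does not depend on t.
    let S : Set E := Metric.closedBall z r ∪ Metric.closedBall w r
    have hS : ∀ y, y ∉ S → (φ.normed μ (z - y) - φ.normed μ (w - y)) • b t y = 0 := by
      intro y hy
      simp only [S, mem_union, Metric.mem_closedBall, not_or, not_le] at hy
      have e : ∀ v : E, r < dist y v → φ.normed μ (v - y) = 0 := by
        intro v hv
        have : v - y ∉ support (φ.normed μ) := by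
          rw [φ.support_normed_eq, Metric.mem_ball, dist_zero_right, ← dist_eq_norm, dist_comm]
          exact not_lt.2 hv.le
        simpa using this
      rw [e z hy.1, e w hy.2]; simp
    rw [← setIntegral_eq_integral_of_forall_compl_eq_zero hS]
    have hfin : μ S < ⊤ := (measure_union_le _ _).trans_lt
      (ENNReal.add_lt_top.2 ⟨measure_closedBall_lt_top, measure_closedBall_lt_top⟩)
    refine (norm_setIntegral_le_of_norm_le_const (C := L * ‖z - w‖ * C) hfin ?_).trans ?_
    · intro y _
      rw [norm_smul]
      gcongr
      · have := hL.dist_le_mul (z - y) (w - y)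
        rwa [dist_eq_norm, dist_eq_norm, sub_sub_sub_cancel_right] at this
      · exact hb.bound t ht y
    · have hm : μ.real S ≤ 2 * μ.real (Metric.closedBall 0 r) := by
        refine (measureReal_union_le _ _).trans ?_
        rw [measureReal_def, measureReal_def, measureReal_def, Measure.addHaar_closedBall_center,
          Measure.addHaar_closedBall_center μ w]
        linarith
      have hC := hb.nonneg
      push_cast
      rw [Real.coe_toNNReal _ hC]
      calc L * ‖z - w‖ * C * μ.real S ≤ L * ‖z - w‖ * C * (2 * μ.real (Metric.closedBall 0 r)) := by
            gcongr
        _ = _ := by rw [measureReal_def]; ring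
  · refine continuousOn_of_dominated (bound := fun y => ‖φ.normed μ (z - y)‖ * C) ?_ ?_ ?_ ?_
    · exact fun t ht => (hint t ht z).aestronglyMeasurable
    · intro t ht
      refine ae_of_all _ fun y => ?_
      rw [norm_smul]
      gcongr
      exact hb.bound t ht y
    · refine Integrable.mul_const (Integrable.norm ?_) C
      exact (φ.integrable_normed (μ := μ)).comp_sub_left z
    · refine ae_of_all _ fun y => ?_
      refine continuousOn_const.smul ?_
      exact hb.cont.comp (f := fun t => (t, y)) (by fun_prop) (fun t ht => ⟨ht, mem_univ y⟩)
  · have hconv : b' t z = (φ.normed μ ⋆[ContinuousLinearMap.lsmul ℝ ℝ, μ] b t) z := by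
      rw [convolution_eq_swap]
      rfl
    rw [hconv, ← dist_eq_norm]
    refine ContDiffBump.dist_normed_convolution_le
      (hb.continuous_slice ht).aestronglyMeasurable (fun w hw => ?_)
    rw [dist_eq_norm]
    rw [Metric.mem_ball, dist_eq_norm] at hw
    exact hbr t ht w z hw.le

/-- Existence for the initial value problem of a log-Lipschitz field on a compact interval. -/
theorem exists_solution {a c : ℝ} (hb : LogLipField (Icc a c) C b) {t₀ : ℝ} (ht₀ : t₀ ∈ Icc a c)
    (z : E) : ∃ x : ℝ → E, x t₀ = z ∧
      ∀ s ∈ Icc a c, HasDerivWithinAt x (b s (x s)) (Icc a c) s := by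
  have hac : a ≤ c := ht₀.1.trans ht₀.2
  -- The exponent n + 1 is for the Cauchy estimate: two approximations with n ≤ m have total defect
  -- at most 2 e^{-(n+1)} ≤ e⁻ⁿ, since e ≥ 2, which is what `norm_le_osgood` allows with N₀ = n.
  choose b' K hK hcont happ using fun n : ℕ =>
    hb.exists_lipschitz_approx (Real.exp_pos (-(n + 1 : ℝ)))
  have hle1 : ∀ n : ℕ, Real.exp (-(n + 1 : ℝ)) ≤ 1 := fun n =>
    Real.exp_le_one_iff.2 (by linarith [n.cast_nonneg (α := ℝ)])
  have hbound : ∀ n, ∀ t ∈ Icc a c, ∀ w, ‖b' n t w‖ ≤ C + 1 := fun n t ht w => by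
    have h1 := happ n t ht w
    have h2 := hb.bound t ht w
    have h3 := norm_le_norm_add_norm_sub (b t w) (b' n t w)
    rw [norm_sub_rev] at h3
    linarith [hle1 n]
  have hpic : ∀ n, ∃ x : ℝ → E, x t₀ = z ∧
      ∀ s ∈ Icc a c, HasDerivWithinAt x (b' n s (x s)) (Icc a c) s := by
    intro n
    have hC := hb.nonneg
    -- The bound C + 1 is global, so a ball of radius (C + 1)(c - a) cannot be left during the
    -- interval and the solution exists on all of it, however large the Lipschitz constant `K n`.
    have hpl : IsPicardLindelof (b' n) (⟨t₀, ht₀⟩ : Icc a c) z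
        (Real.toNNReal ((C + 1) * (c - a))) 0 (Real.toNNReal (C + 1)) (K n) := by
      refine ⟨fun t ht => (hK n t ht).lipschitzOnWith, fun x _ => hcont n x,
        fun t ht x _ => ?_, ?_⟩
      · rw [Real.coe_toNNReal _ (by linarith)]
        exact hbound n t ht x
      · rw [Real.coe_toNNReal _ (by linarith), Real.coe_toNNReal _ (by nlinarith),
          NNReal.coe_zero, sub_zero]
        gcongr
        exact max_le (by linarith [ht₀.1]) (by linarith [ht₀.2])
    exact hpl.exists_eq_forall_mem_Icc_hasDerivWithinAt₀
  choose x hx0 hx using hpic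
  have hsub : ∀ {t}, t ∈ Icc a c → uIcc t₀ t ⊆ Icc a c := fun ht => by
    rw [← uIcc_of_le hac] at ht₀ ht ⊢
    exact uIcc_subset_uIcc ht₀ ht
  have hcauchy : ∀ n m : ℕ, n ≤ m → ∀ t ∈ Icc a c, ‖x n t - x m t‖ ≤ osgood C (c - a) n := by
    intro n m hnm t ht
    have h1 : ‖x n t - x m t‖ ≤ osgood C |t - t₀| n := by
      refine norm_le_osgood (f := fun s => x n s - x m s)
        (f' := fun s => b' n s (x n s) - b' m s (x m s)) hb.nonneg n.cast_nonneg
        (fun s hs => ((hx n s (hsub ht hs)).sub (hx m s (hsub ht hs))).mono (hsub ht))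
        (fun s hs N hN => ?_) (by simpa [hx0] using (Real.exp_pos _).le)
      have e1 := happ n s (hsub ht hs) (x n s)
      have e2 := happ m s (hsub ht hs) (x m s)
      have e3 := hb.logLip s (hsub ht hs) N hN (x n s) (x m s)
      have e4 : Real.exp (-(m + 1 : ℝ)) ≤ Real.exp (-(n + 1 : ℝ)) :=
        Real.exp_le_exp.2 (by have : (n : ℝ) ≤ m := by exact_mod_cast hnm
                              linarith)
      have e5 : 2 * Real.exp (-(n + 1 : ℝ)) ≤ Real.exp (-(n : ℝ)) := by
        have : Real.exp (-(n : ℝ)) = Real.exp (-(n + 1 : ℝ)) * Real.exp 1 := by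
          rw [← Real.exp_add]; ring_nf
        rw [this]
        have h2 : (2 : ℝ) ≤ Real.exp 1 := by linarith [Real.add_one_le_exp (1 : ℝ)]
        nlinarith [Real.exp_pos (-(n + 1 : ℝ))]
      calc ‖b' n s (x n s) - b' m s (x m s)‖
          = ‖(b' n s (x n s) - b s (x n s)) + (b s (x n s) - b s (x m s))
              - (b' m s (x m s) - b s (x m s))‖ := by congr 1; abel
        _ ≤ ‖b' n s (x n s) - b s (x n s)‖ + ‖b s (x n s) - b s (x m s)‖
              + ‖b' m s (x m s) - b s (x m s)‖ :=
            (norm_sub_le _ _).trans (by gcongr; exact norm_add_le _ _)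
        _ ≤ _ := by linarith
    refine h1.trans (osgood_mono hb.nonneg (abs_nonneg _) ?_ n.cast_nonneg)
    rw [abs_le]
    constructor <;> linarith [ht.1, ht.2, ht₀.1, ht₀.2]
  have hosg : Tendsto (fun n : ℕ => osgood C (c - a) n) atTop (𝓝 0) :=
    (tendsto_osgood C (c - a)).comp tendsto_natCast_atTop_atTop
  have hlim : ∀ t ∈ Icc a c, ∃ y, Tendsto (fun n => x n t) atTop (𝓝 y) := by
    intro t ht
    refine cauchySeq_tendsto_of_complete (cauchySeq_of_le_tendsto_0' _ ?_ hosg)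
    intro n m hnm
    rw [dist_eq_norm]
    exact hcauchy n m hnm t ht
  choose! y hy using hlim
  have hylip : ∀ s ∈ Icc a c, ∀ t ∈ Icc a c, ‖y t - y s‖ ≤ (C + 1) * ‖t - s‖ := by
    intro s hs t ht
    refine le_of_tendsto ((hy t ht).sub (hy s hs)).norm (Eventually.of_forall fun n => ?_)
    exact (convex_Icc a c).norm_image_sub_le_of_norm_hasDerivWithin_le
      (fun r hr => hx n r hr) (fun r hr => hbound n r hr _) hs ht
  have hycont : ContinuousOn y (Icc a c) := by
    refine (LipschitzOnWith.of_dist_le_mul (K := Real.toNNReal (C + 1)) ?_).continuousOn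
    intro t ht s hs
    rw [dist_eq_norm, dist_eq_norm, Real.coe_toNNReal _ (by linarith [hb.nonneg])]
    exact hylip s hs t ht
  -- The limit is taken in the integral equation, which needs only convergence of the curves;
  -- differentiability of the limit is then recovered from the Picard integral.
  have hyint : ∀ t ∈ Icc a c, y t = ODE.picard b t₀ z y t := by
    intro t ht
    have e1 : ∀ n, x n t = z + ∫ s in t₀..t, b' n s (x n s) := by
      intro n
      have hc : ContinuousOn (fun s => b' n s (x n s)) (Icc a c) := by
        have hcc : ContinuousOn (uncurry (b' n)) (Icc a c ×ˢ univ) :=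
          continuousOn_prod_of_continuousOn_lipschitzOnWith' (uncurry (b' n)) (K n)
            (fun s hs => (hK n s hs).lipschitzOnWith) (fun w _ => hcont n w)
        exact ODE.continuousOn_comp hcc (fun s hs => (hx n s hs).continuousWithinAt)
          (fun _ _ => mem_univ _)
      have := intervalIntegral.integral_eq_sub_of_hasDeriv_right
        (f := x n) (f' := fun s => b' n s (x n s)) (a := t₀) (b := t)
        (fun s hs => ((hx n s (hsub ht hs)).mono (hsub ht)).continuousWithinAt)
        (fun s hs => ?_) ((hc.mono (hsub ht)).intervalIntegrable)
      · rw [this, hx0]; abel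
      · have hs' : s ∈ Icc a c := hsub ht (Ioo_subset_Icc_self hs)
        have hnhd : Icc a c ∈ 𝓝 s := by
          refine Icc_mem_nhds ?_ ?_
          · exact lt_of_le_of_lt (le_min ht₀.1 ht.1) hs.1
          · exact lt_of_lt_of_le hs.2 (max_le ht₀.2 ht.2)
        exact ((hx n s hs').hasDerivAt hnhd).hasDerivWithinAt
    have e2 : Tendsto (fun n => ∫ s in t₀..t, b' n s (x n s)) atTop
        (𝓝 (∫ s in t₀..t, b s (y s))) := by
      refine intervalIntegral.tendsto_integral_filter_of_dominated_convergence
        (fun _ => C + 1) ?_ ?_ intervalIntegrable_const ?_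
      · refine Eventually.of_forall fun n => ?_
        have hcc : ContinuousOn (uncurry (b' n)) (Icc a c ×ˢ univ) :=
          continuousOn_prod_of_continuousOn_lipschitzOnWith' (uncurry (b' n)) (K n)
            (fun s hs => (hK n s hs).lipschitzOnWith) (fun w _ => hcont n w)
        refine ((ODE.continuousOn_comp hcc (fun s hs => (hx n s hs).continuousWithinAt)
          (fun _ _ => mem_univ _)).mono ?_).aestronglyMeasurable measurableSet_uIoc
        exact uIoc_subset_uIcc.trans (hsub ht)
      · refine Eventually.of_forall fun n => ae_of_all _ fun s hs => ?_
        exact hbound n s (hsub ht (uIoc_subset_uIcc hs)) _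
      · refine ae_of_all _ fun s hs => ?_
        have hs' := hsub ht (uIoc_subset_uIcc hs)
        have h1 : Tendsto (fun n => b s (x n s)) atTop (𝓝 (b s (y s))) :=
          ((hb.continuous_slice hs').tendsto _).comp (hy s hs')
        have h2 : Tendsto (fun n => b' n s (x n s) - b s (x n s)) atTop (𝓝 0) := by
          refine squeeze_zero_norm (fun n => happ n s hs' _) ?_
          refine Real.tendsto_exp_neg_atTop_nhds_zero.comp ?_
          exact tendsto_atTop_add_const_right _ _ tendsto_natCast_atTop_atTop
        simpa using h2.add h1
    refine tendsto_nhds_unique (hy t ht) ?_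
    simp only [e1]
    exact e2.const_add z
  refine ⟨y, tendsto_nhds_unique (hy t₀ ht₀) (by simp [hx0]), fun s hs => ?_⟩
  exact (ODE.hasDerivWithinAt_picard_Icc ht₀ hb.cont hycont (fun _ _ => mem_univ _) z hs).congr
    hyint (hyint s hs)

end LogLipField

end VlasovDarwin

namespace VlasovDarwin

open Filter Topology Function

/-! ### The flow of a log-Lipschitz field -/

theorem exists_solution_Ico {E : Type*} [NormedAddCommGroup E] [NormedSpace ℝ E]
    [FiniteDimensional ℝ E] {T : ℝ} {b : ℝ → E → E}
    (hb : ∀ t₁ ∈ Ico 0 T, ∃ C, LogLipField (Icc 0 t₁) C b) {t : ℝ} (ht : t ∈ Ico 0 T) (z : E) :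
    ∃ x : ℝ → E, x t = z ∧ ∀ s ∈ Ico 0 T, HasDerivWithinAt x (b s (x s)) (Ico 0 T) s := by
  choose! C hC using hb
  have hex : ∀ t₁ ∈ Ico t T, ∃ x : ℝ → E, x t = z ∧
      ∀ s ∈ Icc 0 t₁, HasDerivWithinAt x (b s (x s)) (Icc 0 t₁) s := fun t₁ ht₁ =>
    (hC t₁ ⟨ht.1.trans ht₁.1, ht₁.2⟩).exists_solution ⟨ht.1, ht₁.1⟩ z
  choose! X hX0 hX using hex
  have hagree : ∀ t₁ ∈ Ico t T, ∀ t₂ ∈ Ico t T, t₁ ≤ t₂ → ∀ s ∈ Icc 0 t₁, X t₁ s = X t₂ s := by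
    intro t₁ ht₁ t₂ ht₂ h12 s hs
    have hsub : uIcc t s ⊆ Icc 0 t₁ := by
      have h0 : 0 ≤ t₁ := ht.1.trans ht₁.1
      rw [← uIcc_of_le h0]
      exact uIcc_subset_uIcc (by rw [uIcc_of_le h0]; exact ⟨ht.1, ht₁.1⟩)
        (by rwa [uIcc_of_le h0])
    have hsub2 : uIcc t s ⊆ Icc 0 t₂ := hsub.trans (Icc_subset_Icc_right h12)
    exact (hC t₁ ⟨ht.1.trans ht₁.1, ht₁.2⟩).unique hsub
      (fun r hr => (hX t₁ ht₁ r (hsub hr)).mono hsub)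
      (fun r hr => (hX t₂ ht₂ r (hsub2 hr)).mono hsub2) (by rw [hX0 t₁ ht₁, hX0 t₂ ht₂])
  -- Solutions on different intervals agree, so the value at s may be read from the shortest
  -- interval [0, max t s]. Near s this curve coincides with the solution on the slightly longer [0,
  -- t₁], from which it inherits its derivative.
  refine ⟨fun s => X (max t s) s, by simp [hX0 t ⟨le_rfl, ht.2⟩], fun s hs => ?_⟩
  let t₁ := (max t s + T) / 2
  have hmT : max t s < T := max_lt ht.2 hs.2
  have hmt : t ≤ max t s := le_max_left _ _
  have hms : s ≤ max t s := le_max_right _ _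
  have h1 : max t s < t₁ := by simp only [t₁]; linarith
  have ht₁ : t₁ ∈ Ico t T := ⟨by linarith, by simp only [t₁]; linarith⟩
  have heq : ∀ r ∈ Ico 0 T ∩ Iio t₁, X (max t r) r = X t₁ r := fun r hr =>
    hagree _ ⟨le_max_left _ _, max_lt ht.2 hr.1.2⟩ _ ht₁
      (max_le ht₁.1 (le_of_lt hr.2)) r ⟨hr.1.1, le_max_right _ _⟩
  have hsI : s ∈ Iio t₁ := hms.trans_lt h1
  have hd := hX t₁ ht₁ s ⟨hs.1, hsI.le⟩
  have e0 : X (max t s) s = X t₁ s := heq s ⟨hs, hsI⟩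
  rw [← hasDerivWithinAt_inter (Iio_mem_nhds hsI)]
  simp only [e0]
  exact (hd.mono fun r hr => ⟨hr.1.1, le_of_lt hr.2⟩).congr heq e0

/-- `Z s t z` is the position at time `s` of a solution on `I` passing through `z` at time `t`. -/
structure IsOdeFlow {E : Type*} [NormedAddCommGroup E] [NormedSpace ℝ E] (I : Set ℝ)
    (b : ℝ → E → E) (Z : ℝ → ℝ → E → E) : Prop where
  initial : ∀ t ∈ I, ∀ z, Z t t z = z
  solves : ∀ t ∈ I, ∀ z, ∀ s ∈ I, HasDerivWithinAt (fun s => Z s t z) (b s (Z s t z)) I s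

theorem exists_isOdeFlow {E : Type*} [NormedAddCommGroup E] [NormedSpace ℝ E]
    [FiniteDimensional ℝ E] {T : ℝ} {b : ℝ → E → E}
    (hb : ∀ t₁ ∈ Ico 0 T, ∃ C, LogLipField (Icc 0 t₁) C b) :
    ∃ Z : ℝ → ℝ → E → E, IsOdeFlow (Ico 0 T) b Z := by
  have h : ∀ t ∈ Ico 0 T, ∀ z : E, ∃ x : ℝ → E, x t = z ∧
      ∀ s ∈ Ico 0 T, HasDerivWithinAt x (b s (x s)) (Ico 0 T) s := fun t ht z =>
    exists_solution_Ico hb ht z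
  choose! X hX0 hX using h
  exact ⟨fun s t z => X t z s, hX0, hX⟩

namespace IsOdeFlow

variable {E : Type*} [NormedAddCommGroup E] [NormedSpace ℝ E] {I : Set ℝ} {C : ℝ}
  {b : ℝ → E → E} {Z : ℝ → ℝ → E → E}

theorem mono (hZ : IsOdeFlow I b Z) {J : Set ℝ} (h : J ⊆ I) : IsOdeFlow J b Z :=
  ⟨fun t ht => hZ.initial t (h ht), fun t ht z s hs => (hZ.solves t (h ht) z s (h hs)).mono h⟩

variable [hI : I.OrdConnected]

theorem eq_of_solution (hZ : IsOdeFlow I b Z) (hb : LogLipField I C b) {t s : ℝ} {z : E}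
    (ht : t ∈ I) (hs : s ∈ I) {x : ℝ → E}
    (hx : ∀ r ∈ uIcc t s, HasDerivWithinAt x (b r (x r)) (uIcc t s) r) (h0 : x t = z) :
    x s = Z s t z := by
  have hsub := hI.uIcc_subset ht hs
  exact hb.unique hsub hx (fun r hr => (hZ.solves t ht z r (hsub hr)).mono hsub)
    (by rw [h0, hZ.initial t ht])

/-- As functions of r both sides solve the equation, and they agree at r = s. -/
theorem comp (hZ : IsOdeFlow I b Z) (hb : LogLipField I C b) {r s t : ℝ} (hr : r ∈ I) (hs : s ∈ I)
    (ht : t ∈ I) (z : E) : Z r s (Z s t z) = Z r t z := by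
  have hsub := hI.uIcc_subset hs hr
  exact (hZ.eq_of_solution hb hs hr
    (fun q hq => (hZ.solves t ht z q (hsub hq)).mono hsub) rfl).symm

theorem inv (hZ : IsOdeFlow I b Z) (hb : LogLipField I C b) {s t : ℝ} (hs : s ∈ I)
    (ht : t ∈ I) (z : E) : Z s t (Z t s z) = z := by
  rw [hZ.comp hb hs ht hs, hZ.initial s hs]

/-- With ‖z - w‖ = e⁻ᴺ the bound is a multiple of ‖z - w‖ to the power e^{-C|s-t|}: the flow is
Hölder, with an exponent that deteriorates in time. Both Liouville's theorem and the uniqueness of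
weak solutions depend on this rate and not merely on continuity. -/
theorem dist_le_osgood (hZ : IsOdeFlow I b Z) (hb : LogLipField I C b) {s t N : ℝ} (hs : s ∈ I)
    (ht : t ∈ I) (hN : 0 ≤ N) {z w : E} (h : ‖z - w‖ ≤ Real.exp (-N)) :
    ‖Z s t z - Z s t w‖ ≤ osgood C |s - t| N := by
  have hsub := hI.uIcc_subset ht hs
  exact hb.dist_le hsub hN (fun r hr => (hZ.solves t ht z r (hsub hr)).mono hsub)
    (fun r hr => (hZ.solves t ht w r (hsub hr)).mono hsub)
    (by rwa [hZ.initial t ht, hZ.initial t ht])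

theorem norm_sub_le (hZ : IsOdeFlow I b Z) (hb : LogLipField I C b) {r s t : ℝ} (hr : r ∈ I)
    (hs : s ∈ I) (ht : t ∈ I) (z : E) : ‖Z r t z - Z s t z‖ ≤ C * |r - s| :=
  hI.convex.norm_image_sub_le_of_norm_hasDerivWithin_le (f := fun s => Z s t z)
    (fun q hq => hZ.solves t ht z q hq) (fun q hq => hb.bound q hq _) hs hr

theorem norm_sub_self_le (hZ : IsOdeFlow I b Z) (hb : LogLipField I C b) {s t : ℝ} (hs : s ∈ I)
    (ht : t ∈ I) (z : E) : ‖Z s t z - z‖ ≤ C * |s - t| := by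
  simpa [hZ.initial t ht] using hZ.norm_sub_le hb hs ht ht z

theorem continuous (hZ : IsOdeFlow I b Z) (hb : LogLipField I C b) {s t : ℝ} (hs : s ∈ I)
    (ht : t ∈ I) : Continuous (Z s t) := by
  rw [Metric.continuous_iff]
  intro z ε hε
  obtain ⟨N, hN0, hN⟩ := ((eventually_ge_atTop 0).and
    ((tendsto_osgood C |s - t|).eventually (gt_mem_nhds hε))).exists
  refine ⟨Real.exp (-N), Real.exp_pos _, fun w hw => ?_⟩
  rw [dist_eq_norm] at hw ⊢
  exact (hZ.dist_le_osgood hb hs ht hN0 hw.le).trans_lt hN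

theorem continuousOn_uncurry (hZ : IsOdeFlow I b Z) (hb : LogLipField I C b) {t : ℝ}
    (ht : t ∈ I) : ContinuousOn (fun q : ℝ × E => Z q.1 t q.2) (I ×ˢ univ) :=
  continuousOn_prod_of_continuousOn_lipschitzOnWith (fun q : ℝ × E => Z q.1 t q.2)
    (Real.toNNReal C)
    (fun s hs => (hZ.continuous hb hs ht).continuousOn)
    (fun z _ => LipschitzOnWith.of_dist_le_mul fun r hr s hs => by
      rw [dist_eq_norm, Real.coe_toNNReal _ hb.nonneg, Real.dist_eq]
      exact hZ.norm_sub_le hb hr hs ht z)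

/-- The time `t` to time `s` map as a homeomorphism. -/
def homeomorph (hZ : IsOdeFlow I b Z) (hb : LogLipField I C b) {s t : ℝ} (hs : s ∈ I)
    (ht : t ∈ I) : E ≃ₜ E where
  toFun := Z s t
  invFun := Z t s
  left_inv := hZ.inv hb ht hs
  right_inv := hZ.inv hb hs ht
  continuous_toFun := hZ.continuous hb hs ht
  continuous_invFun := hZ.continuous hb ht hs

end IsOdeFlow

end VlasovDarwin

namespace VlasovDarwin

open Filter Topology Function

/-! ### Liouville's theorem without derivatives of the flow -/

section ChangeOfVariables

variable {E : Type*} [NormedAddCommGroup E] [InnerProductSpace ℝ E] [FiniteDimensional ℝ E]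

/-- The two one-sided maps of a generating function have derivatives 1 + M and 1 + M*; equality of
the determinants is what makes them share one Jacobian. -/
theorem det_one_add_adjoint (M : E →L[ℝ] E) :
    (1 + ContinuousLinearMap.adjoint M).det = (1 + M).det := by
  have h : (1 + ContinuousLinearMap.adjoint M) = ContinuousLinearMap.adjoint (1 + M) := by
    rw [map_add]
    congr 1
    exact (ContinuousLinearMap.adjoint_id (𝕜 := ℝ) (E := E)).symm
  rw [h]
  let v := stdOrthonormalBasis ℝ E
  rw [ContinuousLinearMap.det, ContinuousLinearMap.det, ← LinearMap.det_toMatrix v.toBasis,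
    ← LinearMap.det_toMatrix v.toBasis, ← ContinuousLinearMap.adjoint_toLinearMap,
    LinearMap.toMatrix_adjoint, Matrix.det_conjTranspose]
  simp

variable [MeasurableSpace E] [BorelSpace E]

/-- The identity plus a contraction is a bijection: the equation x + g x = y says that x is the
fixed point of the contraction x ↦ y - g x. The area formula then has all of E as its image. -/
theorem lintegral_comp_id_add {g : E → E} {g' : E → E →L[ℝ] E} {c : NNReal} (hc : c < 1)
    (hg : LipschitzWith c g) (hg' : ∀ x, HasFDerivAt g (g' x) x) (F : E → ENNReal) :
    ∫⁻ x, ENNReal.ofReal |(1 + g' x).det| * F (x + g x) = ∫⁻ x, F x := by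
  have hcontr : ∀ y, ContractingWith c (fun x => y - g x) := fun y =>
    ⟨hc, by
      have := (LipschitzWith.const y).sub hg
      simpa using this⟩
  have hinj : Injective (fun x => x + g x) := by
    intro x y hxy
    refine (hcontr (x + g x)).fixedPoint_unique' (x := x) (y := y) ?_ ?_
    · simp [IsFixedPt]
    · simp only [IsFixedPt]
      rw [show x + g x = y + g y from hxy]
      abel
  have hsurj : Surjective (fun x => x + g x) := by
    intro y
    refine ⟨ContractingWith.fixedPoint _ (hcontr y), ?_⟩
    have := (hcontr y).fixedPoint_isFixedPt
    simp only [IsFixedPt] at this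
    exact (sub_eq_iff_eq_add.1 this).symm
  have h := lintegral_image_eq_lintegral_abs_det_fderiv_mul (μ := volume) (f := fun x => x + g x)
    (f' := fun x => 1 + g' x) MeasurableSet.univ
    (fun x _ => ((hasFDerivAt_id x).add (hg' x)).hasFDerivWithinAt) hinj.injOn F
  rw [image_univ, hsurj.range_eq, Measure.restrict_univ] at h
  exact h.symm

/-- The two one-sided maps of a generating function, with mixed second derivative `M`, push the
same measure `|det (1 + M)| dx dp` forward to Lebesgue measure. -/
theorem measurePreserving_generating {Gv Gw : E × E → E} {M : E × E → E →L[ℝ] E}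
    {c : NNReal} (hc : c < 1) (hGv : Continuous Gv) (hGw : Continuous Gw)
    (hv : ∀ p, LipschitzWith c fun x => Gv (x, p)) (hw : ∀ x, LipschitzWith c fun p => Gw (x, p))
    (hv' : ∀ z : E × E, HasFDerivAt (fun x => Gv (x, z.2)) (M z) z.1)
    (hw' : ∀ z : E × E, HasFDerivAt (fun p => Gw (z.1, p)) (ContinuousLinearMap.adjoint (M z)) z.2) :
    ∃ ν : Measure (E × E),
      MeasurePreserving (fun z => (z.1 + Gv z, z.2)) ν volume ∧
      MeasurePreserving (fun z => (z.1, z.2 + Gw z)) ν volume := by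
  -- M is a partial derivative of a jointly continuous function, hence measurable in both variables
  -- without being continuous.
  have hM : Measurable M := by
    have h1 : Measurable fun q : E × E => fderiv ℝ ((fun p x => Gv (x, p)) q.1) q.2 :=
      measurable_fderiv_with_param ℝ (f := fun p x => Gv (x, p))
        (hGv.comp continuous_swap)
    have h2 : M = fun z : E × E => fderiv ℝ (fun x => Gv (x, z.2)) z.1 :=
      funext fun z => (hv' z).fderiv.symm
    rw [h2]
    exact h1.comp measurable_swap
  have hJ : Measurable fun z => ENNReal.ofReal |(1 + M z).det| := by
    refine ENNReal.measurable_ofReal.comp (continuous_abs.measurable.comp ?_)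
    exact ContinuousLinearMap.continuous_det.measurable.comp (hM.const_add 1)
  have hVm : Measurable fun z : E × E => (z.1 + Gv z, z.2) := by fun_prop
  have hUm : Measurable fun z : E × E => (z.1, z.2 + Gw z) := by fun_prop
  refine ⟨volume.withDensity fun z => ENNReal.ofReal |(1 + M z).det|, ⟨hVm, ?_⟩, ⟨hUm, ?_⟩⟩
  · refine Measure.ext_of_lintegral _ fun F hF => ?_
    rw [lintegral_map hF hVm]
    refine (lintegral_withDensity_eq_lintegral_mul volume hJ (hF.comp hVm)).trans ?_
    -- With p frozen the map only moves x, so Fubini reduces the claim to the identity plus a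
    -- contraction on E. The other map is treated in the same way with x frozen.
    rw [Measure.volume_eq_prod, lintegral_prod_symm _ (hJ.mul (hF.comp hVm)).aemeasurable,
      lintegral_prod_symm _ hF.aemeasurable]
    refine lintegral_congr fun p => ?_
    exact lintegral_comp_id_add hc (hv p) (g' := fun x => M (x, p)) (fun x => hv' (x, p))
      (fun x => F (x, p))
  · refine Measure.ext_of_lintegral _ fun F hF => ?_
    rw [lintegral_map hF hUm]
    refine (lintegral_withDensity_eq_lintegral_mul volume hJ (hF.comp hUm)).trans ?_
    rw [Measure.volume_eq_prod, lintegral_prod _ (hJ.mul (hF.comp hUm)).aemeasurable,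
      lintegral_prod _ hF.aemeasurable]
    refine lintegral_congr fun x => ?_
    rw [← lintegral_comp_id_add hc (hw x) (g' := fun p => ContinuousLinearMap.adjoint (M (x, p)))
      (fun p => hw' (x, p)) (fun p => F (x, p))]
    simp only [det_one_add_adjoint]
    rfl

end ChangeOfVariables

/-! ### Lipschitz test functions determine a measure -/

section ExtLipschitz

variable {X : Type*} [NormedAddCommGroup X] [NormedSpace ℝ X] [FiniteDimensional ℝ X]
  [MeasurableSpace X] [BorelSpace X]

/-- Locally finite measures are determined by the integrals of compactly supported Lipschitz
functions. -/
theorem measure_ext_of_integral_lipschitz (μ ν : Measure X) [IsLocallyFiniteMeasure μ]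
    [IsLocallyFiniteMeasure ν]
    (h : ∀ (ψ : X → ℝ) (L : NNReal), LipschitzWith L ψ → HasCompactSupport ψ →
      ∫ z, ψ z ∂μ = ∫ z, ψ z ∂ν) : μ = ν := by
  have : ProperSpace X := FiniteDimensional.proper ℝ X
  apply Measure.OuterRegular.ext_isOpen
  apply Measure.InnerRegularWRT.eq_of_innerRegularWRT_of_forall_eq Measure.Regular.innerRegular
    Measure.Regular.innerRegular
  intro K hK
  -- Thickened indicators of a compact K are Lipschitz, vanish off the fixed compact 1-thickening,
  -- and converge pointwise to the indicator of K; inner regularity reduces the claim to such sets.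
  have hδ : ∀ n : ℕ, (0 : ℝ) < 1 / (n + 1) := fun n => by positivity
  let ψ : ℕ → X → ℝ := fun n z => thickenedIndicator (hδ n) K z
  have hψlip : ∀ n, ∃ L, LipschitzWith L (ψ n) := fun n =>
    ⟨_, LipschitzWith.comp (g := fun z => thickenedIndicator (hδ n) K z)
      (f := ((↑) : NNReal → ℝ)) (Kf := 1)
      (LipschitzWith.of_dist_le_mul fun x y => by rw [NNReal.dist_eq, Real.dist_eq]; simp)
      (lipschitzWith_thickenedIndicator (hδ n) K)⟩
  have hzero : ∀ n z, z ∉ Metric.cthickening 1 K → ψ n z = 0 := by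
    intro n z hz
    simp only [ψ, NNReal.coe_eq_zero]
    refine thickenedIndicator_zero (hδ n) K fun hz' => hz ?_
    refine Metric.thickening_subset_cthickening _ _ (Metric.thickening_mono ?_ K hz')
    rw [div_le_one (by positivity)]
    linarith [n.cast_nonneg (α := ℝ)]
  have hcomp : IsCompact (Metric.cthickening 1 K) := hK.cthickening
  have hlim : ∀ (μ : Measure X) [IsLocallyFiniteMeasure μ],
      Tendsto (fun n => ∫ z, ψ n z ∂μ) atTop (𝓝 (μ.real K)) := by
    intro μ _
    rw [← integral_indicator_one hK.measurableSet]
    refine tendsto_integral_of_dominated_convergence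
      ((Metric.cthickening 1 K).indicator fun _ => 1) ?_ ?_ ?_ ?_
    · intro n
      obtain ⟨L, hL⟩ := hψlip n
      exact hL.continuous.aestronglyMeasurable
    · rw [integrable_indicator_iff hcomp.measurableSet]
      exact integrableOn_const hcomp.measure_lt_top.ne
    · intro n
      refine ae_of_all _ fun z => ?_
      by_cases hz : z ∈ Metric.cthickening 1 K
      · rw [indicator_of_mem hz, Real.norm_of_nonneg (NNReal.coe_nonneg _)]
        exact_mod_cast thickenedIndicator_le_one (hδ n) K z
      · rw [hzero n z hz, indicator_of_notMem hz, norm_zero]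
    · refine ae_of_all _ fun z => ?_
      have h1 := thickenedIndicator_tendsto_indicator_closure hδ
        tendsto_one_div_add_atTop_nhds_zero_nat K
      rw [tendsto_pi_nhds] at h1
      have h2 := (NNReal.continuous_coe.tendsto _).comp (h1 z)
      rw [hK.isClosed.closure_eq] at h2
      refine h2.congr_dist ?_ |>.trans ?_
      · simp [ψ]
      · refine le_of_eq ?_
        congr 1
        by_cases hz : z ∈ K <;> simp [hz]
  have heq : μ.real K = ν.real K := by
    refine tendsto_nhds_unique (hlim μ) ?_
    refine (hlim ν).congr fun n => ?_
    obtain ⟨L, hL⟩ := hψlip n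
    exact (h (ψ n) L hL (HasCompactSupport.intro hcomp fun z hz => hzero n z hz)).symm
  rw [measureReal_def, measureReal_def,
    ENNReal.toReal_eq_toReal_iff' hK.measure_lt_top.ne hK.measure_lt_top.ne] at heq
  exact heq

end ExtLipschitz

end VlasovDarwin

namespace VlasovDarwin

open Filter Topology Function

theorem IsOdeFlow.integral_eq {E : Type*} [NormedAddCommGroup E] [NormedSpace ℝ E]
    [CompleteSpace E] {I : Set ℝ} [hI : I.OrdConnected] {C : ℝ} {b : ℝ → E → E}
    {Z : ℝ → ℝ → E → E} (hZ : IsOdeFlow I b Z) (hb : LogLipField I C b) {s s' t : ℝ}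
    (hs : s ∈ I) (hs' : s' ∈ I) (ht : t ∈ I) (z : E) :
    ContinuousOn (fun r => b r (Z r t z)) I ∧
      ∫ r in s..s', b r (Z r t z) = Z s' t z - Z s t z := by
  have hsub := hI.uIcc_subset hs hs'
  have hc : ContinuousOn (fun r => b r (Z r t z)) I :=
    ODE.continuousOn_comp hb.cont (fun r hr => (hZ.solves t ht z r hr).continuousWithinAt)
      (fun _ _ => mem_univ _)
  refine ⟨hc, intervalIntegral.integral_eq_sub_of_hasDeriv_right (f := fun r => Z r t z)
    (fun r hr => ((hZ.solves t ht z r (hsub hr)).mono hsub).continuousWithinAt)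
    (fun r hr => ?_) ((hc.mono hsub).intervalIntegrable)⟩
  have hr' : uIcc s s' ∈ 𝓝 r := Icc_mem_nhds hr.1 hr.2
  exact (((hZ.solves t ht z r (hsub (Ioo_subset_Icc_self hr))).mono hsub).hasDerivAt
    hr').hasDerivWithinAt

/-! ### One short time step compared with a generating function -/

section Liouville

variable {E : Type*} [NormedAddCommGroup E] [InnerProductSpace ℝ E] [FiniteDimensional ℝ E]

/-- A field `(v, w)` on `E × E` with `∂ₓ v = D = -(∂ₚ w)*`: the Hamiltonian structure that makes
the field divergence free, stated without second derivatives of a Hamiltonian. -/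
structure SkewField (I : Set ℝ) (K : ℝ) (b : ℝ → E × E → E × E) (D : ℝ → E × E → E →L[ℝ] E) :
    Prop where
  nonneg : 0 ≤ K
  deriv_fst : ∀ t ∈ I, ∀ z : E × E, HasFDerivAt (fun x => (b t (x, z.2)).1) (D t z) z.1
  deriv_snd : ∀ t ∈ I, ∀ z : E × E,
    HasFDerivAt (fun p => (b t (z.1, p)).2) (-ContinuousLinearMap.adjoint (D t z)) z.2
  bound : ∀ t ∈ I, ∀ z, ‖D t z‖ ≤ K
  cont : ∀ z, ContinuousOn (fun t => D t z) I

variable {I : Set ℝ} [hI : I.OrdConnected] {C K : ℝ}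
  {b : ℝ → E × E → E × E} {D : ℝ → E × E → E →L[ℝ] E} {Z : ℝ → ℝ → E × E → E × E}

theorem LogLipField.continuousOn_time {F : Type*} [NormedAddCommGroup F] {I : Set ℝ} {C : ℝ}
    {b : ℝ → F → F} (hb : LogLipField I C b) (z : F) : ContinuousOn (fun t => b t z) I :=
  hb.cont.comp (f := fun t => (t, z)) (by fun_prop) (fun _ ht => ⟨ht, mem_univ _⟩)

/-- The field is integrated in time at a frozen point of phase space. By the skew structure the
x-derivative of the first component is ∫ D, and the p-derivative of minus the second is the adjoint
of the same operator, so `measurePreserving_generating` applies. The condition on the length of the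
step gives ∫ D norm at most 1/2, hence the contractions. -/
theorem SkewField.exists_measurePreserving [MeasurableSpace E] [BorelSpace E] (hD : SkewField I K b D) (hb : LogLipField I C b)
    {s s' : ℝ} (hs : s ∈ I) (hs' : s' ∈ I) (hss : s ≤ s') (hK : K * (s' - s) ≤ 1 / 2) :
    ∃ ν : Measure (E × E),
      MeasurePreserving (fun z => (z.1 + (∫ r in s..s', b r z).1, z.2)) ν volume ∧
      MeasurePreserving (fun z => (z.1, z.2 + -(∫ r in s..s', b r z).2)) ν volume := by
  have hsub : uIoc s s' ⊆ I := uIoc_subset_uIcc.trans (hI.uIcc_subset hs hs')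
  have hmeas : ∀ z, AEStronglyMeasurable (fun r => b r z) (volume.restrict (uIoc s s')) :=
    fun z => ((hb.continuousOn_time z).mono hsub).aestronglyMeasurable measurableSet_uIoc
  have hint : ∀ z, IntervalIntegrable (fun r => b r z) volume s s' := fun z =>
    ((hb.continuousOn_time z).mono (hI.uIcc_subset hs hs')).intervalIntegrable
  have hcont : Continuous fun z => ∫ r in s..s', b r z := by
    refine intervalIntegral.continuous_of_dominated_interval (bound := fun _ => C) hmeas
      (fun z => ae_of_all _ fun r hr => hb.bound r (hsub hr) z) intervalIntegrable_const
      (ae_of_all _ fun r hr => hb.continuous_slice (hsub hr))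
  have hfst : ∀ z, (∫ r in s..s', b r z).1 = ∫ r in s..s', (b r z).1 := fun z =>
    ((ContinuousLinearMap.fst ℝ E E).intervalIntegral_comp_comm (hint z)).symm
  have hsnd : ∀ z, (∫ r in s..s', b r z).2 = ∫ r in s..s', (b r z).2 := fun z =>
    ((ContinuousLinearMap.snd ℝ E E).intervalIntegral_comp_comm (hint z)).symm
  have hintD : ∀ z, IntervalIntegrable (fun r => D r z) volume s s' := fun z =>
    ((hD.cont z).mono (hI.uIcc_subset hs hs')).intervalIntegrable
  have hMbound : ∀ z, ‖∫ r in s..s', D r z‖ ≤ K * (s' - s) := fun z => by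
    rw [← abs_of_nonneg (sub_nonneg.2 hss)]
    exact intervalIntegral.norm_integral_le_of_norm_le_const fun r hr => hD.bound r (hsub hr) z
  have hv' : ∀ z : E × E, HasFDerivAt (fun x => (∫ r in s..s', b r (x, z.2)).1)
      (∫ r in s..s', D r z) z.1 := by
    intro z
    simp only [hfst]
    refine intervalIntegral.hasFDerivAt_integral_of_dominated_of_fderiv_le
      (F := fun x r => (b r (x, z.2)).1) (F' := fun x r => D r (x, z.2)) (bound := fun _ => K)
      univ_mem (Eventually.of_forall fun x => (hmeas _).fst)
      ((continuous_fst.comp_continuousOn ((hb.continuousOn_time z).mono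
        (hI.uIcc_subset hs hs'))).intervalIntegrable)
      (((hD.cont z).mono hsub).aestronglyMeasurable measurableSet_uIoc)
      (ae_of_all _ fun r hr x _ => hD.bound r (hsub hr) _) intervalIntegrable_const
      (ae_of_all _ fun r hr x _ => hD.deriv_fst r (hsub hr) (x, z.2))
  have hw' : ∀ z : E × E, HasFDerivAt (fun p => -(∫ r in s..s', b r (z.1, p)).2)
      (ContinuousLinearMap.adjoint (∫ r in s..s', D r z)) z.2 := by
    intro z
    simp only [hsnd]
    have h1 : HasFDerivAt (fun p => ∫ r in s..s', (b r (z.1, p)).2)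
        (∫ r in s..s', -ContinuousLinearMap.adjoint (D r z)) z.2 :=
      intervalIntegral.hasFDerivAt_integral_of_dominated_of_fderiv_le
        (F := fun p r => (b r (z.1, p)).2)
        (F' := fun p r => -ContinuousLinearMap.adjoint (D r (z.1, p))) (bound := fun _ => K)
        univ_mem (Eventually.of_forall fun p => (hmeas _).snd)
        ((continuous_snd.comp_continuousOn ((hb.continuousOn_time z).mono
          (hI.uIcc_subset hs hs'))).intervalIntegrable)
        ((((ContinuousLinearMap.adjoint (𝕜 := ℝ) (E := E) (F := E)).continuous.comp_continuousOn
          (hD.cont z)).neg.mono hsub).aestronglyMeasurable measurableSet_uIoc)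
        (ae_of_all _ fun r hr p _ => by
          rw [norm_neg, LinearIsometryEquiv.norm_map]; exact hD.bound r (hsub hr) _)
        intervalIntegrable_const
        (ae_of_all _ fun r hr p _ => hD.deriv_snd r (hsub hr) (z.1, p))
    refine h1.neg.congr_fderiv ?_
    rw [intervalIntegral.integral_neg, neg_neg]
    let L : (E →L[ℝ] E) →L[ℝ] (E →L[ℝ] E) :=
      { toFun := fun A => ContinuousLinearMap.adjoint A
        map_add' := fun A B => map_add _ A B
        map_smul' := fun c A => by simp
        cont := (ContinuousLinearMap.adjoint (𝕜 := ℝ) (E := E) (F := E)).continuous }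
    exact L.intervalIntegral_comp_comm (hintD z)
  have hlip : ∀ (f : E → E) (f' : E → E →L[ℝ] E), (∀ x, HasFDerivAt f (f' x) x) →
      (∀ x, ‖f' x‖ ≤ 1 / 2) → LipschitzWith (1 / 2) f := by
    intro f f' hf hf'
    refine lipschitzWith_of_nnnorm_fderiv_le (fun x => (hf x).differentiableAt) fun x => ?_
    rw [(hf x).fderiv]
    exact_mod_cast hf' x
  refine measurePreserving_generating (Gv := fun z => (∫ r in s..s', b r z).1)
    (Gw := fun z => -(∫ r in s..s', b r z).2) (M := fun z => ∫ r in s..s', D r z)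
    (c := 1 / 2) (by exact NNReal.half_lt_self one_ne_zero) (by fun_prop) (by fun_prop)
    (fun p => hlip _ _ (fun x => hv' (x, p)) fun x => (hMbound _).trans hK)
    (fun x => hlip _ _ (fun p => hw' (x, p)) fun p => ?_) hv' hw'
  rw [LinearIsometryEquiv.norm_map]
  exact (hMbound _).trans hK

/-- Adding the full integral of b(r, w) to the starting point (the image of w under the second map)
gives exactly the image of w under the first. So the error is the integral of b(r, Z r) - b(r, w),
taken at points at distance at most 2 C h for a step of length h. With e⁻ᴺ = h it is of order h²
log(1/h). -/
theorem IsOdeFlow.norm_sub_generating_le (hZ : IsOdeFlow I b Z) (hb : LogLipField I C b)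
    {s s' N : ℝ} (hs : s ∈ I) (hs' : s' ∈ I) (hss : s ≤ s') (hN : 0 ≤ N) (w : E × E) :
    ‖Z s' s (w.1, w.2 + -(∫ r in s..s', b r w).2) - (w.1 + (∫ r in s..s', b r w).1, w.2)‖ ≤
      C * (N * (2 * C * (s' - s)) + Real.exp (-N)) * (s' - s) := by
  have hsub : uIcc s s' ⊆ I := hI.uIcc_subset hs hs'
  have hint : IntervalIntegrable (fun r => b r w) volume s s' :=
    ((hb.continuousOn_time w).mono hsub).intervalIntegrable
  set u : E × E := (w.1, w.2 + -(∫ r in s..s', b r w).2) with hu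
  obtain ⟨hc, he⟩ := hZ.integral_eq hb hs hs' hs u
  have hBle : ‖∫ r in s..s', b r w‖ ≤ C * (s' - s) := by
    rw [← abs_of_nonneg (sub_nonneg.2 hss)]
    exact intervalIntegral.norm_integral_le_of_norm_le_const fun r hr =>
      hb.bound r (hsub (uIoc_subset_uIcc hr)) w
  have huw : ‖u - w‖ ≤ C * (s' - s) := by
    refine le_trans ?_ hBle
    rw [hu, Prod.norm_def, Prod.norm_def]
    simp only [Prod.fst_sub, Prod.snd_sub, sub_self, norm_zero, add_sub_cancel_left, norm_neg]
    exact max_le (le_max_of_le_left (norm_nonneg _)) (le_max_right _ _)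
  have hdiff : Z s' s u - (w.1 + (∫ r in s..s', b r w).1, w.2) =
      ∫ r in s..s', (b r (Z r s u) - b r w) := by
    rw [intervalIntegral.integral_sub ((hc.mono hsub).intervalIntegrable) hint, he,
      hZ.initial s hs, sub_sub]
    congr 1
    rw [hu]
    ext <;> simp
  rw [hdiff]
  rw [← abs_of_nonneg (sub_nonneg.2 hss)]
  refine intervalIntegral.norm_integral_le_of_norm_le_const fun r hr => ?_
  rw [abs_of_nonneg (sub_nonneg.2 hss)]
  have hrI := hsub (uIoc_subset_uIcc hr)
  rw [uIoc_of_le hss] at hr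
  refine (hb.logLip r hrI N hN _ _).trans ?_
  have hC := hb.nonneg
  gcongr
  calc ‖Z r s u - w‖ ≤ ‖Z r s u - u‖ + ‖u - w‖ := norm_sub_le_norm_sub_add_norm_sub _ _ _
    _ ≤ C * (s' - s) + C * (s' - s) := by
        gcongr
        refine (hZ.norm_sub_self_le hb hrI hs u).trans ?_
        rw [abs_of_nonneg (by linarith [hr.1])]
        gcongr
        exact hr.2
    _ = _ := by ring

end Liouville

end VlasovDarwin

namespace VlasovDarwin

open Filter Topology Function

/-! ### Short steps summed up to Liouville's theorem -/

section Liouville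

variable {E : Type*} [NormedAddCommGroup E] [InnerProductSpace ℝ E] [FiniteDimensional ℝ E]
  [MeasurableSpace E] [BorelSpace E] {I : Set ℝ} [hI : I.OrdConnected] {C K : ℝ}
  {b : ℝ → E × E → E × E} {D : ℝ → E × E → E →L[ℝ] E} {Z : ℝ → ℝ → E × E → E × E}

/-- The integral of a Lipschitz function transported for a short time by the flow is Hölder
continuous in time with exponent greater than one. -/
theorem IsOdeFlow.abs_integral_sub_le (hZ : IsOdeFlow I b Z) (hb : LogLipField I C b)
    (hD : SkewField I K b D) {τ : ℝ} (hτ : 4 / 5 ≤ Real.exp (-C * τ)) {ψ : E × E → ℝ} {L : NNReal}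
    (hψ : LipschitzWith L ψ) (hψc : HasCompactSupport ψ) {t : ℝ} (ht : t ∈ I) :
    ∃ B N₀ : ℝ, 0 ≤ B ∧ ∀ N, N₀ ≤ N → ∀ s ∈ I, ∀ s' ∈ I, |t - s| ≤ τ → |t - s'| ≤ τ →
      s' - s = Real.exp (-N) →
      |(∫ z, ψ (Z t s' z)) - ∫ z, ψ (Z t s z)| ≤ B * Real.exp (-(7 / 5) * N) := by
  have hC := hb.nonneg
  obtain ⟨R, hR0, hR⟩ : ∃ R, 0 ≤ R ∧ ∀ z, ψ z ≠ 0 → ‖z‖ ≤ R := by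
    obtain ⟨R, hR⟩ := hψc.isCompact.isBounded.exists_norm_le
    exact ⟨max R 0, le_max_right _ _, fun z hz =>
      (hR z (subset_tsupport _ hz)).trans (le_max_left _ _)⟩
  -- Outside V⁻¹ S both transported functions vanish: the flow moves points by at most C τ, and U w
  -- and V w are at most C apart because the step is no longer than one. The ν-mass of V⁻¹ S is the
  -- volume of S.
  let S : Set (E × E) := Metric.closedBall 0 (R + C * τ + C)
  have hS : volume S < ⊤ := measure_closedBall_lt_top
  -- A factor h^{1/4} of the step error h² log(1/h) is spent on the logarithm and the constants,
  -- leaving h^{7/4} for small h = e⁻ᴺ.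
  have hlim : Tendsto (fun N : ℝ => C * (2 * C * (N * Real.exp (-(1 / 4) * N)) +
      Real.exp (-(1 / 4) * N))) atTop (𝓝 (C * (2 * C * 0 + 0))) := by
    have e2 : Tendsto (fun N : ℝ => Real.exp (-(1 / 4) * N)) atTop (𝓝 0) := by
      refine Real.tendsto_exp_atBot.comp ?_
      exact tendsto_id.const_mul_atTop_of_neg (by norm_num)
    have e1 : Tendsto (fun N : ℝ => N * Real.exp (-(1 / 4) * N)) atTop (𝓝 0) := by
      have h := ((Real.tendsto_pow_mul_exp_neg_atTop_nhds_zero 1).comp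
        (tendsto_id.const_mul_atTop (by norm_num : (0 : ℝ) < 1 / 4))).const_mul 4
      rw [mul_zero] at h
      refine h.congr fun N => ?_
      simp only [Function.comp_apply, id, pow_one, neg_mul]
      ring
    exact ((e1.const_mul (2 * C)).add e2).const_mul C
  simp only [mul_zero, add_zero] at hlim
  have hlimK : Tendsto (fun N : ℝ => K * Real.exp (-N)) atTop (𝓝 (K * 0)) :=
    Real.tendsto_exp_neg_atTop_nhds_zero.const_mul K
  rw [mul_zero] at hlimK
  obtain ⟨N₀, hN₀⟩ := eventually_atTop.1 ((eventually_ge_atTop 0).and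
    ((hlim.eventually (ge_mem_nhds one_pos)).and
      (hlimK.eventually (ge_mem_nhds (by norm_num : (0 : ℝ) < 1 / 2)))))
  refine ⟨L * (1 + (C + 2) * |τ|) * volume.real S, N₀, by positivity, ?_⟩
  intro N hNN s hs s' hs' hts hts' hss
  obtain ⟨hN, hN1, hN2⟩ := hN₀ N hNN
  have hexp1 : Real.exp (-N) ≤ 1 := Real.exp_le_one_iff.2 (by linarith)
  have hss' : s ≤ s' := by linarith [Real.exp_pos (-N)]
  have hτ0 : 0 ≤ τ := (abs_nonneg _).trans hts
  obtain ⟨ν, hV, hU⟩ := hD.exists_measurePreserving hb hs hs' hss' (by rw [hss]; exact hN2)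
  set V : E × E → E × E := fun z => (z.1 + (∫ r in s..s', b r z).1, z.2) with hVdef
  set U : E × E → E × E := fun z => (z.1, z.2 + -(∫ r in s..s', b r z).2) with hUdef
  have hUV : ∀ w, ‖Z s' s (U w) - V w‖ ≤ Real.exp (-(7 / 4 * N)) := by
    intro w
    refine (hZ.norm_sub_generating_le hb hs hs' hss' hN w).trans ?_
    rw [hss]
    have e1 : Real.exp (-N) = Real.exp (-(1 / 4) * N) * Real.exp (-(3 / 4 * N)) := by
      rw [← Real.exp_add]; ring_nf
    have e2 : Real.exp (-(7 / 4 * N)) = Real.exp (-N) * Real.exp (-(3 / 4 * N)) := by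
      rw [← Real.exp_add]; ring_nf
    calc C * (N * (2 * C * Real.exp (-N)) + Real.exp (-N)) * Real.exp (-N)
        = (C * (2 * C * (N * Real.exp (-(1 / 4) * N)) + Real.exp (-(1 / 4) * N)))
            * (Real.exp (-N) * Real.exp (-(3 / 4 * N))) := by
          nth_rewrite 1 2 [e1]; ring
      _ ≤ 1 * (Real.exp (-N) * Real.exp (-(3 / 4 * N))) := by gcongr
      _ = _ := by rw [e2, one_mul]
  -- By composition, ψ at time s starting from U w is ψ at time s' starting from the flow image of U
  -- w, which is within h^{7/4} of V w. The remaining flow is Hölder with exponent at least 4/5 by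
  -- the choice of τ, and 7/4 · 4/5 = 7/5 exceeds one.
  have hdiff : ∀ w, |ψ (Z t s' (V w)) - ψ (Z t s (U w))| ≤
      L * ((1 + (C + 2) * |τ|) * Real.exp (-(7 / 5) * N)) := by
    intro w
    rw [← hZ.comp hb ht hs' hs (U w), ← Real.dist_eq, dist_comm]
    refine (hψ.dist_le_mul _ _).trans ?_
    gcongr
    rw [dist_eq_norm]
    refine (hZ.dist_le_osgood hb ht hs' (by positivity) (hUV w)).trans ?_
    refine (osgood_mono hC (abs_nonneg _) hts' (by positivity)).trans ?_
    unfold osgood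
    refine mul_le_mul ?_ (Real.exp_le_exp.2 (by nlinarith)) (Real.exp_pos _).le (by positivity)
    gcongr
    exact le_abs_self τ
  have hz0 : ∀ w, w ∉ V ⁻¹' S → ψ (Z t s' (V w)) - ψ (Z t s (U w)) = 0 := by
    intro w hw
    simp only [S, mem_preimage, Metric.mem_closedBall, dist_zero_right, not_le] at hw
    have h1 : ψ (Z t s' (V w)) = 0 := by
      by_contra h
      have e1 := hR _ h
      have e2 := hZ.norm_sub_self_le hb ht hs' (V w)
      have e3 := norm_le_norm_add_norm_sub (Z t s' (V w)) (V w)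
      have e4 : C * |t - s'| ≤ C * τ := by gcongr
      linarith
    have h2 : ψ (Z t s (U w)) = 0 := by
      by_contra h
      have e1 := hR _ h
      have e2 := hZ.norm_sub_self_le hb ht hs (U w)
      have e3 := norm_le_norm_add_norm_sub (Z t s (U w)) (U w)
      have e4 : C * |t - s| ≤ C * τ := by gcongr
      have e5 : ‖V w - U w‖ ≤ C := by
        have hB : V w - U w = ∫ r in s..s', b r w := by
          ext <;> simp [hVdef, hUdef]
        rw [hB]
        refine (intervalIntegral.norm_integral_le_of_norm_le_const (C := C) fun r hr =>
          hb.bound r (hI.uIcc_subset hs hs' (uIoc_subset_uIcc hr)) w).trans ?_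
        rw [hss, abs_of_pos (Real.exp_pos _)]
        exact mul_le_of_le_one_right hC hexp1
      have e6 := norm_le_norm_add_norm_sub (U w) (V w)
      rw [norm_sub_rev] at e6
      linarith
    rw [h1, h2, sub_zero]
  have hmeas : ∀ r ∈ I, Continuous fun z => ψ (Z t r z) := fun r hr =>
    hψ.continuous.comp (hZ.continuous hb ht hr)
  have hcomp : ∀ r ∈ I, Integrable fun z => ψ (Z t r z) := fun r hr =>
    (hmeas r hr).integrable_of_hasCompactSupport
      (hψc.comp_homeomorph (hZ.homeomorph hb ht hr))
  -- Both integrals are pulled back to the common measure ν, one by V and the other by U, after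
  -- which the integrands can be compared pointwise.
  have hI1 : ∫ z, ψ (Z t s' z) = ∫ w, ψ (Z t s' (V w)) ∂ν := by
    rw [← hV.map_eq, integral_map hV.aemeasurable (hmeas s' hs').aestronglyMeasurable]
  have hI2 : ∫ z, ψ (Z t s z) = ∫ w, ψ (Z t s (U w)) ∂ν := by
    rw [← hU.map_eq, integral_map hU.aemeasurable (hmeas s hs).aestronglyMeasurable]
  have hi1 : Integrable (fun w => ψ (Z t s' (V w))) ν :=
    hV.integrable_comp_of_integrable (hcomp s' hs')
  have hi2 : Integrable (fun w => ψ (Z t s (U w))) ν :=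
    hU.integrable_comp_of_integrable (hcomp s hs)
  have hSm : MeasurableSet S := Metric.isClosed_closedBall.measurableSet
  have hνS : ν (V ⁻¹' S) = volume S := hV.measure_preimage hSm.nullMeasurableSet
  rw [hI1, hI2, ← integral_sub hi1 hi2, ← setIntegral_eq_integral_of_forall_compl_eq_zero hz0,
    ← Real.norm_eq_abs]
  refine (norm_setIntegral_le_of_norm_le_const (by rw [hνS]; exact hS) fun w _ => hdiff w).trans ?_
  rw [measureReal_def, hνS, measureReal_def]
  exact le_of_eq (by ring)

/-- For a Lipschitz ψ of compact support the increments of r ↦ ∫ ψ(Z t r z) dz are of order |r' -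
r|^{7/5}. The derivative is therefore zero and the function constant, and at r = t it equals ∫ ψ. No
derivative of the flow in z is ever formed. -/
theorem IsOdeFlow.measurePreserving_of_short (hZ : IsOdeFlow I b Z) (hb : LogLipField I C b)
    (hD : SkewField I K b D) {τ : ℝ} (hτ : 4 / 5 ≤ Real.exp (-C * τ)) {s t : ℝ} (hs : s ∈ I)
    (ht : t ∈ I) (hst : |t - s| ≤ τ) : MeasurePreserving (Z t s) volume volume := by
  refine ⟨(hZ.continuous hb ht hs).measurable, ?_⟩
  have hlf : IsLocallyFiniteMeasure (Measure.map (Z t s) volume) := by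
    refine ⟨fun z => ⟨Metric.ball z 1, Metric.ball_mem_nhds z one_pos, ?_⟩⟩
    rw [Measure.map_apply (hZ.continuous hb ht hs).measurable measurableSet_ball]
    refine lt_of_le_of_lt (measure_mono (t := Z s t '' Metric.closedBall z 1) ?_)
      ((isCompact_closedBall z 1).image (hZ.continuous hb hs ht)).measure_lt_top
    intro w hw
    exact ⟨Z t s w, Metric.ball_subset_closedBall hw, hZ.inv hb hs ht w⟩
  refine measure_ext_of_integral_lipschitz _ _ fun ψ L hψ hψc => ?_
  rw [integral_map (hZ.continuous hb ht hs).aemeasurable hψ.continuous.aestronglyMeasurable]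
  obtain ⟨B, N₀, hB, hN₀⟩ := hZ.abs_integral_sub_le hb hD hτ hψ hψc ht
  let J : Set ℝ := uIcc s t
  have hJI : J ⊆ I := hI.uIcc_subset hs ht
  have hJτ : ∀ r ∈ J, |t - r| ≤ τ := fun r hr => (abs_sub_right_of_mem_uIcc hr).trans hst
  have hbound : ∀ N, N₀ ≤ N → ∀ r ∈ J, ∀ r' ∈ J, |r' - r| = Real.exp (-N) →
      |(∫ z, ψ (Z t r' z)) - ∫ z, ψ (Z t r z)| ≤ B * Real.exp (-(7 / 5) * N) := by
    intro N hN r hr r' hr' hrr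
    rcases le_total r r' with h | h
    · rw [abs_of_nonneg (sub_nonneg.2 h)] at hrr
      exact hN₀ N hN r (hJI hr) r' (hJI hr') (hJτ r hr) (hJτ r' hr') hrr
    · rw [abs_of_nonpos (sub_nonpos.2 h), neg_sub] at hrr
      rw [abs_sub_comm]
      exact hN₀ N hN r' (hJI hr') r (hJI hr) (hJτ r' hr') (hJτ r hr) hrr
  have hder : ∀ r ∈ J, HasDerivWithinAt (fun r => ∫ z, ψ (Z t r z)) 0 J r := by
    intro r hr
    rw [hasDerivWithinAt_iff_isLittleO, Asymptotics.isLittleO_iff]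
    intro ε hε
    have hlim : Tendsto (fun N : ℝ => B * Real.exp (-(2 / 5) * N)) atTop (𝓝 (B * 0)) := by
      refine Tendsto.const_mul B (Real.tendsto_exp_atBot.comp ?_)
      exact tendsto_id.const_mul_atTop_of_neg (by norm_num)
    rw [mul_zero] at hlim
    obtain ⟨N₁, hN₁⟩ := eventually_atTop.1
      ((eventually_ge_atTop N₀).and (hlim.eventually (ge_mem_nhds hε)))
    filter_upwards [self_mem_nhdsWithin,
      mem_nhdsWithin_of_mem_nhds (Metric.ball_mem_nhds r (Real.exp_pos (-N₁)))] with r' hr' hrb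
    rw [smul_zero, sub_zero]
    rcases eq_or_ne r' r with rfl | hne
    · simp
    · have hpos : 0 < |r' - r| := abs_pos.2 (sub_ne_zero.2 hne)
      have hNe : |r' - r| = Real.exp (-(-Real.log |r' - r|)) := by rw [neg_neg, Real.exp_log hpos]
      set N := -Real.log |r' - r|
      have hNN : N₁ ≤ N := by
        rw [Metric.mem_ball, Real.dist_eq, hNe, Real.exp_lt_exp] at hrb
        linarith
      rw [Real.norm_eq_abs, Real.norm_eq_abs]
      refine (hbound N (hN₁ N hNN).1 r hr r' hr' hNe).trans ?_
      have e : Real.exp (-(7 / 5) * N) = Real.exp (-(2 / 5) * N) * Real.exp (-N) := by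
        rw [← Real.exp_add]; ring_nf
      rw [e, ← mul_assoc, hNe]
      gcongr
      exact (hN₁ N hNN).2
  have hconst := (convex_uIcc s t).norm_image_sub_le_of_norm_hasDerivWithin_le
    (f := fun r => ∫ z, ψ (Z t r z)) (f' := fun _ => 0) (C := 0) hder (by simp)
    left_mem_uIcc right_mem_uIcc
  rw [zero_mul, norm_le_zero_iff, sub_eq_zero] at hconst
  rw [← hconst]
  simp [hZ.initial t ht]

/-- **Liouville's theorem** for log-Lipschitz fields with Hamiltonian structure. -/
theorem IsOdeFlow.measurePreserving (hZ : IsOdeFlow I b Z) (hb : LogLipField I C b)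
    (hD : SkewField I K b D) {s t : ℝ} (hs : s ∈ I) (ht : t ∈ I) :
    MeasurePreserving (Z t s) volume volume := by
  obtain ⟨τ, hτ0, hτ⟩ : ∃ τ : ℝ, 0 < τ ∧ 4 / 5 ≤ Real.exp (-C * τ) := by
    have hC := hb.nonneg
    -- This gives C τ ≤ 1/5, and e^{-1/5} ≥ 1 - 1/5.
    refine ⟨1 / (5 * (C + 1)), by positivity, ?_⟩
    have h1 := Real.add_one_le_exp (-C * (1 / (5 * (C + 1))))
    have h2 : C * (1 / (5 * (C + 1))) ≤ 1 / 5 := by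
      rw [mul_one_div, div_le_div_iff₀ (by positivity) (by norm_num)]
      linarith
    linarith
  have key : ∀ n : ℕ, ∀ t ∈ I, |t - s| ≤ n * τ → MeasurePreserving (Z t s) volume volume := by
    intro n
    induction n with
    | zero =>
      intro t ht h
      refine hZ.measurePreserving_of_short hb hD hτ hs ht (h.trans ?_)
      simpa using hτ0.le
    | succ n ih =>
      intro t ht h
      -- The intermediate time leaves the fraction 1/(n + 1) of the way, a step of length at most τ,
      -- to the short-time theorem.
      let r := s + (n / (n + 1) : ℝ) * (t - s)
      have hn : (0 : ℝ) < n + 1 := by positivity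
      have h01 : (n / (n + 1) : ℝ) ≤ 1 := by rw [div_le_one hn]; linarith
      have hr : r ∈ I := by
        refine hI.convex.add_smul_sub_mem hs ht ⟨by positivity, h01⟩
      push_cast at h
      have hr1 : |r - s| ≤ n * τ := by
        have : r - s = (n / (n + 1) : ℝ) * (t - s) := by simp [r]
        rw [this, abs_mul, abs_of_nonneg (by positivity)]
        calc (n / (n + 1) : ℝ) * |t - s| ≤ (n / (n + 1) : ℝ) * ((n + 1) * τ) := by gcongr
          _ = n * τ := by field_simp
      have hr2 : |t - r| ≤ τ := by
        have : t - r = (1 / (n + 1) : ℝ) * (t - s) := by simp only [r]; field_simp; ring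
        rw [this, abs_mul, abs_of_nonneg (by positivity)]
        calc (1 / (n + 1) : ℝ) * |t - s| ≤ (1 / (n + 1) : ℝ) * ((n + 1) * τ) := by gcongr
          _ = τ := by field_simp
      have h1 := hZ.measurePreserving_of_short hb hD hτ hr ht hr2
      have h2 := h1.comp (ih r hr hr1)
      rwa [show Z t r ∘ Z r s = Z t s from funext fun z => hZ.comp hb ht hr hs z] at h2
  obtain ⟨n, hn⟩ := exists_nat_ge (|t - s| / τ)
  exact key n t ht ((div_le_iff₀ hτ0).1 hn)

end Liouville

end VlasovDarwin

namespace VlasovDarwin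

open Filter Topology Function

/-! ### Existence for the transport equation -/

theorem exists_ae_bound {α : Type*} [MeasurableSpace α] {μ : Measure α} {f : α → ℝ}
    (hf : MemLp f ⊤ μ) : ∃ M, 0 ≤ M ∧ ∀ᵐ z ∂μ, ‖f z‖ ≤ M := by
  refine ⟨(eLpNorm f ⊤ μ).toReal, ENNReal.toReal_nonneg, ?_⟩
  filter_upwards [ae_le_eLpNormEssSup (f := f) (μ := μ)] with z hz
  rw [eLpNorm_exponent_top] at *
  rw [← toReal_enorm]
  exact ENNReal.toReal_mono (by simpa using hf.eLpNorm_lt_top.ne) hz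

/-- A locally log-Lipschitz field on `[0,T[` together with its measure preserving flow. -/
structure LiouvilleFlow (T : ℝ) (b : ℝ → Phase → Phase) (Z : ℝ → ℝ → Phase → Phase) : Prop where
  field : ∀ t₁ ∈ Ico 0 T, ∃ C, LogLipField (Icc 0 t₁) C b
  flow : IsOdeFlow (Ico 0 T) b Z
  preserving : ∀ s ∈ Ico 0 T, ∀ t ∈ Ico 0 T, MeasurePreserving (Z s t) volume volume

namespace LiouvilleFlow

variable {T : ℝ} {b : ℝ → Phase → Phase} {Z : ℝ → ℝ → Phase → Phase}

theorem flow_Icc (h : LiouvilleFlow T b Z) {t₁ : ℝ} (ht₁ : t₁ ∈ Ico 0 T) :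
    IsOdeFlow (Icc 0 t₁) b Z :=
  h.flow.mono fun _ hs => ⟨hs.1, hs.2.trans_lt ht₁.2⟩

theorem comp (h : LiouvilleFlow T b Z) {r s t : ℝ} (hr : r ∈ Ico 0 T) (hs : s ∈ Ico 0 T)
    (ht : t ∈ Ico 0 T) (z : Phase) : Z r s (Z s t z) = Z r t z := by
  have hm : max r (max s t) ∈ Ico 0 T := ⟨le_max_of_le_left hr.1, max_lt hr.2 (max_lt hs.2 ht.2)⟩
  obtain ⟨C, hC⟩ := h.field _ hm
  exact (h.flow_Icc hm).comp hC ⟨hr.1, le_max_left _ _⟩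
    ⟨hs.1, le_max_of_le_right (le_max_left _ _)⟩ ⟨ht.1, le_max_of_le_right (le_max_right _ _)⟩ z

theorem inv (h : LiouvilleFlow T b Z) {s t : ℝ} (hs : s ∈ Ico 0 T)
    (ht : t ∈ Ico 0 T) (z : Phase) : Z s t (Z t s z) = z := by
  rw [h.comp hs ht hs, h.flow.initial s hs]

theorem continuous (h : LiouvilleFlow T b Z) {s t : ℝ} (hs : s ∈ Ico 0 T)
    (ht : t ∈ Ico 0 T) : Continuous (Z s t) := by
  have hm : max s t ∈ Ico 0 T := ⟨le_max_of_le_left hs.1, max_lt hs.2 ht.2⟩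
  obtain ⟨C, hC⟩ := h.field _ hm
  exact (h.flow_Icc hm).continuous hC ⟨hs.1, le_max_left _ _⟩ ⟨ht.1, le_max_right _ _⟩

theorem measurableEmbedding (h : LiouvilleFlow T b Z) {s t : ℝ} (hs : s ∈ Ico 0 T)
    (ht : t ∈ Ico 0 T) : MeasurableEmbedding (Z s t) :=
  (Homeomorph.mk (Equiv.mk (Z s t) (Z t s) (h.inv ht hs) (h.inv hs ht))
    (h.continuous hs ht) (h.continuous ht hs)).measurableEmbedding

/-- The change of variables `z = Z s t w`. -/
theorem integral_comp (h : LiouvilleFlow T b Z) {s t : ℝ} (hs : s ∈ Ico 0 T)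
    (ht : t ∈ Ico 0 T) {F : Type*} [NormedAddCommGroup F] [NormedSpace ℝ F] (g : Phase → F) :
    ∫ w, g (Z s t w) = ∫ z, g z :=
  (h.preserving s hs t ht).integral_comp (h.measurableEmbedding hs ht) g

/-- The change of variables puts the flow on the test function, where dominated convergence works if
that function is continuous with compact support. Such functions are dense in L¹, and the error is
uniform in t because composition with the flow preserves the essential bound of f₀. -/
theorem weakStarContinuous (h : LiouvilleFlow T b Z) {f₀ : Phase → ℝ} (hf1 : Integrable f₀)
    (hf : MemLp f₀ ⊤ volume) : WeakStarContinuous T (fun t z => f₀ (Z 0 t z)) := by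
  refine ⟨fun t ht => ?_, fun g hg => ?_⟩
  · have h0 : (0 : ℝ) ∈ Ico 0 T := ⟨le_rfl, ht.1.trans_lt ht.2⟩
    exact hf.comp_measurePreserving (h.preserving 0 h0 t ht)
  · rcases lt_or_ge 0 T with hT | hT
    swap
    · rw [Ico_eq_empty (not_lt.2 hT)]
      exact continuousOn_empty _
    have h0 : (0 : ℝ) ∈ Ico 0 T := ⟨le_rfl, hT⟩
    obtain ⟨M, hM0, hM⟩ := exists_ae_bound hf
    refine continuousOn_of_uniform_approx_of_continuousOn fun u hu => ?_
    obtain ⟨ε, hε, hεu⟩ := Metric.mem_uniformity_dist.1 hu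
    obtain ⟨g', hg'c, hg'd, hg'cont, hg'i⟩ := hg.exists_hasCompactSupport_integral_sub_le
      (ε := ε / (2 * (M + 1))) (by positivity)
    have hchange : ∀ (k : Phase → ℝ), ∀ t ∈ Ico 0 T,
        ∫ z, f₀ (Z 0 t z) * k z = ∫ w, f₀ w * k (Z t 0 w) := by
      intro k t ht
      rw [← h.integral_comp ht h0 (fun z => f₀ (Z 0 t z) * k z)]
      simp only [h.inv h0 ht]
    refine ⟨fun t => ∫ z, f₀ (Z 0 t z) * g' z, ?_, fun t ht => hεu ?_⟩
    · refine ContinuousOn.congr (f := fun t => ∫ w, f₀ w * g' (Z t 0 w)) ?_ (hchange g')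
      obtain ⟨B, hB⟩ := hg'cont.bounded_above_of_compact_support hg'c
      refine continuousOn_of_dominated (bound := fun w => ‖f₀ w‖ * B) (fun t ht => ?_)
        (fun t ht => ae_of_all _ fun w => ?_) (hf1.norm.mul_const B) (ae_of_all _ fun w => ?_)
      · exact hf1.aestronglyMeasurable.mul
          (hg'cont.comp (h.continuous ht h0)).aestronglyMeasurable
      · rw [norm_mul]
        gcongr
        exact hB _
      · refine continuousOn_const.mul (hg'cont.comp_continuousOn fun s hs => ?_)
        exact (h.flow.solves 0 h0 w s hs).continuousWithinAt
    · have hft : ∀ᵐ z, ‖f₀ (Z 0 t z)‖ ≤ M :=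
        (h.preserving 0 h0 t ht).quasiMeasurePreserving.ae hM
      have hm : AEStronglyMeasurable (fun z => f₀ (Z 0 t z)) volume :=
        hf1.aestronglyMeasurable.comp_measurePreserving (h.preserving 0 h0 t ht)
      have hi1 : Integrable (fun z => f₀ (Z 0 t z) * g z) := hg.bdd_mul hm hft
      have hi2 : Integrable (fun z => f₀ (Z 0 t z) * g' z) := hg'i.bdd_mul hm hft
      rw [dist_eq_norm, ← integral_sub hi1 hi2]
      calc ‖∫ z, (f₀ (Z 0 t z) * g z - f₀ (Z 0 t z) * g' z)‖
          ≤ ∫ z, M * ‖g z - g' z‖ := by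
            refine norm_integral_le_of_norm_le ((hg.sub hg'i).norm.const_mul M) ?_
            filter_upwards [hft] with z hz
            rw [← mul_sub, norm_mul]
            gcongr
        _ = M * ∫ z, ‖g z - g' z‖ := integral_const_mul _ _
        _ ≤ M * (ε / (2 * (M + 1))) := by gcongr
        _ < ε := by
          rw [mul_div_assoc', div_lt_iff₀ (by positivity)]
          nlinarith

/-- The field is controlled only on compact subintervals of [0, T[; the compact support of a test
function confines its time integral to one of them. -/
theorem _root_.VlasovDarwin.IsTestFunction.exists_time {φ : ℝ × Phase → ℝ}
    (hφ : IsTestFunction T φ) (hT : 0 < T) : ∃ t₁ ∈ Ico 0 T, 0 < t₁ ∧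
      ∀ t, t₁ ≤ t → ∀ z, φ (t, z) = 0 ∧ fderiv ℝ φ (t, z) = 0 := by
  have hK : IsCompact (Prod.fst '' tsupport φ) := hφ.compact.isCompact.image continuous_fst
  obtain ⟨m, hmT, hm⟩ : ∃ m < T, ∀ t ∈ Prod.fst '' tsupport φ, t ≤ m := by
    rcases (Prod.fst '' tsupport φ).eq_empty_or_nonempty with he | hne
    · exact ⟨T - 1, by linarith, by simp [he]⟩
    · obtain ⟨q, hq, hmax⟩ := hK.exists_isMaxOn hne continuousOn_id
      refine ⟨q, ?_, fun t ht => hmax ht⟩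
      obtain ⟨p, hp, rfl⟩ := hq
      exact (hφ.support hp).1
  refine ⟨(max m 0 + T) / 2, ⟨?_, ?_⟩, ?_, fun t ht z => ?_⟩
  · have := le_max_right m 0; linarith
  · have := max_lt hmT hT; linarith
  · have := le_max_right m 0; linarith
  · have hn : (t, z) ∉ tsupport φ := fun hmem => by
      have h1 := hm t ⟨_, hmem, rfl⟩
      have h2 := le_max_left m 0
      have h3 := max_lt hmT hT
      linarith
    exact ⟨image_eq_zero_of_notMem_tsupport hn, fderiv_of_notMem_tsupport ℝ hn⟩

theorem hasDerivWithinAt_comp (h : LiouvilleFlow T b Z) {φ : ℝ × Phase → ℝ}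
    (hφ : ContDiff ℝ ∞ φ) {s t : ℝ} (hs : s ∈ Ico 0 T) (ht : t ∈ Ico 0 T) (w : Phase) :
    HasDerivWithinAt (fun s => φ (s, Z s t w))
      (fderiv ℝ φ (s, Z s t w) (1, b s (Z s t w))) (Ico 0 T) s :=
  ((hφ.differentiable (by simp)) (s, Z s t w)).hasFDerivAt.comp_hasDerivWithinAt s
    ((hasDerivWithinAt_id s _).prodMk (h.flow.solves t ht w s hs))

/-- After the substitution z = Z t 0 w the integrand is f₀(w) times the time derivative of φ along a
characteristic. Fubini and the fundamental theorem of calculus leave only the boundary term at time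
zero. -/
theorem equation (h : LiouvilleFlow T b Z) (hT : 0 < T) {f₀ : Phase → ℝ} (hf : Integrable f₀)
    {φ : ℝ × Phase → ℝ} (hφ : IsTestFunction T φ) :
    ∫ t in Ioo 0 T, ∫ z, f₀ (Z 0 t z) * fderiv ℝ φ (t, z) (1, b t z)
      = -∫ z, f₀ z * φ (0, z) := by
  have h0 : (0 : ℝ) ∈ Ico 0 T := ⟨le_rfl, hT⟩
  obtain ⟨t₁, ht₁, hpos, hzero⟩ := hφ.exists_time hT
  have hsubI : Icc 0 t₁ ⊆ Ico 0 T := fun s hs => ⟨hs.1, hs.2.trans_lt ht₁.2⟩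
  obtain ⟨C, hC⟩ := h.field t₁ ht₁
  let k : ℝ → Phase → ℝ := fun t w => fderiv ℝ φ (t, Z t 0 w) (1, b t (Z t 0 w))
  have hinner : ∀ t ∈ Ico 0 T, ∫ z, f₀ (Z 0 t z) * fderiv ℝ φ (t, z) (1, b t z)
      = ∫ w, f₀ w * k t w := by
    intro t ht
    rw [← h.integral_comp ht h0]
    simp only [h.inv h0 ht, k]
  have hZc : ContinuousOn (fun q : ℝ × Phase => Z q.1 0 q.2) (Icc 0 t₁ ×ˢ univ) :=
    (h.flow_Icc ht₁).continuousOn_uncurry hC ⟨le_rfl, ht₁.1⟩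
  have hfd : Continuous (fderiv ℝ φ) := hφ.smooth.continuous_fderiv (by simp)
  have hkc : ContinuousOn (uncurry k) (Icc 0 t₁ ×ˢ univ) := by
    have h1 : ContinuousOn (fun q : ℝ × Phase => fderiv ℝ φ (q.1, Z q.1 0 q.2))
        (Icc 0 t₁ ×ˢ univ) := hfd.comp_continuousOn (continuousOn_fst.prodMk hZc)
    have h2 : ContinuousOn (fun q : ℝ × Phase => b q.1 (Z q.1 0 q.2)) (Icc 0 t₁ ×ˢ univ) :=
      hC.cont.comp (continuousOn_fst.prodMk hZc) (fun q hq => ⟨hq.1, mem_univ _⟩)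
    exact h1.clm_apply (continuousOn_const.prodMk h2)
  obtain ⟨B, hB⟩ := hfd.bounded_above_of_compact_support (hφ.compact.fderiv ℝ)
  have hkb : ∀ t ∈ Icc 0 t₁, ∀ w, ‖k t w‖ ≤ B * max 1 C := fun t ht w => by
    refine (ContinuousLinearMap.le_opNorm _ _).trans ?_
    have hB0 : 0 ≤ B := (norm_nonneg _).trans (hB 0)
    gcongr
    · exact hB _
    · rw [Prod.norm_def, norm_one]
      exact max_le_max le_rfl (hC.bound t ht _)
  have hvan : ∀ t, t₁ < t → ∫ z, f₀ (Z 0 t z) * fderiv ℝ φ (t, z) (1, b t z) = 0 := by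
    intro t ht
    simp [(hzero t ht.le _).2]
  have hswap : ∫ t in Ioc 0 t₁, ∫ w, f₀ w * k t w = ∫ w, ∫ t in Ioc 0 t₁, f₀ w * k t w := by
    refine integral_integral_swap ?_
    have hmeas : AEStronglyMeasurable (uncurry k)
        ((volume.restrict (Ioc 0 t₁)).prod (volume : Measure Phase)) := by
      have := (hkc.mono (prod_mono Ioc_subset_Icc_self subset_rfl)).aestronglyMeasurable
        (μ := (volume : Measure ℝ).prod (volume : Measure Phase))
        (measurableSet_Ioc.prod MeasurableSet.univ)
      rwa [← Measure.prod_restrict, Measure.restrict_univ] at this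
    refine Integrable.mono' (g := fun q : ℝ × Phase => (B * max 1 C) * ‖f₀ q.2‖) ?_ ?_ ?_
    · exact (integrable_const (B * max 1 C)).mul_prod hf.norm
    · exact hf.aestronglyMeasurable.comp_snd.mul hmeas
    · have : ∀ᵐ q ∂((volume.restrict (Ioc 0 t₁)).prod (volume : Measure Phase)),
          q.1 ∈ Ioc 0 t₁ :=
        Measure.quasiMeasurePreserving_fst.ae (ae_restrict_mem measurableSet_Ioc)
      filter_upwards [this] with q hq
      simp only [uncurry]
      rw [norm_mul, mul_comm]
      gcongr
      exact hkb _ (Ioc_subset_Icc_self hq) _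
  have hftc : ∀ w, ∫ t in Ioc 0 t₁, f₀ w * k t w = -(f₀ w * φ (0, w)) := by
    intro w
    rw [integral_const_mul, ← intervalIntegral.integral_of_le hpos.le,
      intervalIntegral.integral_eq_sub_of_hasDeriv_right (f := fun s => φ (s, Z s 0 w))]
    · rw [(hzero t₁ le_rfl _).1, h.flow.initial 0 h0]
      ring
    · rw [uIcc_of_le hpos.le]
      exact fun s hs => ((h.hasDerivWithinAt_comp hφ.smooth (hsubI hs) h0 w).mono
        hsubI).continuousWithinAt
    · rw [min_eq_left hpos.le, max_eq_right hpos.le]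
      intro s hs
      refine ((h.hasDerivWithinAt_comp hφ.smooth (hsubI (Ioo_subset_Icc_self hs)) h0
        w).hasDerivAt ?_).hasDerivWithinAt
      exact Filter.mem_of_superset (Icc_mem_nhds hs.1 hs.2) hsubI
    · refine ContinuousOn.intervalIntegrable ?_
      rw [uIcc_of_le hpos.le]
      exact hkc.comp (f := fun t => (t, w)) (by fun_prop) (fun t ht => ⟨ht, mem_univ _⟩)
  calc ∫ t in Ioo 0 T, ∫ z, f₀ (Z 0 t z) * fderiv ℝ φ (t, z) (1, b t z)
      = ∫ t in Ioc 0 t₁, ∫ z, f₀ (Z 0 t z) * fderiv ℝ φ (t, z) (1, b t z) := by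
        refine setIntegral_eq_of_subset_of_forall_sdiff_eq_zero measurableSet_Ioo
          (fun t ht => ⟨ht.1, ht.2.trans_lt ht₁.2⟩) fun t ht => hvan t ?_
        by_contra hle
        exact ht.2 ⟨ht.1.1, not_lt.1 hle⟩
    _ = ∫ t in Ioc 0 t₁, ∫ w, f₀ w * k t w :=
        setIntegral_congr_fun measurableSet_Ioc fun t ht => hinner t (hsubI (Ioc_subset_Icc_self ht))
    _ = _ := by
        rw [hswap]
        simp only [hftc]
        exact integral_neg _

theorem isWeakSolution {Φ : ℝ → E3 → ℝ} {A : ℝ → E3 → E3}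
    (h : LiouvilleFlow T (charField Φ A) Z) (hT : 0 < T) {f₀ : Phase → ℝ}
    (hf1 : MemLp f₀ 1 volume) (hf : MemLp f₀ ⊤ volume) (hpos : 0 ≤ᵐ[volume] f₀) :
    IsWeakSolution T Φ A f₀ (fun t z => f₀ (Z 0 t z)) := by
  have h0 : (0 : ℝ) ∈ Ico 0 T := ⟨le_rfl, hT⟩
  have hi := memLp_one_iff_integrable.1 hf1
  exact {
    weakStar := h.weakStarContinuous hi hf
    nonneg := fun t ht => (h.preserving 0 h0 t ht).quasiMeasurePreserving.ae hpos
    integrable := fun t ht => (h.preserving 0 h0 t ht).integrable_comp_of_integrable hi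
    mass := fun t ht => h.integral_comp h0 ht f₀
    equation := fun φ hφ => h.equation hT hi hφ }

theorem densityMeasure_eq_map (h : LiouvilleFlow T b Z) {t : ℝ} (ht : t ∈ Ico 0 T)
    (f₀ : Phase → ℝ) :
    densityMeasure (fun z => f₀ (Z 0 t z)) = (densityMeasure f₀).map (Z t 0) := by
  have h0 : (0 : ℝ) ∈ Ico 0 T := ⟨le_rfl, ht.1.trans_lt ht.2⟩
  ext s hs
  have hm := (h.continuous ht h0).measurable
  rw [Measure.map_apply hm hs, densityMeasure, densityMeasure, withDensity_apply _ hs,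
    withDensity_apply _ (hm hs)]
  rw [← (h.preserving t ht 0 h0).setLIntegral_comp_preimage_emb (h.measurableEmbedding ht h0)]
  simp only [h.inv h0 ht]

end LiouvilleFlow

end VlasovDarwin

namespace VlasovDarwin

open Filter Topology Function

/-! ### Weak-* continuous families of densities -/

namespace WeakStarContinuous

variable {T : ℝ} {f : ℝ → Phase → ℝ}

/-- Banach–Steinhaus: the functionals g ↦ ∫ f(t) g on L¹ are pointwise bounded for t in [0, t₁], by
continuity on a compact interval, hence bounded in norm. The norm in the dual of L¹ is then read as
an essential bound. -/
theorem exists_bound (hf : WeakStarContinuous T f) {t₁ : ℝ} (ht₁ : t₁ ∈ Ico 0 T) :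
    ∃ M, 0 ≤ M ∧ ∀ t ∈ Icc 0 t₁, ∀ᵐ z, ‖f t z‖ ≤ M := by
  have hsub : Icc 0 t₁ ⊆ Ico 0 T := fun s hs => ⟨hs.1, hs.2.trans_lt ht₁.2⟩
  have hint : ∀ t ∈ Icc 0 t₁, ∀ g : Phase → ℝ, Integrable g →
      Integrable fun z => f t z * g z := fun t ht g hg => by
    obtain ⟨M, -, hM⟩ := exists_ae_bound (hf.memLp t (hsub ht))
    exact hg.bdd_mul (hf.memLp t (hsub ht)).1 hM
  have hex : ∀ t : Icc 0 t₁, ∃ Λ : Lp ℝ 1 (volume : Measure Phase) →L[ℝ] ℝ,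
      ∀ g, Λ g = ∫ z, f t z * g z := by
    intro t
    obtain ⟨M, hM0, hM⟩ := exists_ae_bound (hf.memLp t (hsub t.2))
    have hL : ∀ g : Lp ℝ 1 (volume : Measure Phase), Integrable g := fun g => L1.integrable_coeFn g
    let Λ : Lp ℝ 1 (volume : Measure Phase) →ₗ[ℝ] ℝ :=
      { toFun := fun g => ∫ z, f t z * g z
        map_add' := fun g g' => by
          rw [← integral_add (hint t t.2 g (hL g)) (hint t t.2 g' (hL g'))]
          refine integral_congr_ae ?_
          filter_upwards [Lp.coeFn_add g g'] with z hz
          rw [hz, Pi.add_apply, mul_add]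
        map_smul' := fun c g => by
          rw [RingHom.id_apply, smul_eq_mul, ← integral_const_mul]
          refine integral_congr_ae ?_
          filter_upwards [Lp.coeFn_smul c g] with z hz
          rw [hz, Pi.smul_apply, smul_eq_mul]
          ring }
    refine ⟨Λ.mkContinuous M fun g => ?_, fun g => rfl⟩
    rw [L1.norm_eq_integral_norm, ← integral_const_mul]
    refine norm_integral_le_of_norm_le ((hL g).norm.const_mul M) ?_
    filter_upwards [hM] with z hz
    rw [norm_mul]
    gcongr
  choose Λ hΛ using hex
  obtain ⟨M, hM⟩ := banach_steinhaus (g := Λ) fun g => by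
    have hc : ContinuousOn (fun t => ∫ z, f t z * g z) (Icc 0 t₁) :=
      (hf.continuousOn g (L1.integrable_coeFn g)).mono hsub
    obtain ⟨B, hB⟩ := isCompact_Icc.exists_bound_of_continuousOn hc
    exact ⟨B, fun t => by rw [hΛ]; exact hB t t.2⟩
  have hkey : ∀ t ∈ Icc 0 t₁, ∀ g : Phase → ℝ, Integrable g →
      |∫ z, f t z * g z| ≤ M * ∫ z, ‖g z‖ := by
    intro t ht g hg
    have h1 := (Λ ⟨t, ht⟩).le_of_opNorm_le (hM ⟨t, ht⟩) hg.toL1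
    rw [hΛ, L1.norm_eq_integral_norm] at h1
    have e1 : ∫ z, f t z * (hg.toL1 g) z = ∫ z, f t z * g z := by
      refine integral_congr_ae ?_
      filter_upwards [hg.coeFn_toL1] with z hz
      rw [hz]
    have e2 : ∫ z, ‖(hg.toL1 g) z‖ = ∫ z, ‖g z‖ := by
      refine integral_congr_ae ?_
      filter_upwards [hg.coeFn_toL1] with z hz
      rw [hz]
    rwa [e1, e2] at h1
  -- Indicators of sets of finite measure as test functions bound all averages of f(t) by M, which
  -- forces the pointwise bound almost everywhere.
  have hset : ∀ t ∈ Icc 0 t₁, ∀ s, MeasurableSet s → volume s < ⊤ →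
      IntegrableOn (f t) s ∧ |∫ z in s, f t z| ≤ M * volume.real s := by
    intro t ht s hs hfin
    have hi : Integrable (s.indicator fun _ : Phase => (1 : ℝ)) :=
      (integrable_indicator_iff hs).2 (integrableOn_const hfin.ne)
    have e : (fun z => f t z * s.indicator (fun _ => (1 : ℝ)) z) = s.indicator (f t) := by
      ext z
      by_cases hz : z ∈ s <;> simp [hz]
    have h1 := hint t ht _ hi
    have h2 := hkey t ht _ hi
    rw [e] at h1 h2
    rw [integrable_indicator_iff hs] at h1
    refine ⟨h1, ?_⟩
    rw [integral_indicator hs] at h2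
    refine h2.trans (le_of_eq ?_)
    congr 1
    simp_rw [norm_indicator_eq_indicator_norm, norm_one]
    exact integral_indicator_one hs
  have hM0 : ∀ s : Set Phase, volume s < ⊤ → IntegrableOn (fun _ => M) s := fun s hs =>
    integrableOn_const hs.ne
  refine ⟨max M 0, le_max_right _ _, fun t ht => ?_⟩
  have h1 : 0 ≤ᵐ[volume] fun z => M - f t z := by
    refine ae_nonneg_of_forall_setIntegral_nonneg_of_sigmaFinite
      (fun s hs hfin => (hM0 s hfin).sub (hset t ht s hs hfin).1) fun s hs hfin => ?_
    rw [integral_sub (hM0 s hfin) (hset t ht s hs hfin).1, setIntegral_const, smul_eq_mul]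
    have := (abs_le.1 (hset t ht s hs hfin).2).2
    linarith
  have h2 : 0 ≤ᵐ[volume] fun z => M + f t z := by
    refine ae_nonneg_of_forall_setIntegral_nonneg_of_sigmaFinite
      (fun s hs hfin => (hM0 s hfin).add (hset t ht s hs hfin).1) fun s hs hfin => ?_
    rw [integral_add (hM0 s hfin) (hset t ht s hs hfin).1, setIntegral_const, smul_eq_mul]
    have := (abs_le.1 (hset t ht s hs hfin).2).1
    linarith
  filter_upwards [h1, h2] with z hz1 hz2
  simp only [Pi.zero_apply] at hz1 hz2
  rw [Real.norm_eq_abs, abs_le]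
  constructor <;> linarith [le_max_left M 0]

theorem integrable_mul (hf : WeakStarContinuous T f) {t : ℝ} (ht : t ∈ Ico 0 T) {g : Phase → ℝ}
    (hg : Integrable g) : Integrable fun z => f t z * g z := by
  obtain ⟨M, -, hM⟩ := exists_ae_bound (hf.memLp t ht)
  exact hg.bdd_mul (hf.memLp t ht).1 hM

theorem locallyIntegrable (hf : WeakStarContinuous T f) {t : ℝ} (ht : t ∈ Ico 0 T) :
    LocallyIntegrable (f t) volume :=
  (hf.memLp t ht).locallyIntegrable le_top

/-- Pairing a weak-* continuous family with a family that is continuous in `L¹`. -/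
theorem continuousOn_pairing (hf : WeakStarContinuous T f) {Y : Type*} [TopologicalSpace Y]
    [FirstCountableTopology Y] {S : Set Y} {σ : Y → ℝ} {t₁ : ℝ} (ht₁ : t₁ ∈ Ico 0 T)
    (hσ : ContinuousOn σ S) (hσm : ∀ y ∈ S, σ y ∈ Icc 0 t₁) {Ξ : Y → Phase → ℝ}
    {G : Phase → ℝ} (hG : Integrable G) (hm : ∀ y ∈ S, AEStronglyMeasurable (Ξ y) volume)
    (hb : ∀ y ∈ S, ∀ z, ‖Ξ y z‖ ≤ G z) (hc : ∀ z, ContinuousOn (fun y => Ξ y z) S) :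
    ContinuousOn (fun y => ∫ z, f (σ y) z * Ξ y z) S := by
  have hsub : Icc 0 t₁ ⊆ Ico 0 T := fun s hs => ⟨hs.1, hs.2.trans_lt ht₁.2⟩
  obtain ⟨M, hM0, hM⟩ := hf.exists_bound ht₁
  have hint : ∀ y ∈ S, Integrable (Ξ y) := fun y hy =>
    hG.mono' (hm y hy) (ae_of_all _ (hb y hy))
  intro y₀ hy₀
  -- The variation is split in two: with the test function frozen at y₀ weak-* continuity applies,
  -- and the change of the test function is small in L¹ and meets the uniform essential bound of f.
  have h1 : Tendsto (fun y => ∫ z, f (σ y) z * Ξ y₀ z) (𝓝[S] y₀)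
      (𝓝 (∫ z, f (σ y₀) z * Ξ y₀ z)) := by
    have h := (hf.continuousOn _ (hint y₀ hy₀)) (σ y₀) (hsub (hσm y₀ hy₀))
    exact h.tendsto.comp ((hσ y₀ hy₀).tendsto_nhdsWithin (fun y hy => hsub (hσm y hy)))
  have h2 : Tendsto (fun y => ∫ z, ‖Ξ y z - Ξ y₀ z‖) (𝓝[S] y₀) (𝓝 (∫ _ : Phase, (0 : ℝ))) := by
    refine tendsto_integral_filter_of_dominated_convergence (fun z => 2 * G z) ?_ ?_
      (hG.const_mul 2) (ae_of_all _ fun z => ?_)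
    · filter_upwards [self_mem_nhdsWithin] with y hy
      exact ((hm y hy).sub (hm y₀ hy₀)).norm
    · filter_upwards [self_mem_nhdsWithin] with y hy
      refine ae_of_all _ fun z => ?_
      rw [norm_norm, two_mul]
      exact (norm_sub_le _ _).trans (add_le_add (hb y hy z) (hb y₀ hy₀ z))
    · have := ((hc z y₀ hy₀).tendsto.sub_const (Ξ y₀ z)).norm
      simpa using this
  rw [integral_zero] at h2
  have h3 : Tendsto (fun y => ∫ z, f (σ y) z * (Ξ y z - Ξ y₀ z)) (𝓝[S] y₀) (𝓝 0) := by
    have h2' := h2.const_mul M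
    rw [mul_zero] at h2'
    refine squeeze_zero_norm' ?_ h2'
    filter_upwards [self_mem_nhdsWithin] with y hy
    rw [← integral_const_mul]
    refine norm_integral_le_of_norm_le (((hint y hy).sub (hint y₀ hy₀)).norm.const_mul M) ?_
    filter_upwards [hM _ (hσm y hy)] with z hz
    rw [norm_mul]
    gcongr
  have h4 := h3.add h1
  rw [zero_add] at h4
  refine h4.congr' ?_
  filter_upwards [self_mem_nhdsWithin] with y hy
  have i1 := hf.integrable_mul (hsub (hσm y hy)) (hint y hy)
  have i2 := hf.integrable_mul (hsub (hσm y hy)) (hint y₀ hy₀)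
  simp only [mul_sub]
  rw [integral_sub i1 i2, sub_add_cancel]

end WeakStarContinuous

/-! ### Uniqueness for the transport equation -/

/-- A continuous function whose distributional derivative on `[0,T[` is `k`, with value `m₀` at time
zero, is `m₀ + ∫ k`. -/
theorem eq_add_integral_of_weak {T m₀ : ℝ} (hT : 0 < T) {m k : ℝ → ℝ}
    (hm : ContinuousOn m (Ico 0 T)) (hk : ContinuousOn k (Ico 0 T))
    (h : ∀ θ : ℝ → ℝ, ContDiff ℝ ∞ θ → HasCompactSupport θ → tsupport θ ⊆ Iio T →
      ∫ t in Ioo 0 T, (deriv θ t * m t + θ t * k t) = -(θ 0 * m₀)) {t : ℝ} (ht : t ∈ Ico 0 T) :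
    m t = m₀ + ∫ s in 0..t, k s := by
  let n : ℝ → ℝ := fun t => m₀ + ∫ s in 0..t, k s
  have hsub : ∀ {t}, t ∈ Ico 0 T → Icc 0 t ⊆ Ico 0 T := fun ht s hs => ⟨hs.1, hs.2.trans_lt ht.2⟩
  have hkint : ∀ t ∈ Ico 0 T, IntervalIntegrable k volume 0 t := fun t ht => by
    refine ContinuousOn.intervalIntegrable (hk.mono ?_)
    rw [uIcc_of_le ht.1]
    exact hsub ht
  have hnd : ∀ t ∈ Ioo 0 T, HasDerivAt n (k t) t := fun t ht => by
    have hkt : ContinuousAt k t := hk.continuousAt (Ico_mem_nhds ht.1 ht.2)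
    refine (intervalIntegral.integral_hasDerivAt_right (hkint t (Ioo_subset_Ico_self ht)) ?_
      hkt).const_add m₀
    exact (hk.mono Ioo_subset_Ico_self).stronglyMeasurableAtFilter isOpen_Ioo t ht
  have hnc : ContinuousOn n (Ico 0 T) := by
    intro t ht
    let t' := (t + T) / 2
    have ht' : t' ∈ Ico 0 T := ⟨by simp only [t']; linarith [ht.1], by simp only [t']; linarith [ht.2]⟩
    have h1 : ContinuousOn n (Icc 0 t') := by
      have := intervalIntegral.continuousOn_primitive_interval' (hkint t' ht') (left_mem_uIcc)
      rw [uIcc_of_le ht'.1] at this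
      exact continuousOn_const.add this
    have h2 : t < t' := by simp only [t']; linarith [ht.2]
    refine ((h1 t ⟨ht.1, h2.le⟩).mono_of_mem_nhdsWithin ?_)
    filter_upwards [self_mem_nhdsWithin, mem_nhdsWithin_of_mem_nhds (Iio_mem_nhds h2)] with s hs hs2
    exact ⟨hs.1, le_of_lt hs2⟩
  have hae : ∀ᵐ t, t ∈ Ioo 0 T → m t - n t = 0 := by
    -- By the fundamental lemma of the calculus of variations it suffices to show ∫ g (m - n) = 0
    -- for smooth g with compact support in ]0, T[. To that end g is realised as the derivative of
    -- an admissible θ.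
    refine isOpen_Ioo.ae_eq_zero_of_integral_contDiff_smul_eq_zero
      (((hm.sub hnc).mono Ioo_subset_Ico_self).locallyIntegrableOn measurableSet_Ioo)
      fun g hg hgc hgs => ?_
    obtain ⟨β, hβ0, hβT, hβ⟩ : ∃ β, 0 < β ∧ β < T ∧ ∀ t, β ≤ t → g t = 0 := by
      rcases (tsupport g).eq_empty_or_nonempty with he | hne
      · refine ⟨T / 2, by linarith, by linarith, fun t _ => ?_⟩
        exact image_eq_zero_of_notMem_tsupport (by simp [he])
      · obtain ⟨q, hq, hmax⟩ := hgc.isCompact.exists_isMaxOn hne continuousOn_id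
        have hqT := (hgs hq).2
        refine ⟨(q + T) / 2, by linarith [(hgs hq).1], by linarith, fun t ht => ?_⟩
        refine image_eq_zero_of_notMem_tsupport fun hmem => ?_
        have := hmax hmem
        simp only [id, mem_ofPred_eq] at this
        linarith
    -- The primitive starts at T so that it vanishes after the support of g; its value at 0 need not
    -- vanish, and there the initial value m₀ enters.
    let G : ℝ → ℝ := fun t => ∫ s in T..t, g s
    have hGd : ∀ t, HasDerivAt G (g t) t := fun t =>
      intervalIntegral.integral_hasDerivAt_right (hg.continuous.intervalIntegrable _ _)
        hg.continuous.stronglyMeasurable.stronglyMeasurableAtFilter hg.continuous.continuousAt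
    have hGs : ContDiff ℝ ∞ G := by
      rw [contDiff_infty_iff_deriv]
      refine ⟨fun t => (hGd t).differentiableAt, ?_⟩
      rwa [show deriv G = g from funext fun t => (hGd t).deriv]
    have hGz : ∀ t, β ≤ t → G t = 0 := by
      intro t ht
      refine intervalIntegral.integral_zero_ae (ae_of_all _ fun s hs => hβ s ?_)
      have := uIoc_subset_uIcc hs
      rw [mem_uIcc] at this
      rcases this with h | h <;> linarith [h.1]
    -- The cutoff acts only between times -1 and 0. It makes the support compact without changing G
    -- on [0, T[.
    let θ : ℝ → ℝ := fun t => Real.smoothTransition (t + 1) * G t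
    have hθs : ContDiff ℝ ∞ θ := (Real.smoothTransition.contDiff.comp (by fun_prop)).mul hGs
    have hθsupp : tsupport θ ⊆ Icc (-1) β := by
      refine closure_minimal (fun t ht => ?_) isClosed_Icc
      rw [mem_support] at ht
      constructor
      · by_contra hlt
        exact ht (by simp only [θ]; rw [Real.smoothTransition.zero_of_nonpos (by linarith), zero_mul])
      · by_contra hlt
        exact ht (by simp only [θ]; rw [hGz t (by linarith), mul_zero])
    have hθc : HasCompactSupport θ := 
      isCompact_Icc.of_isClosed_subset (isClosed_tsupport _) hθsupp
    have hθeq : ∀ t, 0 ≤ t → θ t = G t := fun t ht => by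
      simp only [θ]
      rw [Real.smoothTransition.one_of_one_le (by linarith), one_mul]
    have hθd : ∀ t, 0 < t → HasDerivAt θ (g t) t := fun t ht =>
      (hGd t).congr_of_eventuallyEq (by
        filter_upwards [Ioi_mem_nhds ht] with s hs using hθeq s (le_of_lt hs))
    have hweak := h θ hθs hθc (hθsupp.trans fun t ht => ht.2.trans_lt hβT)
    have hβI : β ∈ Ico 0 T := ⟨hβ0.le, hβT⟩
    have hred : ∀ {F : ℝ → ℝ}, (∀ t, β < t → F t = 0) → ∫ t in Ioo 0 T, F t = ∫ t in 0..β, F t := by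
      intro F hF
      rw [intervalIntegral.integral_of_le hβ0.le]
      refine setIntegral_eq_of_subset_of_forall_sdiff_eq_zero measurableSet_Ioo
        (fun t ht => ⟨ht.1, ht.2.trans_lt hβT⟩) fun t ht => hF t ?_
      by_contra hle
      exact ht.2 ⟨ht.1.1, not_lt.1 hle⟩
    have hnint : ∫ t in 0..β, (g t * n t + G t * k t) = -(θ 0 * m₀) := by
      have := intervalIntegral.integral_eq_sub_of_hasDeriv_right (f := fun t => G t * n t)
        (f' := fun t => g t * n t + G t * k t) (a := 0) (b := β) ?_ ?_ ?_
      · rw [this, hGz β le_rfl, hθeq 0 le_rfl]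
        simp [n]
      · rw [uIcc_of_le hβ0.le]
        exact hGs.continuous.continuousOn.mul (hnc.mono (hsub hβI))
      · rw [min_eq_left hβ0.le, max_eq_right hβ0.le]
        exact fun t ht => ((hGd t).mul (hnd t ⟨ht.1, ht.2.trans hβT⟩)).hasDerivWithinAt
      · refine ContinuousOn.intervalIntegrable ?_
        rw [uIcc_of_le hβ0.le]
        exact (hg.continuous.continuousOn.mul (hnc.mono (hsub hβI))).add
          (hGs.continuous.continuousOn.mul (hk.mono (hsub hβI)))
    have hmint : ∫ t in 0..β, (g t * m t + G t * k t) = -(θ 0 * m₀) := by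
      rw [← hweak, ← hred]
      · exact setIntegral_congr_fun measurableSet_Ioo fun t ht => by
          simp only [(hθd t ht.1).deriv, hθeq t ht.1.le]
      · intro t ht
        rw [hβ t ht.le, hGz t ht.le]
        simp
    have hi : ∀ {F : ℝ → ℝ}, ContinuousOn F (Ico 0 T) →
        IntervalIntegrable (fun t => g t * F t + G t * k t) volume 0 β := fun hF => by
      refine ContinuousOn.intervalIntegrable ?_
      rw [uIcc_of_le hβ0.le]
      exact (hg.continuous.continuousOn.mul (hF.mono (hsub hβI))).add
        (hGs.continuous.continuousOn.mul (hk.mono (hsub hβI)))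
    have hsubt := intervalIntegral.integral_sub (hi hm) (hi hnc)
    rw [hmint, hnint, sub_self] at hsubt
    rw [← hsubt, ← hred, ← integral_indicator measurableSet_Ioo]
    · refine integral_congr_ae (ae_of_all _ fun t => ?_)
      by_cases ht : t ∈ Ioo 0 T
      · simp only [indicator_of_mem ht, smul_eq_mul]; ring
      · simp only [indicator_of_notMem ht, smul_eq_mul]
        rw [image_eq_zero_of_notMem_tsupport (fun hmem => ht (hgs hmem)), zero_mul]
    · intro t ht
      rw [hβ t ht.le, hGz t ht.le]
      simp
  have heqOn : EqOn m n (Ioo 0 T) := by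
    refine Measure.eqOn_open_of_ae_eq (μ := volume) ?_ isOpen_Ioo (hm.mono Ioo_subset_Ico_self)
      (hnc.mono Ioo_subset_Ico_self)
    rw [EventuallyEq, ae_restrict_iff' measurableSet_Ioo]
    filter_upwards [hae] with t ht hmem
    exact sub_eq_zero.1 (ht hmem)
  have hclos : Ico 0 T ⊆ closure (Ioo 0 T) := by
    rw [closure_Ioo hT.ne]
    exact Ico_subset_Icc_self
  exact (heqOn.of_subset_closure hm hnc Ioo_subset_Ico_self hclos) ht

end VlasovDarwin

/-! ### Mollification on phase space -/

namespace VlasovDarwin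

open Filter Topology Function

instance : (volume : Measure Phase).IsAddHaarMeasure :=
  inferInstanceAs ((volume : Measure E3).prod (volume : Measure E3)).IsAddHaarMeasure

instance : (volume : Measure Phase).IsNegInvariant :=
  Measure.IsAddHaarMeasure.isNegInvariant_of_regular volume

theorem continuousOn_Ico_of_Icc {α : Type*} [TopologicalSpace α] {T : ℝ} {g : ℝ → α}
    (h : ∀ t₁ ∈ Ico 0 T, ContinuousOn g (Icc 0 t₁)) : ContinuousOn g (Ico 0 T) := by
  intro t ht
  have h2 : t < (t + T) / 2 := by linarith [ht.2]
  have ht' : (t + T) / 2 ∈ Ico 0 T := ⟨by linarith [ht.1], by linarith [ht.2]⟩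
  refine (h _ ht' t ⟨ht.1, h2.le⟩).mono_of_mem_nhdsWithin ?_
  filter_upwards [self_mem_nhdsWithin, mem_nhdsWithin_of_mem_nhds (Iio_mem_nhds h2)] with s hs hs2
  exact ⟨hs.1, le_of_lt hs2⟩

/-- While the centre q.2 stays in a ball, the kernels are dominated by one bounded function of
compact support, so `continuousOn_pairing` applies; continuity is local, and every point has such a
neighbourhood. -/
theorem WeakStarContinuous.continuousOn_pairing_translate {T : ℝ} {f : ℝ → Phase → ℝ}
    (hf : WeakStarContinuous T f) {t₁ : ℝ} (ht₁ : t₁ ∈ Ico 0 T) {Ξ : ℝ × Phase → Phase → ℝ}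
    {B ρ : ℝ} (hc : ContinuousOn (uncurry Ξ) ((Icc 0 t₁ ×ˢ univ) ×ˢ univ))
    (hb : ∀ q ∈ Icc 0 t₁ ×ˢ (univ : Set Phase), ∀ z, ‖Ξ q z‖ ≤ B)
    (hs : ∀ q z, ρ < ‖z - q.2‖ → Ξ q z = 0) :
    ContinuousOn (fun q : ℝ × Phase => ∫ z, f q.1 z * Ξ q z) (Icc 0 t₁ ×ˢ univ) := by
  have key : ∀ R : ℝ, ContinuousOn (fun q : ℝ × Phase => ∫ z, f q.1 z * Ξ q z)
      (Icc 0 t₁ ×ˢ Metric.closedBall 0 R) := by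
    intro R
    have hsubS : ∀ {q : ℝ × Phase}, q ∈ Icc 0 t₁ ×ˢ Metric.closedBall (0 : Phase) R →
        q ∈ Icc 0 t₁ ×ˢ (univ : Set Phase) := fun hq => ⟨hq.1, mem_univ _⟩
    refine hf.continuousOn_pairing (σ := Prod.fst) ht₁ continuousOn_fst (fun q hq => hq.1)
      (G := (Metric.closedBall (0 : Phase) (R + ρ)).indicator fun _ => B) ?_ (fun q hq => ?_)
      (fun q hq z => ?_) (fun z => ?_)
    · exact (integrable_indicator_iff measurableSet_closedBall).2
        (integrableOn_const measure_closedBall_lt_top.ne)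
    · have : Continuous (Ξ q) := by
        rw [← continuousOn_univ]
        exact hc.comp (f := fun z => (q, z)) (by fun_prop) (fun z _ => ⟨hsubS hq, mem_univ _⟩)
      exact this.aestronglyMeasurable
    · by_cases hz : z ∈ Metric.closedBall (0 : Phase) (R + ρ)
      · rw [indicator_of_mem hz]
        exact hb q (hsubS hq) z
      · rw [indicator_of_notMem hz, hs q z, norm_zero]
        rw [Metric.mem_closedBall, dist_zero_right, not_le] at hz
        have h1 := hq.2
        rw [Metric.mem_closedBall, dist_zero_right] at h1
        have h2 := norm_sub_norm_le z q.2
        linarith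
    · exact hc.comp (f := fun q => (q, z)) (by fun_prop) (fun q hq => ⟨hsubS hq, mem_univ _⟩)
  intro q hq
  have h1 : q ∈ Icc 0 t₁ ×ˢ Metric.closedBall (0 : Phase) (‖q.2‖ + 1) :=
    ⟨hq.1, by rw [Metric.mem_closedBall, dist_zero_right]; linarith⟩
  refine (key (‖q.2‖ + 1) q h1).mono_of_mem_nhdsWithin ?_
  have h2 : {p : ℝ × Phase | ‖p.2‖ < ‖q.2‖ + 1} ∈ 𝓝 q :=
    (isOpen_lt (by fun_prop) continuous_const).mem_nhds (by simp)
  filter_upwards [self_mem_nhdsWithin, mem_nhdsWithin_of_mem_nhds h2] with p hp hp2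
  exact ⟨hp.1, by rw [Metric.mem_closedBall, dist_zero_right]; exact le_of_lt hp2⟩

/-- Rescaled mollifiers: the gradient of a mollifier of width `δ` has `L¹` norm of order `1/δ`. -/
theorem exists_mollifier : ∃ J : ℝ, 0 ≤ J ∧ ∀ δ : ℝ, 0 < δ → ∃ η : Phase → ℝ,
    ContDiff ℝ ∞ η ∧ HasCompactSupport η ∧ (∀ z, δ < ‖z‖ → η z = 0) ∧ (∀ z, 0 ≤ η z) ∧
      ∫ z, η z = 1 ∧ ∫ z, ‖fderiv ℝ η z‖ ≤ J / δ := by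
  let φ : ContDiffBump (0 : Phase) := ⟨1 / 2, 1, by norm_num, by norm_num⟩
  let η₁ : Phase → ℝ := φ.normed volume
  have hη₁ : ContDiff ℝ ∞ η₁ := φ.contDiff_normed
  let d := Module.finrank ℝ Phase
  refine ⟨∫ z, ‖fderiv ℝ η₁ z‖, integral_nonneg fun _ => norm_nonneg _, fun δ hδ => ?_⟩
  have hδ' : δ⁻¹ ≠ 0 := inv_ne_zero hδ.ne'
  have hzero : ∀ z : Phase, δ < ‖z‖ → δ⁻¹ ^ d * η₁ (δ⁻¹ • z) = 0 := by
    intro z hz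
    have : δ⁻¹ • z ∉ support η₁ := by
      rw [φ.support_normed_eq, Metric.mem_ball, dist_zero_right, norm_smul, norm_inv,
        Real.norm_of_nonneg hδ.le, inv_mul_lt_iff₀ hδ, not_lt]
      simpa [φ] using hz.le
    rw [notMem_support.1 this, mul_zero]
  refine ⟨fun z => δ⁻¹ ^ d * η₁ (δ⁻¹ • z), contDiff_const.mul (hη₁.comp (by fun_prop)), ?_,
    hzero, fun z => by have := φ.nonneg_normed (μ := volume) (δ⁻¹ • z); positivity, ?_, ?_⟩
  · refine HasCompactSupport.intro (isCompact_closedBall 0 δ) fun z hz => hzero z ?_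
    simpa using hz
  · rw [integral_const_mul, Measure.integral_comp_smul, φ.integral_normed, smul_eq_mul, mul_one,
      abs_of_pos (by positivity)]
    exact mul_inv_cancel₀ (by positivity)
  · have hd : ∀ z, ‖fderiv ℝ (fun z => δ⁻¹ ^ d * η₁ (δ⁻¹ • z)) z‖
        = δ⁻¹ ^ d * δ⁻¹ * ‖fderiv ℝ η₁ (δ⁻¹ • z)‖ := by
      intro z
      have h1 : HasFDerivAt (fun z => δ⁻¹ ^ d * η₁ (δ⁻¹ • z))
          (δ⁻¹ ^ d • ((fderiv ℝ η₁ (δ⁻¹ • z)).comp (δ⁻¹ • ContinuousLinearMap.id ℝ Phase))) z :=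
        ((hη₁.differentiable (by simp) _).hasFDerivAt.comp z
          ((hasFDerivAt_id z).const_smul δ⁻¹)).const_mul _
      rw [h1.fderiv, ContinuousLinearMap.comp_smul, ContinuousLinearMap.comp_id, norm_smul,
        norm_smul, Real.norm_of_nonneg (by positivity), Real.norm_of_nonneg (by positivity),
        mul_assoc]
    simp only [hd]
    rw [integral_const_mul, Measure.integral_comp_smul volume (fun z => ‖fderiv ℝ η₁ z‖),
      smul_eq_mul, abs_of_pos (by positivity)]
    refine le_of_eq ?_
    have : δ⁻¹ ^ d ≠ 0 := by positivity
    change δ⁻¹ ^ d * δ⁻¹ * ((δ⁻¹ ^ d)⁻¹ * _) = _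
    field_simp

/-- The averaged identity `∫ θ (η * f) → ∫ θ f`, quantitatively. -/
theorem abs_integral_mollify_sub_le {θ f η : Phase → ℝ} (hθ : Continuous θ) {R κ M δ : ℝ}
    (hR : ∀ z, R < ‖z‖ → θ z = 0) (hδ : δ ≤ 1) (hκ : ∀ y z, ‖y - z‖ ≤ δ → |θ y - θ z| ≤ κ)
    (hf : AEStronglyMeasurable f) (hM : ∀ᵐ z, ‖f z‖ ≤ M) (hM0 : 0 ≤ M) (hη : Continuous η)
    (hηs : ∀ z, δ < ‖z‖ → η z = 0) (hη0 : ∀ z, 0 ≤ η z) (hη1 : ∫ z, η z = 1) :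
    |(∫ y, θ y * ∫ z, f z * η (z - y)) - ∫ z, f z * θ z| ≤
      M * κ * volume.real (Metric.closedBall (0 : Phase) (R + 1)) := by
  have hθc : HasCompactSupport θ := HasCompactSupport.intro (isCompact_closedBall 0 R) fun z hz =>
    hR z (by simpa using hz)
  have hηc : HasCompactSupport η := HasCompactSupport.intro (isCompact_closedBall 0 δ) fun z hz =>
    hηs z (by simpa using hz)
  have hθi : Integrable θ := hθ.integrable_of_hasCompactSupport hθc
  have hηi : Integrable η := hη.integrable_of_hasCompactSupport hηc
  have hint : Integrable (fun q : Phase × Phase => θ q.1 * (f q.2 * η (q.2 - q.1)))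
      (volume.prod volume) := by
    have h1 : Integrable (fun q : Phase × Phase => θ q.1 * η (q.2 - q.1))
        ((volume : Measure Phase).prod volume) :=
      hθi.convolution_integrand (ContinuousLinearMap.mul ℝ ℝ) hηi |>.swap
    have h2 := h1.bdd_mul (f := fun q : Phase × Phase => f q.2) (c := M) hf.comp_snd
      (Measure.quasiMeasurePreserving_snd.ae hM)
    refine h2.congr (ae_of_all _ fun q => ?_)
    simp only
    ring
  -- Fubini moves the mollifier from f, about which only a bound is known, to the continuous
  -- function θ.
  have hswap : ∫ y, θ y * ∫ z, f z * η (z - y) = ∫ z, f z * ∫ y, θ y * η (z - y) := by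
    simp_rw [← integral_const_mul]
    rw [integral_integral_swap hint]
    congr 1 with z
    congr 1 with y
    ring
  have hη1' : ∀ z, ∫ y, η (z - y) = 1 := fun z => by rw [integral_sub_left_eq_self, hη1]
  have hi1 : ∀ z, Integrable fun y => η (z - y) := fun z => hηi.comp_sub_left z
  have hi2 : ∀ z, Integrable fun y => θ y * η (z - y) := fun z => by
    obtain ⟨B, hB⟩ := hθ.bounded_above_of_compact_support hθc
    exact (hi1 z).bdd_mul hθ.aestronglyMeasurable (ae_of_all _ hB)
  have hdiff : ∀ z, (∫ y, θ y * η (z - y)) - θ z = ∫ y, (θ y - θ z) * η (z - y) := fun z => by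
    simp only [sub_mul]
    rw [integral_sub (hi2 z) ((hi1 z).const_mul _), integral_const_mul, hη1', mul_one]
  have hbd : ∀ z, |(∫ y, θ y * η (z - y)) - θ z| ≤ κ := fun z => by
    rw [hdiff, ← Real.norm_eq_abs]
    refine (norm_integral_le_of_norm_le ((hi1 z).const_mul κ) (ae_of_all _ fun y => ?_)).trans ?_
    · rw [norm_mul, Real.norm_of_nonneg (hη0 _)]
      by_cases h : ‖z - y‖ ≤ δ
      · have := hκ y z (by rwa [norm_sub_rev])
        exact mul_le_mul_of_nonneg_right this (hη0 _)
      · rw [hηs _ (not_le.1 h), mul_zero, mul_zero]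
    · rw [integral_const_mul, hη1', mul_one]
  have hz : ∀ z, z ∉ Metric.closedBall (0 : Phase) (R + 1) →
      f z * ((∫ y, θ y * η (z - y)) - θ z) = 0 := by
    intro z hz
    rw [Metric.mem_closedBall, dist_zero_right, not_le] at hz
    have e : ∀ y, θ y * η (z - y) = 0 := by
      intro y
      by_cases h : ‖z - y‖ ≤ δ
      · have := norm_sub_norm_le z y
        rw [hR y (by linarith), zero_mul]
      · rw [hηs _ (not_le.1 h), mul_zero]
    simp only [e, integral_zero, hR z (by linarith), sub_zero, mul_zero]
  have hfi1 : Integrable fun z => f z * ∫ y, θ y * η (z - y) := by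
    have := hint.integral_prod_right
    refine this.congr (ae_of_all _ fun z => ?_)
    simp only
    rw [← integral_const_mul]
    congr 1 with y
    ring
  have hfi2 : Integrable fun z => f z * θ z := hθi.bdd_mul hf hM
  rw [hswap, ← integral_sub hfi1 hfi2]
  simp only [← mul_sub]
  rw [← setIntegral_eq_integral_of_forall_compl_eq_zero hz, ← Real.norm_eq_abs]
  refine norm_setIntegral_le_of_norm_le_const_ae measure_closedBall_lt_top ?_
  refine ae_restrict_of_ae ?_
  filter_upwards [hM] with z hzM
  rw [norm_mul]
  gcongr
  exact hbd z

end VlasovDarwin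

/-! ### Mollified weak solutions along characteristics -/

namespace VlasovDarwin

open Filter Topology Function

/-- The weak formulation of the transport equation along `b`, tested with all test functions. -/
def WeakTransport (T : ℝ) (b : ℝ → Phase → Phase) (f₀ : Phase → ℝ) (f : ℝ → Phase → ℝ) : Prop :=
  ∀ φ : ℝ × Phase → ℝ, IsTestFunction T φ →
    ∫ t in Ioo 0 T, ∫ z, f t z * fderiv ℝ φ (t, z) (1, b t z) = -∫ z, f₀ z * φ (0, z)

namespace LiouvilleFlow

variable {T : ℝ} {b : ℝ → Phase → Phase} {Z : ℝ → ℝ → Phase → Phase} {f₀ : Phase → ℝ}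
  {f : ℝ → Phase → ℝ}

theorem continuous_slice (h : LiouvilleFlow T b Z) {t : ℝ} (ht : t ∈ Ico 0 T) :
    Continuous (b t) := by
  obtain ⟨C, hC⟩ := h.field t ht
  exact hC.continuous_slice ⟨ht.1, le_rfl⟩

/-- These are the mollified density and the ingredients of its partial derivatives. Their joint
continuity is what permits the chain rule along a moving characteristic in `mollified_sub_eq`. -/
theorem continuousOn_flux (h : LiouvilleFlow T b Z) (hf : WeakStarContinuous T f) {η : Phase → ℝ}
    (hη : ContDiff ℝ ∞ η) (hηc : HasCompactSupport η) {t₁ : ℝ} (ht₁ : t₁ ∈ Ico 0 T) :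
    ContinuousOn (fun q : ℝ × Phase => ∫ z, f q.1 z * η (z - q.2)) (Icc 0 t₁ ×ˢ univ) ∧
    ContinuousOn (fun q : ℝ × Phase => ∫ z, f q.1 z * fderiv ℝ η (z - q.2) (b q.1 z))
      (Icc 0 t₁ ×ˢ univ) ∧
    ∀ v, ContinuousOn (fun q : ℝ × Phase => ∫ z, f q.1 z * fderiv ℝ η (z - q.2) v)
      (Icc 0 t₁ ×ˢ univ) := by
  obtain ⟨C, hC⟩ := h.field t₁ ht₁
  have hd : Continuous (fderiv ℝ η) := hη.continuous_fderiv (by simp)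
  obtain ⟨B, hB⟩ := hη.continuous.bounded_above_of_compact_support hηc
  obtain ⟨B', hB'⟩ := hd.bounded_above_of_compact_support (hηc.fderiv ℝ)
  have hB'0 : 0 ≤ B' := (norm_nonneg _).trans (hB' 0)
  obtain ⟨ρ, hρ⟩ := hηc.isCompact.isBounded.exists_norm_le
  have h0 : ∀ z, ρ < ‖z‖ → z ∉ tsupport η := fun z hz hmem => absurd (hρ z hmem) (not_le.2 hz)
  refine ⟨?_, ?_, fun v => ?_⟩
  · exact hf.continuousOn_pairing_translate ht₁ (Ξ := fun q z => η (z - q.2)) (B := B) (ρ := ρ)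
      (hη.continuous.comp (by fun_prop)).continuousOn (fun q _ z => hB _)
      (fun q z hz => image_eq_zero_of_notMem_tsupport (h0 _ hz))
  · refine hf.continuousOn_pairing_translate ht₁
      (Ξ := fun q z => fderiv ℝ η (z - q.2) (b q.1 z)) (B := B' * C) (ρ := ρ)
      ?_ (fun q hq z => ?_) (fun q z hz => ?_)
    · refine ContinuousOn.clm_apply (hd.comp (by fun_prop)).continuousOn ?_
      exact hC.cont.comp (f := fun p : (ℝ × Phase) × Phase => (p.1.1, p.2)) (by fun_prop)
        (fun p hp => ⟨hp.1.1, mem_univ _⟩)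
    · exact (ContinuousLinearMap.le_opNorm _ _).trans
        (mul_le_mul (hB' _) (hC.bound _ hq.1 _) (norm_nonneg _) hB'0)
    · rw [fderiv_of_notMem_tsupport ℝ (h0 _ hz)]
      rfl
  · refine hf.continuousOn_pairing_translate ht₁
      (Ξ := fun q z => fderiv ℝ η (z - q.2) v) (B := B' * ‖v‖) (ρ := ρ)
      ?_ (fun q hq z => ?_) (fun q z hz => ?_)
    · exact ContinuousOn.clm_apply (hd.comp (by fun_prop)).continuousOn continuousOn_const
    · exact (ContinuousLinearMap.le_opNorm _ _).trans
        (mul_le_mul_of_nonneg_right (hB' _) (norm_nonneg _))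
    · rw [fderiv_of_notMem_tsupport ℝ (h0 _ hz)]
      rfl

/-- Test functions of product form θ(t) χ(z) reduce the weak equation to a scalar distributional
equation for t ↦ ∫ f(t) χ, to which `eq_add_integral_of_weak` applies. The integral form also
identifies the value at time zero. -/
theorem integral_mul_eq (h : LiouvilleFlow T b Z) (hT : 0 < T) (hf : WeakStarContinuous T f)
    (hw : WeakTransport T b f₀ f) {χ : Phase → ℝ} (hχ : ContDiff ℝ ∞ χ)
    (hχc : HasCompactSupport χ) {t : ℝ} (ht : t ∈ Ico 0 T) :
    ∫ z, f t z * χ z = (∫ z, f₀ z * χ z) + ∫ s in 0..t, ∫ z, f s z * fderiv ℝ χ z (b s z) := by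
  have hpt : ∀ {t₁ : ℝ}, ContinuousOn (fun s : ℝ => ((s, 0) : ℝ × Phase)) (Icc 0 t₁) :=
    (by fun_prop : Continuous fun s : ℝ => ((s, 0) : ℝ × Phase)).continuousOn
  have hm : ContinuousOn (fun s => ∫ z, f s z * χ z) (Ico 0 T) :=
    hf.continuousOn χ (hχ.continuous.integrable_of_hasCompactSupport hχc)
  have hk : ContinuousOn (fun s => ∫ z, f s z * fderiv ℝ χ z (b s z)) (Ico 0 T) := by
    refine continuousOn_Ico_of_Icc fun t₁ ht₁ => ?_
    have := (h.continuousOn_flux hf hχ hχc ht₁).2.1.comp hpt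
      (fun s hs => ⟨hs, mem_univ _⟩)
    simpa [Function.comp_def] using this
  have hχd : Continuous (fderiv ℝ χ) := hχ.continuous_fderiv (by simp)
  refine eq_add_integral_of_weak hT hm hk (fun θ hθ hθc hθs => ?_) ht
  have htest : IsTestFunction T fun q : ℝ × Phase => θ q.1 * χ q.2 := by
    have hz : ∀ q : ℝ × Phase, q ∉ tsupport θ ×ˢ tsupport χ → θ q.1 * χ q.2 = 0 := by
      intro q hq
      rw [mem_prod, not_and_or] at hq
      rcases hq with hq | hq
      · rw [image_eq_zero_of_notMem_tsupport hq, zero_mul]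
      · rw [image_eq_zero_of_notMem_tsupport hq, mul_zero]
    refine ⟨(hθ.comp contDiff_fst).mul (hχ.comp contDiff_snd),
      HasCompactSupport.intro (hθc.isCompact.prod hχc.isCompact) hz, ?_⟩
    refine (closure_minimal (fun q hq => ?_)
      ((isClosed_tsupport θ).prod (isClosed_tsupport χ))).trans (prod_mono hθs (subset_univ _))
    by_contra hn
    exact hq (hz q hn)
  have heq := hw _ htest
  have hr : ∫ z, f₀ z * (θ 0 * χ z) = θ 0 * ∫ z, f₀ z * χ z := by
    rw [← integral_const_mul]
    congr 1 with z
    ring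
  simp only [hr] at heq
  rw [← heq]
  refine setIntegral_congr_fun measurableSet_Ioo fun s hs => ?_
  have hs' : s ∈ Ico 0 T := Ioo_subset_Ico_self hs
  have hd : ∀ z v, fderiv ℝ (fun q : ℝ × Phase => θ q.1 * χ q.2) (s, z) (1, v) =
      deriv θ s * χ z + θ s * fderiv ℝ χ z v := by
    intro z v
    have h1 : HasFDerivAt (fun q : ℝ × Phase => θ q.1)
        ((ContinuousLinearMap.toSpanSingleton ℝ (deriv θ s)).comp
          (ContinuousLinearMap.fst ℝ ℝ Phase)) (s, z) :=
      ((hθ.differentiable (by simp) s).hasDerivAt.hasFDerivAt).comp (s, z) hasFDerivAt_fst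
    have h2 : HasFDerivAt (fun q : ℝ × Phase => χ q.2)
        ((fderiv ℝ χ z).comp (ContinuousLinearMap.snd ℝ ℝ Phase)) (s, z) :=
      ((hχ.differentiable (by simp) z).hasFDerivAt).comp (s, z) hasFDerivAt_snd
    have h3 : HasFDerivAt (fun q : ℝ × Phase => θ q.1 * χ q.2) _ (s, z) := h1.mul h2
    rw [h3.fderiv]
    simp
    ring
  simp only [hd]
  have i1 : Integrable fun z => f s z * χ z :=
    hf.integrable_mul hs' (hχ.continuous.integrable_of_hasCompactSupport hχc)
  have i2 : Integrable fun z => f s z * fderiv ℝ χ z (b s z) := by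
    refine hf.integrable_mul hs' (Continuous.integrable_of_hasCompactSupport
      (hχd.clm_apply (h.continuous_slice hs')) ?_)
    refine (hχc.fderiv ℝ).mono' fun z hz => subset_tsupport _ fun h0 => hz ?_
    simp [h0]
  rw [← integral_const_mul, ← integral_const_mul, ← integral_add (i1.const_mul _) (i2.const_mul _)]
  congr 1 with z
  ring

/-- The field of a measure preserving flow is divergence free in the sense of distributions. -/
theorem integral_fderiv_eq_zero (h : LiouvilleFlow T b Z) {ξ : Phase → ℝ} (hξ : ContDiff ℝ ∞ ξ)
    (hξc : HasCompactSupport ξ) {s : ℝ} (hs : s ∈ Ioo 0 T) : ∫ y, fderiv ℝ ξ y (b s y) = 0 := by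
  have hsI : s ∈ Ico 0 T := Ioo_subset_Ico_self hs
  let t₁ := (s + T) / 2
  have ht₁ : t₁ ∈ Ico 0 T := ⟨by simp only [t₁]; linarith [hs.1, hs.2], by simp only [t₁]; linarith [hs.2]⟩
  have hst : s < t₁ := by simp only [t₁]; linarith [hs.2]
  obtain ⟨C, hC⟩ := h.field t₁ ht₁
  have hsub : Icc 0 t₁ ⊆ Ico 0 T := fun r hr => ⟨hr.1, hr.2.trans_lt ht₁.2⟩
  have hnhd : Ioo 0 t₁ ∈ 𝓝 s := Ioo_mem_nhds hs.1 hst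
  have hξd : Continuous (fderiv ℝ ξ) := hξ.continuous_fderiv (by simp)
  obtain ⟨B, hB⟩ := hξd.bounded_above_of_compact_support (hξc.fderiv ℝ)
  have hB0 : 0 ≤ B := (norm_nonneg _).trans (hB 0)
  obtain ⟨ρ, hρ⟩ := hξc.isCompact.isBounded.exists_norm_le
  have hmeas : ∀ r ∈ Ico 0 T, Continuous fun y => ξ (Z r s y) := fun r hr =>
    hξ.continuous.comp (h.continuous hr hsI)
  -- By conservation of volume ∫ ξ(Z r s y) dy does not depend on r. Differentiated under the
  -- integral at r = s, where the flow is the identity, this gives the claim.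
  have key := hasDerivAt_integral_of_dominated_loc_of_deriv_le (μ := (volume : Measure Phase))
    (F := fun r y => ξ (Z r s y)) (F' := fun r y => fderiv ℝ ξ (Z r s y) (b r (Z r s y)))
    (x₀ := s) (s := Ioo 0 t₁)
    (bound := (Metric.closedBall (0 : Phase) (ρ + C * t₁)).indicator fun _ => B * C) hnhd ?_ ?_ ?_
    ?_ ?_ ?_
  · have hconst : (fun r => ∫ y, ξ (Z r s y)) =ᶠ[𝓝 s] fun _ => ∫ y, ξ y := by
      filter_upwards [hnhd] with r hr
      exact h.integral_comp (hsub (Ioo_subset_Icc_self hr)) hsI ξ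
    have h0 := (hasDerivAt_const s (∫ y, ξ y)).congr_of_eventuallyEq hconst
    have := key.2.unique h0
    simpa [h.flow.initial s hsI] using this
  · filter_upwards [hnhd] with r hr
    exact (hmeas r (hsub (Ioo_subset_Icc_self hr))).aestronglyMeasurable
  · simp only [h.flow.initial s hsI]
    exact hξ.continuous.integrable_of_hasCompactSupport hξc
  · have : Continuous fun y => fderiv ℝ ξ (Z s s y) (b s (Z s s y)) := by
      simp only [h.flow.initial s hsI]
      exact hξd.clm_apply (h.continuous_slice hsI)
    exact this.aestronglyMeasurable
  · refine ae_of_all _ fun y r hr => ?_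
    have hr' := Ioo_subset_Icc_self hr
    by_cases hy : y ∈ Metric.closedBall (0 : Phase) (ρ + C * t₁)
    · rw [indicator_of_mem hy]
      exact (ContinuousLinearMap.le_opNorm _ _).trans
        (mul_le_mul (hB _) (hC.bound r hr' _) (norm_nonneg _) hB0)
    · rw [indicator_of_notMem hy, fderiv_of_notMem_tsupport ℝ]
      · simp
      · intro hmem
        rw [Metric.mem_closedBall, dist_zero_right, not_le] at hy
        have h1 := hρ _ hmem
        have h2 := (h.flow_Icc ht₁).norm_sub_self_le hC hr' ⟨hs.1.le, hst.le⟩ y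
        have h3 := norm_le_norm_add_norm_sub (Z r s y) y
        have h4 : |r - s| ≤ t₁ := by
          rw [abs_le]; constructor <;> linarith [hr.1, hr.2, hs.1]
        have h5 := mul_le_mul_of_nonneg_left h4 hC.nonneg
        linarith
  · exact (integrable_indicator_iff measurableSet_closedBall).2
      (integrableOn_const measure_closedBall_lt_top.ne)
  · refine ae_of_all _ fun y r hr => ?_
    have hr' := Ioo_subset_Icc_self hr
    have h1 : HasDerivAt (fun r => Z r s y) (b r (Z r s y)) r :=
      (h.flow.solves s hsI y r (hsub hr')).hasDerivAt
        (Ico_mem_nhds hr.1 (hr.2.trans ht₁.2))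
    exact (hξ.differentiable (by simp) _).hasFDerivAt.comp_hasDerivAt r h1

/-- Along characteristics, the mollified density changes by the commutator only. -/
theorem mollified_sub_eq (h : LiouvilleFlow T b Z) (hT : 0 < T) (hf : WeakStarContinuous T f)
    (hw : WeakTransport T b f₀ f) {η : Phase → ℝ} (hη : ContDiff ℝ ∞ η)
    (hηc : HasCompactSupport η) {t : ℝ} (ht : t ∈ Ico 0 T) :
    ContinuousOn (fun q : ℝ × Phase =>
        ∫ z, f q.1 z * fderiv ℝ η (z - q.2) (b q.1 z - b q.1 q.2)) (Icc 0 t ×ˢ univ) ∧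
    ∀ w, (∫ z, f t z * η (z - w)) - ∫ z, f 0 z * η (z - Z 0 t w) =
      ∫ s in 0..t, ∫ z, f s z * fderiv ℝ η (z - Z s t w) (b s z - b s (Z s t w)) := by
  have hηd : Continuous (fderiv ℝ η) := hη.continuous_fderiv (by simp)
  obtain ⟨B', hB'⟩ := hηd.bounded_above_of_compact_support (hηc.fderiv ℝ)
  have hsub : ∀ {t₁}, t₁ ∈ Ico 0 T → Icc 0 t₁ ⊆ Ico 0 T := fun ht₁ s hs =>
    ⟨hs.1, hs.2.trans_lt ht₁.2⟩
  have hηi : Integrable η := hη.continuous.integrable_of_hasCompactSupport hηc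
  have hηdi : ∀ y, Integrable fun z => fderiv ℝ η (z - y) := fun y =>
    (hηd.integrable_of_hasCompactSupport (hηc.fderiv ℝ)).comp_sub_right y
  have hib : ∀ s ∈ Ico 0 T, ∀ y, Integrable fun z => f s z * fderiv ℝ η (z - y) (b s z) := by
    intro s hs y
    refine hf.integrable_mul hs (Continuous.integrable_of_hasCompactSupport
      ((hηd.comp (by fun_prop)).clm_apply (h.continuous_slice hs)) ?_)
    refine ((hηc.fderiv ℝ).comp_homeomorph (Homeomorph.subRight y)).mono' fun z hz =>
      subset_tsupport _ fun h0 => hz ?_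
    simp only [comp_apply, Homeomorph.coe_subRight] at h0
    simp [h0]
  have hiv : ∀ s ∈ Ico 0 T, ∀ y v, Integrable fun z => f s z * fderiv ℝ η (z - y) v :=
    fun s hs y v => hf.integrable_mul hs ((hηdi y).apply_continuousLinearMap v)
  have hismul : ∀ s ∈ Ico 0 T, ∀ y, Integrable fun z => f s z • fderiv ℝ η (z - y) := by
    intro s hs y
    obtain ⟨M, -, hM⟩ := exists_ae_bound (hf.memLp s hs)
    exact (hηdi y).bdd_smul M (hf.memLp s hs).1 hM
  have hηsub : ∀ y z, fderiv ℝ (fun z => η (z - y)) z = fderiv ℝ η (z - y) := by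
    intro y z
    have h1 := (hη.differentiable (by simp) (z - y)).hasFDerivAt.comp z
      ((hasFDerivAt_id z).sub_const y)
    rw [ContinuousLinearMap.comp_id] at h1
    exact h1.fderiv
  -- P and Q are the time and space derivatives of the mollified density F(s, y). Along a
  -- characteristic the derivative is P + Q b(s, y), in which the field enters only through the
  -- difference b(s, z) - b(s, y).
  let P : ℝ → Phase → ℝ := fun s y => ∫ z, f s z * fderiv ℝ η (z - y) (b s z)
  let Q : ℝ → Phase → Phase →L[ℝ] ℝ := fun s y => -∫ z, f s z • fderiv ℝ η (z - y)
  have hQ : ∀ s ∈ Ico 0 T, ∀ y v, Q s y v = -∫ z, f s z * fderiv ℝ η (z - y) v := by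
    intro s hs y v
    simp only [Q, neg_apply]
    rw [ContinuousLinearMap.integral_apply (hismul s hs y)]
    rfl
  have hr : ∀ s ∈ Ico 0 T, ∀ y,
      ∫ z, f s z * fderiv ℝ η (z - y) (b s z - b s y) = P s y + Q s y (b s y) := by
    intro s hs y
    rw [hQ s hs, ← sub_eq_add_neg]
    simp only [map_sub, mul_sub, P]
    exact integral_sub (hib s hs y) (hiv s hs y _)
  have hPc : ∀ t₁ ∈ Ico 0 T, ContinuousOn (fun q : ℝ × Phase => P q.1 q.2) (Icc 0 t₁ ×ˢ univ) :=
    fun t₁ ht₁ => (h.continuousOn_flux hf hη hηc ht₁).2.1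
  have hQc : ∀ t₁ ∈ Ico 0 T, ContinuousOn (fun q : ℝ × Phase => Q q.1 q.2) (Icc 0 t₁ ×ˢ univ) := by
    intro t₁ ht₁
    rw [continuousOn_clm_apply]
    intro v
    refine ((h.continuousOn_flux hf hη hηc ht₁).2.2 v).neg.congr fun q hq => ?_
    exact hQ q.1 (hsub ht₁ hq.1) q.2 v
  have hrc : ContinuousOn (fun q : ℝ × Phase =>
      ∫ z, f q.1 z * fderiv ℝ η (z - q.2) (b q.1 z - b q.1 q.2)) (Icc 0 t ×ˢ univ) := by
    obtain ⟨C, hC⟩ := h.field t ht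
    refine ((hPc t ht).add ((hQc t ht).clm_apply hC.cont)).congr fun q hq => ?_
    exact hr q.1 (hsub ht hq.1) q.2
  refine ⟨hrc, fun w => ?_⟩
  let F : ℝ → Phase → ℝ := fun s y => ∫ z, f s z * η (z - y)
  have hFs : ∀ s ∈ Ioo 0 T, ∀ y, HasFDerivAt (fun s => F s y)
      (ContinuousLinearMap.toSpanSingleton ℝ (P s y)) s := by
    intro s hs y
    have hsI : s ∈ Ico 0 T := Ioo_subset_Ico_self hs
    have hχ : ContDiff ℝ ∞ fun z => η (z - y) := hη.comp (by fun_prop)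
    have hχc : HasCompactSupport fun z => η (z - y) :=
      hηc.comp_homeomorph (Homeomorph.subRight y)
    have hPy : ContinuousOn (fun s => P s y) (Ico 0 T) := by
      refine continuousOn_Ico_of_Icc fun t₁ ht₁ => ?_
      exact (hPc t₁ ht₁).comp (f := fun s => (s, y)) (by fun_prop) (fun s hs => ⟨hs, mem_univ _⟩)
    have hd : HasDerivAt (fun s => (∫ z, f₀ z * η (z - y)) + ∫ r in 0..s, P r y) (P s y) s := by
      refine (intervalIntegral.integral_hasDerivAt_right ?_ ?_ ?_).const_add _
      · refine (hPy.mono ?_).intervalIntegrable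
        rw [uIcc_of_le hs.1.le]
        exact hsub hsI
      · exact (hPy.mono Ioo_subset_Ico_self).stronglyMeasurableAtFilter isOpen_Ioo s hs
      · exact hPy.continuousAt (Ico_mem_nhds hs.1 hs.2)
    refine (hd.congr_of_eventuallyEq ?_).hasFDerivAt
    filter_upwards [Ioo_mem_nhds hs.1 hs.2] with r hr
    have := h.integral_mul_eq hT hf hw hχ hχc (Ioo_subset_Ico_self hr)
    simp only [hηsub] at this
    exact this
  have hFy : ∀ s ∈ Ico 0 T, ∀ y, HasFDerivAt (fun y => F s y) (Q s y) y := by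
    intro s hs y
    obtain ⟨M, hM0, hM⟩ := exists_ae_bound (hf.memLp s hs)
    obtain ⟨ρ, hρ⟩ := hηc.isCompact.isBounded.exists_norm_le
    have hQ' : Q s y = ∫ z, f s z • -fderiv ℝ η (z - y) := by
      simp only [Q, smul_neg, integral_neg]
    rw [hQ']
    refine hasFDerivAt_integral_of_dominated_of_fderiv_le (μ := volume)
      (F := fun y z => f s z * η (z - y)) (F' := fun y z => f s z • -fderiv ℝ η (z - y))
      (bound := (Metric.closedBall (0 : Phase) (‖y‖ + 1 + ρ)).indicator fun _ => M * B')
      (Metric.ball_mem_nhds y one_pos) ?_ ?_ ?_ ?_ ?_ ?_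
    · refine Eventually.of_forall fun y' => ?_
      exact (hf.integrable_mul hs (hηi.comp_sub_right y')).aestronglyMeasurable
    · exact hf.integrable_mul hs (hηi.comp_sub_right y)
    · simp only [smul_neg]
      exact (hismul s hs y).neg.aestronglyMeasurable
    · filter_upwards [hM] with z hz y' hy'
      by_cases hzm : z ∈ Metric.closedBall (0 : Phase) (‖y‖ + 1 + ρ)
      · rw [indicator_of_mem hzm, norm_smul, norm_neg]
        gcongr
        exact hB' _
      · rw [indicator_of_notMem hzm, fderiv_of_notMem_tsupport ℝ]
        · simp
        · intro hmem
          rw [Metric.mem_closedBall, dist_zero_right, not_le] at hzm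
          rw [Metric.mem_ball, dist_eq_norm] at hy'
          have h1 := hρ _ hmem
          have h2 := norm_sub_norm_le z y'
          have h3 := norm_sub_norm_le y' y
          linarith
    · exact (integrable_indicator_iff measurableSet_closedBall).2
        (integrableOn_const measure_closedBall_lt_top.ne)
    · refine ae_of_all _ fun z y' _ => ?_
      have h1 : HasFDerivAt (fun y' => η (z - y')) (-fderiv ℝ η (z - y')) y' := by
        have := (hη.differentiable (by simp) (z - y')).hasFDerivAt.comp y'
          ((hasFDerivAt_id y').const_sub z)
        rwa [ContinuousLinearMap.comp_neg, ContinuousLinearMap.comp_id] at this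
      exact h1.const_mul (f s z)
  have hFd : ∀ s ∈ Ioo 0 t, HasDerivAt (fun s => F s (Z s t w))
      (P s (Z s t w) + Q s (Z s t w) (b s (Z s t w))) s := by
    intro s hs
    have hsT : s ∈ Ioo 0 T := ⟨hs.1, hs.2.trans ht.2⟩
    have hopen : Ioo 0 t ×ˢ (univ : Set Phase) ∈ 𝓝 (s, Z s t w) :=
      prod_mem_nhds (Ioo_mem_nhds hs.1 hs.2) univ_mem
    have hIcc : Icc 0 t ×ˢ (univ : Set Phase) ∈ 𝓝 (s, Z s t w) :=
      prod_mem_nhds (Icc_mem_nhds hs.1 hs.2) univ_mem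
    -- The two partial derivatives of F are known separately; since both are jointly continuous, F
    -- is differentiable in (s, y) together and can be followed along the curve.
    have hstrict := hasStrictFDerivAt_uncurry_coprod (𝕜 := ℝ) (u := (s, Z s t w)) (f := F)
      (f₁ := fun s y => ContinuousLinearMap.toSpanSingleton ℝ (P s y)) (f₂ := Q)
      (by
        filter_upwards [hopen] with v hv
        exact hFs v.1 ⟨hv.1.1, hv.1.2.trans ht.2⟩ v.2)
      (by
        filter_upwards [hopen] with v hv
        exact hFy v.1 ⟨hv.1.1.le, hv.1.2.trans ht.2⟩ v.2)
      (by
        have h1 : ContinuousAt (fun q : ℝ × Phase => P q.1 q.2) (s, Z s t w) :=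
          (hPc t ht).continuousAt hIcc
        exact (ContinuousLinearMap.toSpanSingletonCLE (𝕜 := ℝ) (E := ℝ)).continuous.continuousAt.comp
          h1)
      ((hQc t ht).continuousAt hIcc)
    have hz : HasDerivAt (fun r => (r, Z r t w)) (1, b s (Z s t w)) s :=
      (hasDerivAt_id s).prodMk ((h.flow.solves t ht w s (Ioo_subset_Ico_self hsT)).hasDerivAt
        (Ico_mem_nhds hsT.1 hsT.2))
    have := hstrict.hasFDerivAt.comp_hasDerivAt s hz
    simpa [Function.comp_def, Function.HasUncurry.uncurry] using this
  have hcurve : ContinuousOn (fun s => (s, Z s t w)) (Icc 0 t) :=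
    continuousOn_id.prodMk fun s hs =>
      ((h.flow.solves t ht w s (hsub ht hs)).mono (hsub ht)).continuousWithinAt
  have hmaps : MapsTo (fun s => (s, Z s t w)) (Icc 0 t) (Icc 0 t ×ˢ univ) :=
    fun s hs => ⟨hs, mem_univ _⟩
  have hFc : ContinuousOn (fun s => F s (Z s t w)) (Icc 0 t) :=
    (h.continuousOn_flux hf hη hηc ht).1.comp hcurve hmaps
  have hfin := intervalIntegral.integral_eq_sub_of_hasDeriv_right (f := fun s => F s (Z s t w))
    (f' := fun s => ∫ z, f s z * fderiv ℝ η (z - Z s t w) (b s z - b s (Z s t w)))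
    (a := 0) (b := t) (by rwa [uIcc_of_le ht.1]) ?_ ?_
  · rw [hfin]
    simp only [F, h.flow.initial t ht]
  · rw [min_eq_left ht.1, max_eq_right ht.1]
    intro s hs
    rw [hr s ⟨hs.1.le, hs.2.trans ht.2⟩]
    exact (hFd s hs).hasDerivWithinAt
  · refine ContinuousOn.intervalIntegrable ?_
    rw [uIcc_of_le ht.1]
    exact hrc.comp hcurve hmaps

end LiouvilleFlow

end VlasovDarwin

/-! ### The commutator estimate and uniqueness of weak solutions -/

namespace VlasovDarwin

open Filter Topology Function

theorem integral_fderiv_apply_eq_zero {η : Phase → ℝ} (hη : ContDiff ℝ ∞ η)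
    (hηc : HasCompactSupport η) (v : Phase) : ∫ y, fderiv ℝ η y v = 0 := by
  have hd : Integrable fun y => fderiv ℝ η y v :=
    ((hη.continuous_fderiv (by simp)).integrable_of_hasCompactSupport
      (hηc.fderiv ℝ)).apply_continuousLinearMap v
  have h := integral_mul_fderiv_eq_neg_fderiv_mul_of_integrable (μ := (volume : Measure Phase))
    (f := fun _ => (1 : ℝ)) (g := η) (v := v) (by simp) (by simpa using hd)
    (by simpa using hη.continuous.integrable_of_hasCompactSupport hηc)
    (fun x _ => differentiableAt_const _) (fun x _ => hη.differentiable (by simp) x)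
  simpa using h

namespace LiouvilleFlow

variable {T : ℝ} {b : ℝ → Phase → Phase} {Z : ℝ → ℝ → Phase → Phase} {f₀ : Phase → ℝ}
  {f : ℝ → Phase → ℝ}

/-- The commutator of transport and mollification is small when tested with a function of small
oscillation. -/
theorem abs_integral_commutator_le (h : LiouvilleFlow T b Z) {s : ℝ} (hs : s ∈ Ioo 0 T)
    {g φ η : Phase → ℝ} {R κ β M δ : ℝ} (hg : AEStronglyMeasurable g)
    (hgM : ∀ᵐ z, ‖g z‖ ≤ M) (hM0 : 0 ≤ M) (hφ : Continuous φ) (hR : ∀ z, R < ‖z‖ → φ z = 0)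
    (hδ : δ ≤ 1) (hκ0 : 0 ≤ κ) (hκ : ∀ y z, ‖y - z‖ ≤ δ → |φ y - φ z| ≤ κ)
    (hβ : ∀ y z, ‖y - z‖ ≤ δ → ‖b s y - b s z‖ ≤ β) (hη : ContDiff ℝ ∞ η)
    (hηs : ∀ z, δ < ‖z‖ → η z = 0) :
    |∫ y, φ y * ∫ z, g z * fderiv ℝ η (z - y) (b s z - b s y)| ≤
      M * (κ * β * ∫ z, ‖fderiv ℝ η z‖) * volume.real (Metric.closedBall (0 : Phase) (R + 1)) := by
  have hbc := h.continuous_slice (Ioo_subset_Ico_self hs)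
  have hηc : HasCompactSupport η := HasCompactSupport.intro (isCompact_closedBall 0 δ) fun z hz =>
    hηs z (by simpa using hz)
  have hηd : Continuous (fderiv ℝ η) := hη.continuous_fderiv (by simp)
  have hηdi : Integrable (fderiv ℝ η) := hηd.integrable_of_hasCompactSupport (hηc.fderiv ℝ)
  have hηds : ∀ z, δ < ‖z‖ → fderiv ℝ η z = 0 := fun z hz => by
    refine fderiv_of_notMem_tsupport ℝ fun hmem => not_le.2 hz ?_
    have : tsupport η ⊆ Metric.closedBall 0 δ := closure_minimal (fun w hw => by
      by_contra hn
      exact hw (hηs w (by simpa using hn))) Metric.isClosed_closedBall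
    simpa using this hmem
  let K : Phase → Phase → ℝ := fun y z => fderiv ℝ η (z - y) (b s z - b s y)
  have hKc : Continuous fun q : Phase × Phase => K q.1 q.2 :=
    (hηd.comp (by fun_prop)).clm_apply ((hbc.comp continuous_snd).sub (hbc.comp continuous_fst))
  have hK0 : ∀ y z, δ < ‖z - y‖ → K y z = 0 := fun y z hyz => by
    simp only [K, hηds _ hyz, zero_apply]
  have hKb : ∀ y z, |K y z| ≤ β * ‖fderiv ℝ η (z - y)‖ := fun y z => by
    by_cases hyz : ‖z - y‖ ≤ δ
    · rw [mul_comm]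
      exact ((fderiv ℝ η (z - y)).le_opNorm (b s z - b s y)).trans
        (mul_le_mul_of_nonneg_left (hβ _ _ hyz) (norm_nonneg _))
    · rw [hK0 y z (not_le.1 hyz), hηds _ (not_le.1 hyz)]
      simp
  have hint : Integrable (fun q : Phase × Phase => φ q.1 * (g q.2 * K q.1 q.2))
      ((volume : Measure Phase).prod volume) := by
    have hcont : Continuous fun q : Phase × Phase => φ q.1 * K q.1 q.2 :=
      (hφ.comp continuous_fst).mul hKc
    have hsupp : HasCompactSupport fun q : Phase × Phase => φ q.1 * K q.1 q.2 := by
      refine HasCompactSupport.intro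
        ((isCompact_closedBall 0 R).prod (isCompact_closedBall 0 (R + 1))) fun q hq => ?_
      by_cases h1 : R < ‖q.1‖
      · rw [hR _ h1, zero_mul]
      · rw [hK0, mul_zero]
        by_contra h2
        refine hq ⟨by simpa using h1, ?_⟩
        have h3 := norm_sub_norm_le q.2 q.1
        rw [Metric.mem_closedBall, dist_zero_right]
        linarith
    have h1 : Integrable (fun q : Phase × Phase => φ q.1 * K q.1 q.2)
        ((volume : Measure Phase).prod volume) := hcont.integrable_of_hasCompactSupport hsupp
    refine (h1.bdd_mul (f := fun q : Phase × Phase => g q.2) (c := M) hg.comp_snd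
      (Measure.quasiMeasurePreserving_snd.ae hgM)).congr (ae_of_all _ fun q => ?_)
    simp only
    ring
  have hswap : ∫ y, φ y * ∫ z, g z * K y z = ∫ z, g z * ∫ y, φ y * K y z := by
    simp_rw [← integral_const_mul]
    rw [integral_integral_swap hint]
    congr 1 with z
    congr 1 with y
    ring
  have hKi : ∀ z, Integrable fun y => K y z := fun z => by
    refine (hKc.comp (f := fun y => (y, z)) (by fun_prop)).integrable_of_hasCompactSupport
      (HasCompactSupport.intro (isCompact_closedBall z δ) fun y hy => hK0 y z ?_)
    rw [Metric.mem_closedBall, dist_eq_norm, not_le] at hy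
    rwa [norm_sub_rev]
  -- The term with b(s, y) integrates to zero because the field is divergence free, the term with
  -- the constant vector b(s, z) because a derivative of η has mean zero.
  have hKzero : ∀ z, ∫ y, K y z = 0 := fun z => by
    have hξ : ContDiff ℝ ∞ fun y => η (z - y) := hη.comp (by fun_prop)
    have hξc : HasCompactSupport fun y => η (z - y) :=
      hηc.comp_homeomorph (Homeomorph.subLeft z)
    have hξd : ∀ y, fderiv ℝ (fun y => η (z - y)) y = -fderiv ℝ η (z - y) := fun y => by
      have := (hη.differentiable (by simp) (z - y)).hasFDerivAt.comp y
        ((hasFDerivAt_id y).const_sub z)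
      rw [ContinuousLinearMap.comp_neg, ContinuousLinearMap.comp_id] at this
      exact this.fderiv
    have h1 := h.integral_fderiv_eq_zero hξ hξc hs
    simp only [hξd, neg_apply, integral_neg, neg_eq_zero] at h1
    have h2 : ∫ y, fderiv ℝ η (z - y) (b s z) = 0 := by
      rw [integral_sub_left_eq_self (fun y => fderiv ℝ η y (b s z)) volume z]
      exact integral_fderiv_apply_eq_zero hη hηc _
    have h3 : Integrable fun y => fderiv ℝ η (z - y) (b s z) :=
      (hηdi.apply_continuousLinearMap _).comp_sub_left z
    have h4 : Integrable fun y => fderiv ℝ η (z - y) (b s y) :=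
      (h3.sub (hKi z)).congr (ae_of_all _ fun y => by simp [K])
    simp only [K, map_sub]
    rw [integral_sub h3 h4, h1, h2, sub_zero]
  -- Since K has mean zero in y, the constant φ z may be subtracted, which replaces the size of φ by
  -- its oscillation κ.
  have hbd : ∀ z, |∫ y, φ y * K y z| ≤ κ * β * ∫ z, ‖fderiv ℝ η z‖ := fun z => by
    have h1 : ∫ y, φ y * K y z = ∫ y, (φ y - φ z) * K y z := by
      obtain ⟨B, hB⟩ := hφ.bounded_above_of_compact_support
        (HasCompactSupport.intro (isCompact_closedBall 0 R) fun z hz => hR z (by simpa using hz))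
      simp only [sub_mul]
      rw [integral_sub ((hKi z).bdd_mul hφ.aestronglyMeasurable (ae_of_all _ hB))
        ((hKi z).const_mul _), integral_const_mul, hKzero, mul_zero, sub_zero]
    have h2 : Integrable fun y => ‖fderiv ℝ η (z - y)‖ := (hηdi.comp_sub_left z).norm
    rw [h1, ← Real.norm_eq_abs]
    refine (norm_integral_le_of_norm_le (h2.const_mul (κ * β)) (ae_of_all _ fun y => ?_)).trans ?_
    · rw [norm_mul, mul_assoc]
      by_cases hyz : ‖z - y‖ ≤ δ
      · exact mul_le_mul (hκ y z (by rwa [norm_sub_rev])) (hKb y z) (norm_nonneg _) hκ0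
      · rw [hK0 y z (not_le.1 hyz), hηds _ (not_le.1 hyz)]
        simp
    · rw [integral_const_mul, integral_sub_left_eq_self (fun y => ‖fderiv ℝ η y‖) volume z]
  have hout : ∀ z, R + 1 < ‖z‖ → ∫ y, φ y * K y z = 0 := fun z hz => by
    have : ∀ y, φ y * K y z = 0 := fun y => by
      by_cases h1 : R < ‖y‖
      · rw [hR _ h1, zero_mul]
      · rw [hK0, mul_zero]
        have h3 := norm_sub_norm_le z y
        linarith
    simp [this]
  change |∫ y, φ y * ∫ z, g z * K y z| ≤ _
  rw [hswap, ← Real.norm_eq_abs]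
  set c := κ * β * ∫ z, ‖fderiv ℝ η z‖ with hc
  have hc0 : 0 ≤ c := (abs_nonneg _).trans (hbd 0)
  have hi : Integrable ((Metric.closedBall (0 : Phase) (R + 1)).indicator fun _ => M * c) :=
    (integrable_indicator_iff measurableSet_closedBall).2
      (integrableOn_const measure_closedBall_lt_top.ne)
  refine (norm_integral_le_of_norm_le hi ?_).trans ?_
  · filter_upwards [hgM] with z hz
    by_cases hzm : z ∈ Metric.closedBall (0 : Phase) (R + 1)
    · rw [indicator_of_mem hzm, norm_mul]
      exact mul_le_mul hz (hbd z) (norm_nonneg _) hM0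
    · rw [indicator_of_notMem hzm, hout z (by simpa using hzm), mul_zero, norm_zero]
  · rw [integral_indicator measurableSet_closedBall, setIntegral_const, smul_eq_mul, mul_comm]

theorem ae_eq_initial (h : LiouvilleFlow T b Z) (hT : 0 < T) (hf : WeakStarContinuous T f)
    (hf₀ : LocallyIntegrable f₀ volume) (hw : WeakTransport T b f₀ f) : ∀ᵐ z, f 0 z = f₀ z := by
  have h0 : (0 : ℝ) ∈ Ico 0 T := ⟨le_rfl, hT⟩
  refine ae_eq_of_integral_contDiff_smul_eq (hf.locallyIntegrable h0) hf₀ fun χ hχ hχc => ?_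
  have := h.integral_mul_eq hT hf hw hχ hχc h0
  simpa [mul_comm] using this

/-- The mollified density is compared with the initial one along characteristics, tested with ψ
transported by the flow. At width e⁻ᴺ this test function oscillates by at most L times the Osgood
modulus. Removing the mollifier at the two end times costs that much, and the commutator costs a
further factor of order N + 1. -/
theorem abs_integral_sub_le (h : LiouvilleFlow T b Z) (hT : 0 < T) (hf : WeakStarContinuous T f)
    (hw : WeakTransport T b f₀ f) {ψ : Phase → ℝ} (hψ : ContDiff ℝ ∞ ψ)
    (hψc : HasCompactSupport ψ) {t : ℝ} (ht : t ∈ Ico 0 T) :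
    ∃ C K : ℝ, ∀ N, 0 ≤ N → |(∫ z, f t z * ψ z) - ∫ z, f 0 z * ψ (Z t 0 z)| ≤
      K * ((N + 2) * osgood C t N) := by
  obtain ⟨C, hC⟩ := h.field t ht
  obtain ⟨M, hM0, hM⟩ := hf.exists_bound ht
  obtain ⟨J, hJ0, hJ⟩ := exists_mollifier
  obtain ⟨L, hL⟩ := (hψ.of_le (by simp)).lipschitzWith_of_hasCompactSupport hψc one_ne_zero
  obtain ⟨R, hR⟩ := hψc.isCompact.isBounded.exists_norm_le
  have hψ0 : ∀ z, R < ‖z‖ → ψ z = 0 := fun z hz =>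
    image_eq_zero_of_notMem_tsupport fun hmem => absurd (hR z hmem) (not_le.2 hz)
  have h0 : (0 : ℝ) ∈ Ico 0 T := ⟨le_rfl, hT⟩
  have htI : t ∈ Icc 0 t := ⟨ht.1, le_rfl⟩
  have h0I : (0 : ℝ) ∈ Icc 0 t := ⟨le_rfl, ht.1⟩
  have hsub : Icc 0 t ⊆ Ico 0 T := fun s hs => ⟨hs.1, hs.2.trans_lt ht.2⟩
  have hfl := h.flow_Icc ht
  let V := volume.real (Metric.closedBall (0 : Phase) (R + C * t + 1))
  refine ⟨C, M * L * V * (2 + t * C * J), fun N hN => ?_⟩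
  obtain ⟨η, hη, hηc, hηs, hη0, hη1, hηJ⟩ := hJ (Real.exp (-N)) (Real.exp_pos _)
  have hδ1 : Real.exp (-N) ≤ 1 := Real.exp_le_one_iff.2 (by linarith)
  set o := osgood C t N with ho
  have ho0 : 0 ≤ o := osgood_nonneg hC.nonneg ht.1 N
  let φ : ℝ → Phase → ℝ := fun s y => ψ (Z t s y)
  have hφc : ∀ s ∈ Icc 0 t, Continuous (φ s) := fun s hs =>
    hψ.continuous.comp (hfl.continuous hC htI hs)
  have hφ0 : ∀ s ∈ Icc 0 t, ∀ z, R + C * t < ‖z‖ → φ s z = 0 := by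
    intro s hs z hz
    refine hψ0 _ ?_
    have h1 := hfl.norm_sub_self_le hC htI hs z
    have h2 : C * |t - s| ≤ C * t :=
      mul_le_mul_of_nonneg_left (by rw [abs_of_nonneg (by linarith [hs.2])]; linarith [hs.1])
        hC.nonneg
    have h3 := norm_le_norm_add_norm_sub (Z t s z) z
    linarith
  have hφκ : ∀ s ∈ Icc 0 t, ∀ y z, ‖y - z‖ ≤ Real.exp (-N) → |φ s y - φ s z| ≤ L * o := by
    intro s hs y z hyz
    refine (hL.norm_sub_le _ _).trans (mul_le_mul_of_nonneg_left ?_ L.2)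
    refine (hfl.dist_le_osgood hC htI hs hN hyz).trans (osgood_mono hC.nonneg (abs_nonneg _) ?_ hN)
    rw [abs_of_nonneg (by linarith [hs.2])]
    linarith [hs.1]
  obtain ⟨hrc, hreq⟩ := h.mollified_sub_eq hT hf hw hη hηc ht
  let r : ℝ → Phase → ℝ := fun s y => ∫ z, f s z * fderiv ℝ η (z - y) (b s z - b s y)
  have hφt : φ t = ψ := by
    funext y
    simp only [φ, h.flow.initial t ht]
  have e1 : |(∫ y, ψ y * ∫ z, f t z * η (z - y)) - ∫ z, f t z * ψ z| ≤ M * (L * o) * V :=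
    abs_integral_mollify_sub_le hψ.continuous (by simpa [hφt] using hφ0 t htI) hδ1
      (by simpa [hφt] using hφκ t htI)
      (hf.memLp t ht).1 (hM t htI) hM0 hη.continuous hηs hη0 hη1
  have e2 : |(∫ y, φ 0 y * ∫ z, f 0 z * η (z - y)) - ∫ z, f 0 z * φ 0 z| ≤ M * (L * o) * V :=
    abs_integral_mollify_sub_le (hφc 0 h0I) (hφ0 0 h0I) hδ1 (hφκ 0 h0I)
      (hf.memLp 0 h0).1 (hM 0 h0I) hM0 hη.continuous hηs hη0 hη1
  -- The oscillation C (N + 1) e⁻ᴺ of the field cancels the L¹ norm J / e⁻ᴺ of the gradient of the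
  -- mollifier, leaving only N + 1.
  have e3 : ∀ s ∈ Ioo 0 t, |∫ y, φ s y * r s y| ≤ M * (L * o) * V * (C * J * (N + 1)) := by
    intro s hs
    have hsI := Ioo_subset_Icc_self hs
    have hβ : ∀ y z, ‖y - z‖ ≤ Real.exp (-N) →
        ‖b s y - b s z‖ ≤ C * ((N + 1) * Real.exp (-N)) := fun y z hyz => by
      refine (hC.logLip s hsI N hN y z).trans (mul_le_mul_of_nonneg_left ?_ hC.nonneg)
      nlinarith
    refine (h.abs_integral_commutator_le ⟨hs.1, hs.2.trans ht.2⟩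
      (hf.memLp s (hsub hsI)).1 (hM s hsI) hM0 (hφc s hsI) (hφ0 s hsI) hδ1
      (mul_nonneg L.2 ho0) (hφκ s hsI) hβ hη hηs).trans ?_
    have h1 : L * o * (C * ((N + 1) * Real.exp (-N))) * ∫ z, ‖fderiv ℝ η z‖ ≤
        L * o * (C * ((N + 1) * Real.exp (-N))) * (J / Real.exp (-N)) :=
      mul_le_mul_of_nonneg_left hηJ (by have := hC.nonneg; positivity)
    have h2 : L * o * (C * ((N + 1) * Real.exp (-N))) * (J / Real.exp (-N)) =
        L * o * (C * J * (N + 1)) := by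
      have := (Real.exp_pos (-N)).ne'
      field_simp
    rw [h2] at h1
    refine (mul_le_mul_of_nonneg_right (mul_le_mul_of_nonneg_left h1 hM0)
      measureReal_nonneg).trans (le_of_eq ?_)
    simp only [V]
    ring
  have hflc := hfl.continuousOn_uncurry hC htI
  have hcomp : ContinuousOn (fun q : ℝ × Phase => r q.1 (Z q.1 t q.2)) (Icc 0 t ×ˢ univ) :=
    hrc.comp (continuousOn_fst.prodMk hflc) fun q hq => ⟨hq.1, mem_univ _⟩
  have hint : Integrable (uncurry fun s w => ψ w * r s (Z s t w))
      ((volume.restrict (Ioc 0 t)).prod volume) := by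
    have hc2 : ContinuousOn (fun q : ℝ × Phase => ψ q.2 * r q.1 (Z q.1 t q.2))
        (Icc 0 t ×ˢ univ) := (hψ.continuous.comp continuous_snd).continuousOn.mul hcomp
    have hk : IntegrableOn (fun q : ℝ × Phase => ψ q.2 * r q.1 (Z q.1 t q.2))
        (Icc 0 t ×ˢ Metric.closedBall 0 R) ((volume : Measure ℝ).prod volume) :=
      (hc2.mono (prod_mono Subset.rfl (subset_univ _))).integrableOn_compact
        (isCompact_Icc.prod (isCompact_closedBall 0 R))
    have hk2 : IntegrableOn (fun q : ℝ × Phase => ψ q.2 * r q.1 (Z q.1 t q.2))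
        (Ioc 0 t ×ˢ univ) ((volume : Measure ℝ).prod volume) := by
      refine (hk.mono_set (prod_mono Ioc_subset_Icc_self Subset.rfl)).of_forall_sdiff_eq_zero
        (measurableSet_Ioc.prod MeasurableSet.univ) fun q hq => ?_
      rw [hψ0, zero_mul]
      by_contra hn
      exact hq.2 ⟨hq.1.1, by simpa using hn⟩
    rw [IntegrableOn, ← Measure.prod_restrict, Measure.restrict_univ] at hk2
    exact hk2
  -- The identity along characteristics is indexed by their positions w at time t. Multiplied by
  -- ψ(w) and integrated, with w = Z t s y, it becomes an identity at fixed times for the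
  -- transported test function.
  have hsplit : (∫ w, ψ w * ∫ z, f t z * η (z - w)) - (∫ w, φ 0 w * ∫ z, f 0 z * η (z - w)) =
      ∫ s in 0..t, ∫ y, φ s y * r s y := by
    have hpt : ∀ {t₁ : ℝ}, t₁ ∈ Icc 0 t → Continuous fun y => ∫ z, f t₁ z * η (z - y) := by
      intro t₁ ht₁
      have := (h.continuousOn_flux hf hη hηc ht).1.comp (f := fun y : Phase => (t₁, y))
        (s := univ) (by fun_prop) (fun y _ => ⟨ht₁, mem_univ _⟩)
      exact continuousOn_univ.1 this
    have hi : ∀ {G : Phase → ℝ}, Continuous G → Integrable fun w => ψ w * G w := fun hG =>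
      (hψ.continuous.mul hG).integrable_of_hasCompactSupport hψc.mul_right
    have hch : ∀ s ∈ Ico 0 T, ∫ y, φ s y * r s y = ∫ w, ψ w * r s (Z s t w) := by
      intro s hs
      rw [← h.integral_comp hs ht fun y => φ s y * r s y]
      simp only [φ, h.inv ht hs]
    have hch0 : ∫ w, φ 0 w * ∫ z, f 0 z * η (z - w) =
        ∫ w, ψ w * ∫ z, f 0 z * η (z - Z 0 t w) := by
      rw [← h.integral_comp h0 ht fun w => φ 0 w * ∫ z, f 0 z * η (z - w)]
      simp only [φ, h.inv ht h0]
    have hpt0 : Continuous fun w => ∫ z, f 0 z * η (z - Z 0 t w) :=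
      (hpt h0I).comp (h.continuous h0 ht)
    rw [hch0, ← integral_sub (hi (hpt htI)) (hi hpt0)]
    simp only [← mul_sub, hreq]
    rw [intervalIntegral.integral_of_le ht.1]
    have : ∫ s in Ioc 0 t, ∫ y, φ s y * r s y =
        ∫ s in Ioc 0 t, ∫ w, ψ w * r s (Z s t w) :=
      setIntegral_congr_fun measurableSet_Ioc fun s hs => hch s (hsub (Ioc_subset_Icc_self hs))
    rw [this, integral_integral_swap hint]
    congr 1 with w
    rw [intervalIntegral.integral_of_le ht.1, integral_const_mul]
  have e4 : |∫ s in 0..t, ∫ y, φ s y * r s y| ≤ M * (L * o) * V * (C * J * (N + 1)) * t := by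
    rw [← Real.norm_eq_abs, intervalIntegral.integral_of_le ht.1, integral_Ioc_eq_integral_Ioo]
    refine (norm_setIntegral_le_of_norm_le_const (by simp) e3).trans ?_
    rw [Real.volume_real_Ioo_of_le ht.1, sub_zero]
  rw [← hsplit] at e4
  have hV : 0 ≤ V := measureReal_nonneg
  have hfin : M * (L * o) * V + M * (L * o) * V + M * (L * o) * V * (C * J * (N + 1)) * t ≤
      M * L * V * (2 + t * C * J) * ((N + 2) * o) := by
    have hMV : 0 ≤ M * L * V * o := by positivity
    have hCJ : 0 ≤ t * C * J := mul_nonneg (mul_nonneg ht.1 hC.nonneg) hJ0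
    nlinarith [mul_nonneg hMV hCJ, mul_nonneg hMV hN, mul_nonneg (mul_nonneg hMV hCJ) hN]
  refine le_trans ?_ hfin
  rw [abs_le] at e1 e2 e4 ⊢
  constructor <;> linarith [e1.1, e1.2, e2.1, e2.2, e4.1, e4.2]

/-- As N → ∞ the factor N + 2 loses against exp(-N e^{-Ct}), for any fixed t. -/
theorem integral_mul_eq_comp (h : LiouvilleFlow T b Z) (hT : 0 < T) (hf : WeakStarContinuous T f)
    (hw : WeakTransport T b f₀ f) {ψ : Phase → ℝ} (hψ : ContDiff ℝ ∞ ψ)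
    (hψc : HasCompactSupport ψ) {t : ℝ} (ht : t ∈ Ico 0 T) :
    ∫ z, f t z * ψ z = ∫ z, f 0 z * ψ (Z t 0 z) := by
  obtain ⟨C, K, hK⟩ := h.abs_integral_sub_le hT hf hw hψ hψc ht
  have hlim : Tendsto (fun N => K * ((N + 2) * osgood C t N)) atTop (𝓝 0) := by
    have ha : 0 < Real.exp (-C * t) := Real.exp_pos _
    have h1 := Real.tendsto_pow_mul_exp_neg_atTop_nhds_zero 1
    have h2 : Tendsto (fun N : ℝ => Real.exp (-C * t) * N) atTop atTop :=
      tendsto_id.const_mul_atTop ha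
    have h3 := ((h1.comp h2).const_mul ((1 + (C + 2) * t) * (Real.exp (-C * t))⁻¹)).add
      ((tendsto_osgood C t).const_mul 2)
    have h4 := h3.const_mul K
    simp only [mul_zero, add_zero] at h4
    refine h4.congr fun N => ?_
    simp only [osgood, comp_apply, pow_one]
    have : -N * Real.exp (-C * t) = -(Real.exp (-C * t) * N) := by ring
    rw [this]
    field_simp
  have := ge_of_tendsto hlim ((eventually_ge_atTop 0).mono fun N hN => hK N hN)
  exact sub_eq_zero.1 (abs_nonpos_iff.1 this)

/-- Weak solutions are transported by the flow. -/
theorem ae_eq_comp (h : LiouvilleFlow T b Z) (hT : 0 < T) (hf : WeakStarContinuous T f)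
    (hf₀ : MemLp f₀ ⊤ volume) (hw : WeakTransport T b f₀ f) {t : ℝ} (ht : t ∈ Ico 0 T) :
    ∀ᵐ z, f t z = f₀ (Z 0 t z) := by
  have h0 : (0 : ℝ) ∈ Ico 0 T := ⟨le_rfl, hT⟩
  have hf₀l := hf₀.locallyIntegrable le_top
  refine ae_eq_of_integral_contDiff_smul_eq (hf.locallyIntegrable ht)
    ((hf₀.comp_measurePreserving (h.preserving 0 h0 t ht)).locallyIntegrable le_top)
    fun ψ hψ hψc => ?_
  have h1 := h.integral_mul_eq_comp hT hf hw hψ hψc ht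
  have h2 : ∫ z, f 0 z * ψ (Z t 0 z) = ∫ z, f₀ z * ψ (Z t 0 z) :=
    integral_congr_ae ((h.ae_eq_initial hT hf hf₀l hw).mono fun z hz => by simp only [hz])
  have h3 := h.integral_comp h0 ht fun z => f₀ z * ψ (Z t 0 z)
  simp only [h.inv ht h0] at h3
  simp only [smul_eq_mul, mul_comm (ψ _)]
  rw [h1, h2, h3]

end LiouvilleFlow

end VlasovDarwin

namespace VlasovDarwin

open Filter Topology Function

/-! ### Regularised Newton and Darwin kernels -/

/-- `id + β n ⊗ n`. -/
noncomputable def dirTensor (β : ℝ) (n : E3) : E3 →L[ℝ] E3 :=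
  ContinuousLinearMap.id ℝ E3 + β • (innerSL ℝ n).smulRight n

theorem dirTensor_apply (β : ℝ) (n c : E3) :
    dirTensor β n c = c + (β * inner ℝ n c) • n := by
  simp [dirTensor, mul_smul]

/-- The angular part of the derivative of `(id + β n ⊗ n) c / |z|`, as a function of `c` and of
the direction of differentiation. -/
noncomputable def dirTensorDeriv (β : ℝ) (n : E3) : E3 →L[ℝ] E3 →L[ℝ] E3 :=
  (LinearMap.mk₂ ℝ (fun c h => (-inner ℝ n h) • c +
      β • ((inner ℝ n c) • h - (3 * inner ℝ n c * inner ℝ n h) • n + (inner ℝ c h) • n))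
    (fun c c' h => by simp only [inner_add_left, inner_add_right]; module)
    (fun a c h => by simp only [inner_smul_left, inner_smul_right, conj_trivial]; module)
    (fun c h h' => by simp only [inner_add_right]; module)
    (fun a c h => by simp only [inner_smul_right]; module)).toContinuousBilinearMap

theorem dirTensorDeriv_apply (β : ℝ) (n c h : E3) :
    dirTensorDeriv β n c h = (-inner ℝ n h) • c +
      β • ((inner ℝ n c) • h - (3 * inner ℝ n c * inner ℝ n h) • n + (inner ℝ c h) • n) := rfl

theorem norm_inner_smul_le (a b v : E3) : ‖(inner ℝ a b : ℝ) • v‖ ≤ ‖a‖ * ‖b‖ * ‖v‖ := by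
  rw [norm_smul]
  exact mul_le_mul_of_nonneg_right (abs_real_inner_le_norm a b) (norm_nonneg _)

theorem norm_inner_mul_inner_smul_le (a b c d v : E3) :
    ‖(3 * inner ℝ a b * inner ℝ c d : ℝ) • v‖ ≤ 3 * (‖a‖ * ‖b‖) * (‖c‖ * ‖d‖) * ‖v‖ := by
  rw [norm_smul, norm_mul, norm_mul, Real.norm_of_nonneg (by norm_num : (0 : ℝ) ≤ 3)]
  have h1 := abs_real_inner_le_norm a b
  have h2 := abs_real_inner_le_norm c d
  simp only [Real.norm_eq_abs]
  gcongr

theorem norm_dirTensor_le {β : ℝ} (hβ : |β| ≤ 1) {n : E3} (hn : ‖n‖ ≤ 1) :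
    ‖dirTensor β n‖ ≤ 2 := by
  refine ContinuousLinearMap.opNorm_le_bound _ (by norm_num) fun c => ?_
  rw [dirTensor_apply, mul_smul]
  have h1 : ‖β • (inner ℝ n c : ℝ) • n‖ ≤ ‖c‖ := by
    rw [norm_smul, Real.norm_eq_abs]
    calc |β| * ‖(inner ℝ n c : ℝ) • n‖ ≤ 1 * (1 * ‖c‖ * 1) := by
          have := norm_inner_smul_le n c n
          have h2 : ‖n‖ * ‖c‖ * ‖n‖ ≤ 1 * ‖c‖ * 1 := by gcongr
          exact mul_le_mul hβ (this.trans h2) (norm_nonneg _) zero_le_one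
      _ = ‖c‖ := by ring
  linarith [norm_add_le c (β • (inner ℝ n c : ℝ) • n)]

theorem norm_dirTensor_sub_le {β : ℝ} (hβ : |β| ≤ 1) {n n' : E3} (hn : ‖n‖ ≤ 1) (hn' : ‖n'‖ ≤ 1) :
    ‖dirTensor β n - dirTensor β n'‖ ≤ 2 * ‖n - n'‖ := by
  refine ContinuousLinearMap.opNorm_le_bound _ (by positivity) fun c => ?_
  rw [sub_apply, dirTensor_apply, dirTensor_apply]
  have h0 : c + (β * inner ℝ n c) • n - (c + (β * inner ℝ n' c) • n') =
      β • ((inner ℝ (n - n') c : ℝ) • n + (inner ℝ n' c : ℝ) • (n - n')) := by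
    rw [inner_sub_left]
    module
  rw [h0, norm_smul, Real.norm_eq_abs]
  have h1 := norm_inner_smul_le (n - n') c n
  have h2 := norm_inner_smul_le n' c (n - n')
  have h3 : ‖n - n'‖ * ‖c‖ * ‖n‖ ≤ ‖n - n'‖ * ‖c‖ * 1 := by gcongr
  have h4 : ‖n'‖ * ‖c‖ * ‖n - n'‖ ≤ 1 * ‖c‖ * ‖n - n'‖ := by gcongr
  calc _ ≤ 1 * (‖n - n'‖ * ‖c‖ * 1 + 1 * ‖c‖ * ‖n - n'‖) :=
        mul_le_mul hβ ((norm_add_le _ _).trans (add_le_add (h1.trans h3) (h2.trans h4)))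
          (norm_nonneg _) zero_le_one
    _ = _ := by ring

theorem norm_dirTensorDeriv_le {β : ℝ} (hβ : |β| ≤ 1) {n : E3} (hn : ‖n‖ ≤ 1) :
    ‖dirTensorDeriv β n‖ ≤ 6 := by
  refine ContinuousLinearMap.opNorm_le_bound₂ _ (by norm_num) fun c h => ?_
  rw [dirTensorDeriv_apply]
  have h1 := norm_inner_smul_le n h c
  have h2 := norm_inner_smul_le n c h
  have h3 := norm_inner_mul_inner_smul_le n c n h n
  have h4 := norm_inner_smul_le c h n
  have h1' : ‖n‖ * ‖h‖ * ‖c‖ ≤ 1 * ‖h‖ * ‖c‖ := by gcongr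
  have h2' : ‖n‖ * ‖c‖ * ‖h‖ ≤ 1 * ‖c‖ * ‖h‖ := by gcongr
  have h3' : 3 * (‖n‖ * ‖c‖) * (‖n‖ * ‖h‖) * ‖n‖ ≤ 3 * (1 * ‖c‖) * (1 * ‖h‖) * 1 := by gcongr
  have h4' : ‖c‖ * ‖h‖ * ‖n‖ ≤ ‖c‖ * ‖h‖ * 1 := by gcongr
  rw [neg_smul]
  refine (norm_add_le _ _).trans ?_
  rw [norm_neg, norm_smul β, Real.norm_eq_abs]
  set u := (inner ℝ n c : ℝ) • h
  set v := (3 * inner ℝ n c * inner ℝ n h : ℝ) • n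
  set w := (inner ℝ c h : ℝ) • n
  have h5 : ‖u - v + w‖ ≤ ‖u‖ + ‖v‖ + ‖w‖ := norm_add_le_of_le (norm_sub_le _ _) le_rfl
  have h6 : |β| * ‖u - v + w‖ ≤ 1 * (‖u‖ + ‖v‖ + ‖w‖) :=
    mul_le_mul hβ h5 (norm_nonneg _) zero_le_one
  linarith

theorem norm_dirTensorDeriv_sub_le {β : ℝ} (hβ : |β| ≤ 1) {n n' : E3} (hn : ‖n‖ ≤ 1)
    (hn' : ‖n'‖ ≤ 1) : ‖dirTensorDeriv β n - dirTensorDeriv β n'‖ ≤ 12 * ‖n - n'‖ := by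
  refine ContinuousLinearMap.opNorm_le_bound₂ _ (by positivity) fun c h => ?_
  rw [sub_apply, sub_apply, dirTensorDeriv_apply,
    dirTensorDeriv_apply]
  have h0 : (-inner ℝ n h) • c +
      β • ((inner ℝ n c) • h - (3 * inner ℝ n c * inner ℝ n h) • n + (inner ℝ c h) • n) -
      ((-inner ℝ n' h) • c +
      β • ((inner ℝ n' c) • h - (3 * inner ℝ n' c * inner ℝ n' h) • n' + (inner ℝ c h) • n')) =
      -((inner ℝ (n - n') h : ℝ) • c) + β • ((inner ℝ (n - n') c : ℝ) • h
        - (3 * inner ℝ (n - n') c * inner ℝ n h : ℝ) • n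
        - (3 * inner ℝ n' c * inner ℝ (n - n') h : ℝ) • n
        - (3 * inner ℝ n' c * inner ℝ n' h : ℝ) • (n - n') + (inner ℝ c h : ℝ) • (n - n')) := by
    simp only [inner_sub_left]
    module
  rw [h0]
  have h1 := norm_inner_smul_le (n - n') h c
  have h2 := norm_inner_smul_le (n - n') c h
  have h3 := norm_inner_mul_inner_smul_le (n - n') c n h n
  have h4 := norm_inner_mul_inner_smul_le n' c (n - n') h n
  have h5 := norm_inner_mul_inner_smul_le n' c n' h (n - n')
  have h6 := norm_inner_smul_le c h (n - n')
  set d := n - n'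
  have h3' : 3 * (‖d‖ * ‖c‖) * (‖n‖ * ‖h‖) * ‖n‖ ≤ 3 * (‖d‖ * ‖c‖) * (1 * ‖h‖) * 1 := by gcongr
  have h4' : 3 * (‖n'‖ * ‖c‖) * (‖d‖ * ‖h‖) * ‖n‖ ≤ 3 * (1 * ‖c‖) * (‖d‖ * ‖h‖) * 1 := by gcongr
  have h5' : 3 * (‖n'‖ * ‖c‖) * (‖n'‖ * ‖h‖) * ‖d‖ ≤ 3 * (1 * ‖c‖) * (1 * ‖h‖) * ‖d‖ := by gcongr
  refine (norm_add_le _ _).trans ?_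
  rw [norm_neg, norm_smul β, Real.norm_eq_abs]
  set u₁ := (inner ℝ d c : ℝ) • h
  set u₂ := (3 * inner ℝ d c * inner ℝ n h : ℝ) • n
  set u₃ := (3 * inner ℝ n' c * inner ℝ d h : ℝ) • n
  set u₄ := (3 * inner ℝ n' c * inner ℝ n' h : ℝ) • d
  set u₅ := (inner ℝ c h : ℝ) • d
  have h7 : ‖u₁ - u₂ - u₃ - u₄ + u₅‖ ≤ ‖u₁‖ + ‖u₂‖ + ‖u₃‖ + ‖u₄‖ + ‖u₅‖ :=
    norm_add_le_of_le (norm_sub_le_of_le (norm_sub_le_of_le (norm_sub_le _ _) le_rfl) le_rfl) le_rfl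
  have h8 : |β| * ‖u₁ - u₂ - u₃ - u₄ + u₅‖ ≤ 1 * (‖u₁‖ + ‖u₂‖ + ‖u₃‖ + ‖u₄‖ + ‖u₅‖) :=
    mul_le_mul hβ h7 (norm_nonneg _) zero_le_one
  linarith

/-- `(δ² + |z|²)^{-1/2}`. -/
noncomputable def softInv (δ : ℝ) (z : E3) : ℝ := (√(δ ^ 2 + ‖z‖ ^ 2))⁻¹

theorem softInv_nonneg (δ : ℝ) (z : E3) : 0 ≤ softInv δ z := inv_nonneg.2 (Real.sqrt_nonneg _)

theorem softInv_zero (z : E3) : softInv 0 z = ‖z‖⁻¹ := by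
  simp [softInv, Real.sqrt_sq (norm_nonneg z)]

theorem norm_le_sqrt (δ : ℝ) (z : E3) : ‖z‖ ≤ √(δ ^ 2 + ‖z‖ ^ 2) :=
  Real.le_sqrt_of_sq_le (by nlinarith [sq_nonneg δ])

theorem softInv_le_inv_norm {δ : ℝ} {z : E3} (hz : z ≠ 0) : softInv δ z ≤ ‖z‖⁻¹ :=
  inv_anti₀ (norm_pos_iff.2 hz) (norm_le_sqrt δ z)

theorem softInv_le_inv {δ : ℝ} (hδ : 0 < δ) (z : E3) : softInv δ z ≤ δ⁻¹ :=
  inv_anti₀ hδ (Real.le_sqrt_of_sq_le (by nlinarith [sq_nonneg ‖z‖]))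

theorem softInv_mul_norm_le (δ : ℝ) (z : E3) : softInv δ z * ‖z‖ ≤ 1 := by
  rw [softInv]
  rcases (Real.sqrt_nonneg (δ ^ 2 + ‖z‖ ^ 2)).eq_or_lt with h | h
  · rw [← h]
    simp
  · rw [inv_mul_le_iff₀ h, mul_one]
    exact norm_le_sqrt δ z

set_option maxSynthPendingDepth 3 in
instance : NormSMulClass ℝ (E3 →L[ℝ] E3 →L[ℝ] E3) := inferInstance

/-- The regularised direction of `z`. -/
noncomputable def softDir (δ : ℝ) (z : E3) : E3 := softInv δ z • z

theorem norm_softDir_le (δ : ℝ) (z : E3) : ‖softDir δ z‖ ≤ 1 := by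
  rw [softDir, norm_smul, Real.norm_of_nonneg (softInv_nonneg δ z)]
  exact softInv_mul_norm_le δ z

/-- The difference of reciprocals 1/a - 1/a' is (a' - a)/(a a'), and √(δ² + |z|²) is Lipschitz in z
with constant one. -/
theorem abs_softInv_sub_le {δ : ℝ} (hδ : 0 < δ) (z z' : E3) :
    |softInv δ z - softInv δ z'| ≤ softInv δ z * softInv δ z' * ‖z - z'‖ := by
  have hp : 0 < √(δ ^ 2 + ‖z‖ ^ 2) := Real.sqrt_pos.2 (by positivity)
  have hp' : 0 < √(δ ^ 2 + ‖z'‖ ^ 2) := Real.sqrt_pos.2 (by positivity)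
  rw [softInv, softInv, inv_sub_inv hp.ne' hp'.ne', abs_div, abs_of_pos (mul_pos hp hp'),
    ← mul_inv, div_eq_inv_mul]
  refine mul_le_mul_of_nonneg_left ?_ (by positivity)
  set a := √(δ ^ 2 + ‖z‖ ^ 2) with ha
  set a' := √(δ ^ 2 + ‖z'‖ ^ 2) with ha'
  have h1 : a ^ 2 = δ ^ 2 + ‖z‖ ^ 2 := Real.sq_sqrt (by positivity)
  have h2 : a' ^ 2 = δ ^ 2 + ‖z'‖ ^ 2 := Real.sq_sqrt (by positivity)
  have h3 : (a' - a) * (a + a') = (‖z'‖ - ‖z‖) * (‖z‖ + ‖z'‖) := by nlinarith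
  have h4 : ‖z‖ + ‖z'‖ ≤ a + a' := add_le_add (norm_le_sqrt δ z) (norm_le_sqrt δ z')
  have h5 : |a' - a| * (a + a') = |‖z'‖ - ‖z‖| * (‖z‖ + ‖z'‖) := by
    have := congrArg abs h3
    rwa [abs_mul, abs_mul, abs_of_pos (by positivity : 0 < a + a'),
      abs_of_nonneg (by positivity : 0 ≤ ‖z‖ + ‖z'‖)] at this
  have h6 : |‖z'‖ - ‖z‖| ≤ ‖z - z'‖ := by
    rw [norm_sub_rev]
    exact abs_norm_sub_norm_le z' z
  have h7 : |a' - a| * (a + a') ≤ ‖z - z'‖ * (a + a') := by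
    rw [h5]
    exact mul_le_mul h6 h4 (by positivity) (norm_nonneg _)
  exact le_of_mul_le_mul_right h7 (by positivity)

theorem norm_softDir_sub_le {δ : ℝ} (hδ : 0 < δ) (z z' : E3) :
    ‖softDir δ z - softDir δ z'‖ ≤ 2 * softInv δ z * ‖z - z'‖ := by
  have h0 : softDir δ z - softDir δ z' =
      softInv δ z • (z - z') + (softInv δ z - softInv δ z') • z' := by
    simp only [softDir]
    module
  rw [h0]
  refine (norm_add_le _ _).trans ?_
  rw [norm_smul, norm_smul, Real.norm_of_nonneg (softInv_nonneg δ z), Real.norm_eq_abs]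
  have h1 := mul_le_mul_of_nonneg_right (abs_softInv_sub_le hδ z z') (norm_nonneg z')
  have h2 := mul_le_mul_of_nonneg_left (softInv_mul_norm_le δ z')
    (mul_nonneg (softInv_nonneg δ z) (norm_nonneg (z - z')))
  nlinarith

/-- The numerator of the difference of reciprocals is √(δ² + |z|²) - |z| ≤ δ. -/
theorem inv_norm_sub_softInv {δ : ℝ} (hδ : 0 < δ) {z : E3} (hz : z ≠ 0) :
    |‖z‖⁻¹ - softInv δ z| ≤ ‖z‖⁻¹ * softInv δ z * δ := by
  have hp : 0 < √(δ ^ 2 + ‖z‖ ^ 2) := Real.sqrt_pos.2 (by positivity)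
  have hz' := norm_pos_iff.2 hz
  rw [abs_of_nonneg (sub_nonneg.2 (softInv_le_inv_norm hz)), softInv, inv_sub_inv hz'.ne' hp.ne',
    ← mul_inv, div_eq_inv_mul]
  refine mul_le_mul_of_nonneg_left ?_ (by positivity)
  rw [sub_le_iff_le_add]
  exact Real.sqrt_le_iff.2 ⟨by positivity, by nlinarith⟩

theorem norm_softDir_zero_sub_le {δ : ℝ} (hδ : 0 < δ) {z : E3} (hz : z ≠ 0) :
    ‖softDir 0 z - softDir δ z‖ ≤ softInv δ z * δ := by
  have hz' := norm_pos_iff.2 hz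
  rw [softDir, softDir, ← sub_smul, norm_smul, softInv_zero, Real.norm_eq_abs]
  calc _ ≤ ‖z‖⁻¹ * softInv δ z * δ * ‖z‖ :=
        mul_le_mul_of_nonneg_right (inv_norm_sub_softInv hδ hz) (norm_nonneg _)
    _ = _ := by field_simp

/-- `(id + β n ⊗ n) / |z|`, regularised at scale `δ`. -/
noncomputable def softKernel (β δ : ℝ) (z : E3) : E3 →L[ℝ] E3 :=
  softInv δ z • dirTensor β (softDir δ z)

/-- The derivative of `softKernel β δ z c` in `z`. -/
noncomputable def softKernelDeriv (β δ : ℝ) (z : E3) : E3 →L[ℝ] E3 →L[ℝ] E3 :=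
  softInv δ z ^ 2 • dirTensorDeriv β (softDir δ z)

variable {β : ℝ}

theorem norm_softKernel_le (hβ : |β| ≤ 1) (δ : ℝ) (z : E3) :
    ‖softKernel β δ z‖ ≤ 2 * softInv δ z := by
  rw [softKernel, norm_smul, Real.norm_of_nonneg (softInv_nonneg δ z), mul_comm]
  exact mul_le_mul_of_nonneg_right (norm_dirTensor_le hβ (norm_softDir_le δ z))
    (softInv_nonneg δ z)

theorem norm_softKernelDeriv_le (hβ : |β| ≤ 1) (δ : ℝ) (z : E3) :
    ‖softKernelDeriv β δ z‖ ≤ 6 * softInv δ z ^ 2 := by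
  rw [softKernelDeriv, norm_smul, Real.norm_of_nonneg (sq_nonneg _), mul_comm]
  exact mul_le_mul_of_nonneg_right (norm_dirTensorDeriv_le hβ (norm_softDir_le δ z)) (sq_nonneg _)

theorem norm_smul_sub_smul_le {F : Type*} [NormedAddCommGroup F] [NormedSpace ℝ F] (a b : ℝ)
    (u v : F) : ‖a • u - b • v‖ ≤ |a - b| * ‖u‖ + |b| * ‖u - v‖ := by
  have : a • u - b • v = (a - b) • u + b • (u - v) := by module
  rw [this]
  refine (norm_add_le _ _).trans ?_
  rw [norm_smul, norm_smul, Real.norm_eq_abs, Real.norm_eq_abs]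

/-- The product rule gives mixed products of the two soft inverses; they are dominated by cubes so
that each term depends on one point only. A cube has mass of order log(1/δ) near its singularity,
and this is where the logarithm in the modulus comes from. -/
theorem norm_softKernelDeriv_sub_le (hβ : |β| ≤ 1) {δ : ℝ} (hδ : 0 < δ) (z z' : E3) :
    ‖softKernelDeriv β δ z - softKernelDeriv β δ z'‖ ≤
      30 * (softInv δ z ^ 3 + softInv δ z' ^ 3) * ‖z - z'‖ := by
  refine (norm_smul_sub_smul_le (F := E3 →L[ℝ] E3 →L[ℝ] E3) _ _ _ _).trans ?_
  have h1 := abs_softInv_sub_le hδ z z'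
  have h2 := norm_dirTensorDeriv_le hβ (norm_softDir_le δ z)
  have h3 := (norm_dirTensorDeriv_sub_le hβ (norm_softDir_le δ z) (norm_softDir_le δ z')).trans
    (mul_le_mul_of_nonneg_left (norm_softDir_sub_le hδ z z') (by norm_num))
  have hs := softInv_nonneg δ z
  have hs' := softInv_nonneg δ z'
  set s := softInv δ z
  set s' := softInv δ z'
  set d := ‖z - z'‖
  have hd : 0 ≤ d := norm_nonneg _
  have h4 : |s ^ 2 - s' ^ 2| ≤ s * s' * d * (s + s') := by
    rw [sq_sub_sq, abs_mul, abs_of_nonneg (add_nonneg hs hs'), mul_comm]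
    exact mul_le_mul_of_nonneg_right h1 (add_nonneg hs hs')
  rw [abs_of_nonneg (sq_nonneg s')]
  have h5 : 0 ≤ (s + s') * (s - s') ^ 2 := mul_nonneg (add_nonneg hs hs') (sq_nonneg _)
  have h6 : s' ^ 2 * s ≤ s ^ 3 + s' ^ 3 := by
    have := mul_nonneg (mul_nonneg hs hs) hs'
    nlinarith
  have h7 : s * s' * (s + s') ≤ s ^ 3 + s' ^ 3 := by nlinarith
  calc _ ≤ (s * s' * d * (s + s')) * 6 + s' ^ 2 * (12 * (2 * s * d)) :=
        add_le_add (mul_le_mul h4 h2 (norm_nonneg (dirTensorDeriv β (softDir δ z))) (by positivity))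
          (mul_le_mul_of_nonneg_left h3 (sq_nonneg _))
    _ = (6 * (s * s' * (s + s')) + 24 * (s' ^ 2 * s)) * d := by ring
    _ ≤ (6 * (s ^ 3 + s' ^ 3) + 24 * (s ^ 3 + s' ^ 3)) * d := by gcongr
    _ = _ := by ring

theorem norm_softKernel_zero_sub_le (hβ : |β| ≤ 1) {δ : ℝ} (hδ : 0 < δ) {z : E3} (hz : z ≠ 0) :
    ‖softKernel β 0 z - softKernel β δ z‖ ≤ 4 * δ * ‖z‖⁻¹ ^ 2 := by
  refine (norm_smul_sub_smul_le (F := E3 →L[ℝ] E3) _ _ _ _).trans ?_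
  have h1 := inv_norm_sub_softInv hδ hz
  have h2 := norm_dirTensor_le hβ (norm_softDir_le 0 z)
  have h3 := (norm_dirTensor_sub_le hβ (norm_softDir_le 0 z) (norm_softDir_le δ z)).trans
    (mul_le_mul_of_nonneg_left (norm_softDir_zero_sub_le hδ hz) (by norm_num))
  have h4 : softInv δ z ≤ ‖z‖⁻¹ := softInv_le_inv_norm hz
  have hs := softInv_nonneg δ z
  rw [softInv_zero, abs_of_nonneg hs]
  set s := softInv δ z
  set s₀ := ‖z‖⁻¹
  have hs₀ : 0 ≤ s₀ := hs.trans h4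
  calc _ ≤ s₀ * s * δ * 2 + s * (2 * (s * δ)) :=
        add_le_add (mul_le_mul h1 h2 (norm_nonneg _) (by positivity))
          (mul_le_mul_of_nonneg_left h3 hs)
    _ ≤ s₀ * s₀ * δ * 2 + s₀ * (2 * (s₀ * δ)) := by gcongr
    _ = _ := by ring

/-- One soft factor is kept: the cruder weight |z|⁻³ would not be integrable, whereas |z|⁻² times
the soft inverse has mass of order log(1/δ), so the regularisation error is of order δ log(1/δ). -/
theorem norm_softKernelDeriv_zero_sub_le (hβ : |β| ≤ 1) {δ : ℝ} (hδ : 0 < δ) {z : E3}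
    (hz : z ≠ 0) : ‖softKernelDeriv β 0 z - softKernelDeriv β δ z‖ ≤
      24 * δ * (‖z‖⁻¹ ^ 2 * softInv δ z) := by
  refine (norm_smul_sub_smul_le (F := E3 →L[ℝ] E3 →L[ℝ] E3) _ _ _ _).trans ?_
  have h1 := inv_norm_sub_softInv hδ hz
  have h2 := norm_dirTensorDeriv_le hβ (norm_softDir_le 0 z)
  have h3 := (norm_dirTensorDeriv_sub_le hβ (norm_softDir_le 0 z) (norm_softDir_le δ z)).trans
    (mul_le_mul_of_nonneg_left (norm_softDir_zero_sub_le hδ hz) (by norm_num))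
  have h4 : softInv δ z ≤ ‖z‖⁻¹ := softInv_le_inv_norm hz
  have hs := softInv_nonneg δ z
  rw [softInv_zero, abs_of_nonneg (sq_nonneg (softInv δ z))]
  set s := softInv δ z
  set s₀ := ‖z‖⁻¹
  have hs₀ : 0 ≤ s₀ := hs.trans h4
  have h5 : |s₀ ^ 2 - s ^ 2| ≤ s₀ * s * δ * (s₀ + s) := by
    rw [sq_sub_sq, abs_mul, abs_of_nonneg (add_nonneg hs₀ hs), mul_comm]
    exact mul_le_mul_of_nonneg_right h1 (add_nonneg hs₀ hs)
  calc _ ≤ s₀ * s * δ * (s₀ + s) * 6 + s ^ 2 * (12 * (s * δ)) :=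
        add_le_add (mul_le_mul h5 h2 (norm_nonneg (dirTensorDeriv β (softDir 0 z))) (by positivity))
          (mul_le_mul_of_nonneg_left h3 (sq_nonneg _))
    _ ≤ s₀ * s * δ * (s₀ + s₀) * 6 + s₀ ^ 2 * (12 * (s * δ)) := by gcongr
    _ = _ := by ring

theorem hasFDerivAt_softInv {δ : ℝ} (hδ : 0 < δ) (z : E3) :
    HasFDerivAt (fun z : E3 => softInv δ z) ((-softInv δ z ^ 3) • innerSL ℝ z) z := by
  have hpos : 0 < δ ^ 2 + ‖z‖ ^ 2 := by positivity
  have hq : HasFDerivAt (fun z : E3 => δ ^ 2 + ‖z‖ ^ 2) (2 • innerSL ℝ z) z :=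
    (hasStrictFDerivAt_norm_sq z).hasFDerivAt.const_add _
  have h1 := (hasDerivAt_inv (Real.sqrt_pos.2 hpos).ne').comp_hasFDerivAt z (hq.sqrt hpos.ne')
  refine h1.congr_fderiv (ContinuousLinearMap.ext fun h => ?_)
  have : 0 < √(δ ^ 2 + ‖z‖ ^ 2) := Real.sqrt_pos.2 hpos
  simp only [softInv, smul_apply, nsmul_eq_mul, smul_eq_mul, Nat.cast_ofNat]
  field_simp

theorem hasFDerivAt_softDir {δ : ℝ} (hδ : 0 < δ) (z : E3) :
    HasFDerivAt (fun z : E3 => softDir δ z) (softInv δ z • ContinuousLinearMap.id ℝ E3 +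
      ((-softInv δ z ^ 3) • innerSL ℝ z).smulRight z) z :=
  (hasFDerivAt_softInv hδ z).smul (hasFDerivAt_id z)

/-- With s the soft inverse and n = s z one has ds = -s² n and dn = s (id - n ⊗ n) for every δ > 0.
The derivative therefore has the same algebraic form as for the singular kernel, and one formula
serves all δ. -/
theorem hasFDerivAt_softKernel (β : ℝ) {δ : ℝ} (hδ : 0 < δ) (z c : E3) :
    HasFDerivAt (fun z => softKernel β δ z c) (softKernelDeriv β δ z c) z := by
  have hs := hasFDerivAt_softInv hδ z
  have hn := hasFDerivAt_softDir hδ z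
  have hi := hn.inner ℝ (hasFDerivAt_const c z)
  have hm := hs.smul ((hasFDerivAt_const c z).add ((hi.const_mul β).smul hn))
  have hfun : (fun z => softKernel β δ z c) =
      fun z => softInv δ z • (c + (β * inner ℝ (softDir δ z) c) • softDir δ z) := by
    funext z
    rw [softKernel, smul_apply, dirTensor_apply]
  rw [hfun]
  refine hm.congr_fderiv (ContinuousLinearMap.ext fun h => ?_)
  rw [softKernelDeriv, smul_apply, smul_apply,
    dirTensorDeriv_apply]
  simp [softDir, inner_smul_left, fderivInnerCLM_apply]
  simp only [inner_add_left, inner_neg_left, inner_smul_left, conj_trivial, real_inner_comm h c]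
  module

end VlasovDarwin

namespace VlasovDarwin

open Filter Topology Function

/-! ### Weights with an integrable singularity -/

/-- A nonnegative function on `ℝ³`, integrable near the origin and at most one far from it. -/
structure NearWeight (w : E3 → ℝ) : Prop where
  measurable : Measurable w
  nonneg : ∀ z, 0 ≤ w z
  integrableOn : IntegrableOn w (Metric.ball 0 1)
  far : ∀ z, 1 ≤ ‖z‖ → w z ≤ 1

/-- The mass of a weight in the unit ball. -/
noncomputable def nearMass (w : E3 → ℝ) : ℝ := ∫ z in Metric.ball 0 1, w z

/-- A bounded density supported in a ball. -/
structure IsSource (R M : ℝ) (j : E3 → E3) : Prop where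
  aestronglyMeasurable : AEStronglyMeasurable j volume
  nonneg : 0 ≤ M
  bound : ∀ᵐ y, ‖j y‖ ≤ M
  support : ∀ᵐ y, R < ‖y‖ → j y = 0

theorem nearMass_nonneg {w : E3 → ℝ} (hw : NearWeight w) : 0 ≤ nearMass w :=
  integral_nonneg fun z => hw.nonneg z

/-- The weight is at most its restriction to the unit ball plus one; translation invariance makes
the bound independent of the centre x. -/
theorem NearWeight.integrableOn_translate {w : E3 → ℝ} (hw : NearWeight w) (x : E3) (R : ℝ) :
    IntegrableOn (fun y => w (y - x)) (Metric.closedBall 0 R) ∧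
    ∫ y in Metric.closedBall 0 R, w (y - x) ≤
      nearMass w + volume.real (Metric.closedBall (0 : E3) R) := by
  have h1 : Integrable (fun y => (Metric.ball (0 : E3) 1).indicator w (y - x)) :=
    ((integrable_indicator_iff measurableSet_ball).2 hw.integrableOn).comp_sub_right x
  have h2 : IntegrableOn (fun _ : E3 => (1 : ℝ)) (Metric.closedBall 0 R) :=
    integrableOn_const measure_closedBall_lt_top.ne
  have h3 := h1.integrableOn.add h2
  have hle : ∀ y, w (y - x) ≤ (Metric.ball (0 : E3) 1).indicator w (y - x) + 1 := fun y => by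
    by_cases h : y - x ∈ Metric.ball (0 : E3) 1
    · rw [indicator_of_mem h]
      linarith
    · rw [indicator_of_notMem h, zero_add]
      exact hw.far _ (by simpa using h)
  have hm : AEStronglyMeasurable (fun y => w (y - x)) (volume.restrict (Metric.closedBall 0 R)) :=
    (hw.measurable.comp (measurable_id.sub_const x)).aestronglyMeasurable
  have h4 : IntegrableOn (fun y => w (y - x)) (Metric.closedBall 0 R) :=
    h3.mono' hm (ae_of_all _ fun y => by
      rw [Real.norm_of_nonneg (hw.nonneg _)]
      exact hle y)
  refine ⟨h4, (integral_mono h4 h3 hle).trans ?_⟩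
  have h5 := integral_add h1.integrableOn h2
  refine h5.le.trans (add_le_add ?_ (by simp))
  refine (setIntegral_le_integral h1 (ae_of_all _ fun y => indicator_nonneg
    (fun z _ => hw.nonneg z) _)).trans ?_
  rw [integral_sub_right_eq_self (fun z => (Metric.ball (0 : E3) 1).indicator w z) x,
    integral_indicator measurableSet_ball, nearMass]

theorem IsSource.integral_weight_le {R M : ℝ} {j : E3 → E3} (hj : IsSource R M j) {w : E3 → ℝ}
    (hw : NearWeight w) (x : E3) : Integrable (fun y => w (y - x) * ‖j y‖) ∧
      ∫ y, w (y - x) * ‖j y‖ ≤ M * (nearMass w + volume.real (Metric.closedBall (0 : E3) R)) := by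
  obtain ⟨h1, h2⟩ := hw.integrableOn_translate x R
  have h3 : Integrable ((Metric.closedBall (0 : E3) R).indicator fun y => M * w (y - x)) :=
    (integrable_indicator_iff measurableSet_closedBall).2 (h1.const_mul M)
  have hle : ∀ᵐ y, w (y - x) * ‖j y‖ ≤
      (Metric.closedBall (0 : E3) R).indicator (fun y => M * w (y - x)) y := by
    filter_upwards [hj.bound, hj.support] with y hb hs
    by_cases hy : y ∈ Metric.closedBall (0 : E3) R
    · rw [indicator_of_mem hy, mul_comm]
      exact mul_le_mul_of_nonneg_right hb (hw.nonneg _)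
    · rw [indicator_of_notMem hy, hs (by simpa using hy), norm_zero, mul_zero]
  have hm : AEStronglyMeasurable (fun y => w (y - x) * ‖j y‖) volume :=
    (hw.measurable.comp (measurable_id.sub_const x)).aestronglyMeasurable.mul
      hj.aestronglyMeasurable.norm
  have h4 : Integrable (fun y => w (y - x) * ‖j y‖) := h3.mono' hm <| hle.mono fun y hy => by
    rwa [Real.norm_of_nonneg (mul_nonneg (hw.nonneg _) (norm_nonneg _))]
  refine ⟨h4, (integral_mono_ae h4 h3 hle).trans ?_⟩
  rw [integral_indicator measurableSet_closedBall, integral_const_mul]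
  exact mul_le_mul_of_nonneg_left h2 hj.nonneg

theorem measurable_softInv (δ : ℝ) : Measurable (softInv δ) := by
  unfold softInv
  fun_prop

theorem finrank_E3 : Module.finrank ℝ E3 = 3 := by simp

theorem nearWeight_inv : NearWeight fun z => ‖z‖⁻¹ := by
  refine ⟨by fun_prop, fun z => by positivity, ?_, fun z hz => inv_le_one_of_one_le₀ hz⟩
  rw [integrableOn_fun_norm_addHaar volume (f := fun r => r⁻¹), finrank_E3]
  have h : IntegrableOn (fun y : ℝ => y) (Ioo 0 1) :=
    (continuous_id.integrableOn_Icc (a := 0) (b := 1)).mono_set Ioo_subset_Icc_self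
  refine h.congr_fun (fun y hy => ?_) measurableSet_Ioo
  have := hy.1.ne'
  simp only [smul_eq_mul]
  field_simp

theorem nearWeight_inv_sq : NearWeight fun z => ‖z‖⁻¹ ^ 2 := by
  refine ⟨by fun_prop, fun z => by positivity, ?_,
    fun z hz => pow_le_one₀ (by positivity) (inv_le_one_of_one_le₀ hz)⟩
  rw [integrableOn_fun_norm_addHaar volume (f := fun r => r⁻¹ ^ 2), finrank_E3]
  have h : IntegrableOn (fun _ : ℝ => (1 : ℝ)) (Ioo 0 1) := integrableOn_const (by simp)
  refine h.congr_fun (fun y hy => ?_) measurableSet_Ioo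
  have := hy.1.ne'
  simp only [smul_eq_mul]
  field_simp

theorem nearWeight_inv_sq_softInv {δ : ℝ} (hδ : 0 < δ) :
    NearWeight fun z => ‖z‖⁻¹ ^ 2 * softInv δ z := by
  have hm : Measurable fun z : E3 => ‖z‖⁻¹ ^ 2 * softInv δ z :=
    nearWeight_inv_sq.measurable.mul (measurable_softInv δ)
  have h0 : ∀ z : E3, 0 ≤ ‖z‖⁻¹ ^ 2 * softInv δ z := fun z =>
    mul_nonneg (by positivity) (softInv_nonneg δ z)
  refine ⟨hm, h0, ?_, fun z hz => ?_⟩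
  · refine (nearWeight_inv_sq.integrableOn.const_mul δ⁻¹).mono' hm.aestronglyMeasurable
      (ae_of_all _ fun z => ?_)
    rw [Real.norm_of_nonneg (h0 z), mul_comm]
    exact mul_le_mul_of_nonneg_right (softInv_le_inv hδ z) (by positivity)
  · have hz0 : z ≠ 0 := fun h => by
      rw [h, norm_zero] at hz
      linarith
    have h1 : ‖z‖⁻¹ ≤ 1 := inv_le_one_of_one_le₀ hz
    exact mul_le_one₀ (pow_le_one₀ (by positivity) h1) (softInv_nonneg δ z)
      ((softInv_le_inv_norm hz0).trans h1)

/-- In polar coordinates the volume element r² cancels r⁻², and what remains is the integral of (δ²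
+ r²)^{-1/2} over ]0, 1[. It is at most 2 log((1 + δ)/δ), hence at most 2 (1 + N) for δ = e⁻ᴺ. -/
theorem exists_nearMass_le : ∃ C : ℝ, 0 ≤ C ∧ ∀ N : ℝ, 0 ≤ N →
    nearMass (fun z => ‖z‖⁻¹ ^ 2 * softInv (Real.exp (-N)) z) ≤ C * (1 + N) := by
  refine ⟨3 * volume.real (Metric.ball (0 : E3) 1) * 2, by positivity, fun N hN => ?_⟩
  set δ := Real.exp (-N) with hδ
  have hδ0 : 0 < δ := Real.exp_pos _
  have hδ1 : δ ≤ 1 := Real.exp_le_one_iff.2 (by linarith)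
  let f : ℝ → ℝ := (Iio 1).indicator fun r => r⁻¹ ^ 2 * (√(δ ^ 2 + r ^ 2))⁻¹
  have h1 : nearMass (fun z => ‖z‖⁻¹ ^ 2 * softInv δ z) = ∫ z : E3, f ‖z‖ := by
    rw [nearMass, ← integral_indicator measurableSet_ball]
    congr 1 with z
    by_cases hz : ‖z‖ < 1
    · rw [indicator_of_mem (by simpa using hz)]
      simp only [f]
      rw [indicator_of_mem (by simpa using hz)]
      rfl
    · rw [indicator_of_notMem (by simpa using hz)]
      simp only [f]
      rw [indicator_of_notMem (by simpa using hz)]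
  have h2 : ∫ r in Ioi (0 : ℝ), r ^ (3 - 1) • f r = ∫ r in Ioo (0 : ℝ) 1, (√(δ ^ 2 + r ^ 2))⁻¹ := by
    have h3 : ∀ r ∈ Ioi (0 : ℝ), r ^ (3 - 1) • f r =
        (Iio 1).indicator (fun r => (√(δ ^ 2 + r ^ 2))⁻¹) r := by
      intro r hr
      by_cases h : r ∈ Iio (1 : ℝ)
      · simp only [f, indicator_of_mem h, smul_eq_mul]
        have : r ≠ 0 := ne_of_gt hr
        field_simp
      · simp only [f, indicator_of_notMem h, smul_zero]
    rw [setIntegral_congr_fun measurableSet_Ioi h3, setIntegral_indicator measurableSet_Iio,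
      Ioi_inter_Iio]
  have hle : ∀ r ∈ Ioo (0 : ℝ) 1, (√(δ ^ 2 + r ^ 2))⁻¹ ≤ 2 * (δ + r)⁻¹ := by
    intro r hr
    have hr0 := hr.1
    have h4 : (δ + r) / 2 ≤ √(δ ^ 2 + r ^ 2) :=
      Real.le_sqrt_of_sq_le (by nlinarith [sq_nonneg (δ - r), mul_pos hδ0 hr0])
    calc _ ≤ ((δ + r) / 2)⁻¹ := inv_anti₀ (by positivity) h4
      _ = _ := by field_simp
  have hpos : ∀ r ∈ Icc (0 : ℝ) 1, 0 < δ + r := fun r hr => by linarith [hr.1]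
  have hc1 : ContinuousOn (fun r : ℝ => (√(δ ^ 2 + r ^ 2))⁻¹) (Icc 0 1) :=
    (Continuous.inv₀ (by fun_prop) fun r => (Real.sqrt_pos.2 (by positivity)).ne').continuousOn
  have hc2 : ContinuousOn (fun r : ℝ => 2 * (δ + r)⁻¹) (Icc 0 1) :=
    continuousOn_const.mul (ContinuousOn.inv₀ (by fun_prop) fun r hr => (hpos r hr).ne')
  have h5 : ∫ r in Ioo (0 : ℝ) 1, (√(δ ^ 2 + r ^ 2))⁻¹ ≤ 2 * (1 + N) := by
    refine (setIntegral_mono_on (hc1.integrableOn_Icc.mono_set Ioo_subset_Icc_self)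
      (hc2.integrableOn_Icc.mono_set Ioo_subset_Icc_self) measurableSet_Ioo hle).trans ?_
    rw [← integral_Ioc_eq_integral_Ioo, ← intervalIntegral.integral_of_le zero_le_one,
      intervalIntegral.integral_const_mul, intervalIntegral.integral_comp_add_left (fun r => r⁻¹) δ,
      integral_inv_of_pos (by linarith) (by linarith), add_zero,
      Real.log_div (by positivity) hδ0.ne', hδ, Real.log_exp, ← hδ]
    have := Real.log_le_sub_one_of_pos (by linarith : 0 < δ + 1)
    linarith
  rw [h1, integral_fun_norm_addHaar volume f, finrank_E3, h2, nsmul_eq_mul, smul_eq_mul]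
  calc _ ≤ ((3 : ℕ) : ℝ) * (volume.real (Metric.ball (0 : E3) 1) * (2 * (1 + N))) := by gcongr
    _ = _ := by
      push_cast
      ring

/-! ### The potentials and their derivatives -/

theorem continuous_dirTensor (β : ℝ) : Continuous (dirTensor β) := by
  rw [continuous_clm_apply]
  intro c
  simp only [dirTensor_apply]
  fun_prop

theorem continuous_dirTensorDeriv (β : ℝ) : Continuous (dirTensorDeriv β) := by
  rw [continuous_clm_apply]
  intro c
  rw [continuous_clm_apply]
  intro h
  simp only [dirTensorDeriv_apply]
  fun_prop

theorem measurable_softDir (δ : ℝ) : Measurable (softDir δ) :=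
  (measurable_softInv δ).smul measurable_id

theorem stronglyMeasurable_softKernel (β δ : ℝ) : StronglyMeasurable (softKernel β δ) :=
  (measurable_softInv δ).stronglyMeasurable.smul
    ((continuous_dirTensor β).comp_stronglyMeasurable (measurable_softDir δ).stronglyMeasurable)

theorem stronglyMeasurable_softKernelDeriv (β δ : ℝ) : StronglyMeasurable (softKernelDeriv β δ) :=
  ((measurable_softInv δ).pow_const 2).stronglyMeasurable.smul
    ((continuous_dirTensorDeriv β).comp_stronglyMeasurable
      (measurable_softDir δ).stronglyMeasurable)

theorem aestronglyMeasurable_clm_apply {α F : Type*} [MeasurableSpace α] {μ : Measure α}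
    [NormedAddCommGroup F] [NormedSpace ℝ F] {L : α → E3 →L[ℝ] F} {j : α → E3}
    (hL : AEStronglyMeasurable L μ) (hj : AEStronglyMeasurable j μ) :
    AEStronglyMeasurable (fun y => L y (j y)) μ :=
  (ContinuousLinearMap.id ℝ (E3 →L[ℝ] F)).aestronglyMeasurable_comp₂ hL hj

theorem norm_apply_sub_apply_le {F : Type*} [NormedAddCommGroup F] [NormedSpace ℝ F]
    (L L' : E3 →L[ℝ] F) (v : E3) : ‖L v - L' v‖ ≤ ‖L - L'‖ * ‖v‖ := by
  rw [← sub_apply]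
  exact ContinuousLinearMap.le_opNorm _ _

/-- The potential of the density `j`, regularised at scale `δ`. -/
noncomputable def potential (β δ : ℝ) (j : E3 → E3) (x : E3) : E3 :=
  ∫ y, softKernel β δ (y - x) (j y)

/-- The derivative of the potential. -/
noncomputable def potentialDeriv (β δ : ℝ) (j : E3 → E3) (x : E3) : E3 →L[ℝ] E3 :=
  -∫ y, softKernelDeriv β δ (y - x) (j y)

namespace IsSource

variable {R M β : ℝ} {j : E3 → E3}

theorem aestronglyMeasurable_kernel (hj : IsSource R M j) (β δ : ℝ) (x : E3) :
    AEStronglyMeasurable (fun y => softKernel β δ (y - x) (j y)) volume :=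
  aestronglyMeasurable_clm_apply
    ((stronglyMeasurable_softKernel β δ).comp_measurable
      (measurable_id.sub_const x)).aestronglyMeasurable hj.aestronglyMeasurable

theorem aestronglyMeasurable_kernelDeriv (hj : IsSource R M j) (β δ : ℝ) (x : E3) :
    AEStronglyMeasurable (fun y => softKernelDeriv β δ (y - x) (j y)) volume :=
  aestronglyMeasurable_clm_apply
    ((stronglyMeasurable_softKernelDeriv β δ).comp_measurable
      (measurable_id.sub_const x)).aestronglyMeasurable hj.aestronglyMeasurable

theorem ae_sub_ne (x : E3) : ∀ᵐ y : E3, y - x ≠ 0 :=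
  (Measure.ae_ne volume x).mono fun _ hy => sub_ne_zero.2 hy

theorem ae_norm_kernel_le (hβ : |β| ≤ 1) (δ : ℝ) (j : E3 → E3) (x : E3) :
    ∀ᵐ y, ‖softKernel β δ (y - x) (j y)‖ ≤ 2 * (‖y - x‖⁻¹ * ‖j y‖) := by
  filter_upwards [ae_sub_ne x] with y hy
  rw [← mul_assoc]
  refine (ContinuousLinearMap.le_opNorm _ _).trans (mul_le_mul_of_nonneg_right ?_ (norm_nonneg _))
  exact (norm_softKernel_le hβ δ _).trans
    (mul_le_mul_of_nonneg_left (softInv_le_inv_norm hy) (by norm_num))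

theorem ae_norm_kernelDeriv_le (hβ : |β| ≤ 1) (δ : ℝ) (j : E3 → E3) (x : E3) :
    ∀ᵐ y, ‖softKernelDeriv β δ (y - x) (j y)‖ ≤ 6 * (‖y - x‖⁻¹ ^ 2 * ‖j y‖) := by
  filter_upwards [ae_sub_ne x] with y hy
  rw [← mul_assoc]
  refine (ContinuousLinearMap.le_opNorm _ _).trans (mul_le_mul_of_nonneg_right ?_ (norm_nonneg _))
  exact (norm_softKernelDeriv_le hβ δ _).trans (mul_le_mul_of_nonneg_left
    (pow_le_pow_left₀ (softInv_nonneg _ _) (softInv_le_inv_norm hy) 2) (by norm_num))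

theorem integrable_kernel (hj : IsSource R M j) (hβ : |β| ≤ 1) (δ : ℝ) (x : E3) :
    Integrable fun y => softKernel β δ (y - x) (j y) :=
  ((hj.integral_weight_le nearWeight_inv x).1.const_mul 2).mono'
    (hj.aestronglyMeasurable_kernel β δ x) (ae_norm_kernel_le hβ δ j x)

theorem integrable_kernelDeriv (hj : IsSource R M j) (hβ : |β| ≤ 1) (δ : ℝ) (x : E3) :
    Integrable fun y => softKernelDeriv β δ (y - x) (j y) :=
  ((hj.integral_weight_le nearWeight_inv_sq x).1.const_mul 6).mono'
    (hj.aestronglyMeasurable_kernelDeriv β δ x) (ae_norm_kernelDeriv_le hβ δ j x)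

theorem norm_potential_le (hj : IsSource R M j) (hβ : |β| ≤ 1) (δ : ℝ) (x : E3) :
    ‖potential β δ j x‖ ≤ 2 * (M * (nearMass (fun z => ‖z‖⁻¹) +
      volume.real (Metric.closedBall (0 : E3) R))) := by
  obtain ⟨h1, h2⟩ := hj.integral_weight_le nearWeight_inv x
  refine (norm_integral_le_of_norm_le (h1.const_mul 2) (ae_norm_kernel_le hβ δ j x)).trans ?_
  rw [integral_const_mul]
  linarith

theorem norm_potentialDeriv_le (hj : IsSource R M j) (hβ : |β| ≤ 1) (δ : ℝ) (x : E3) :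
    ‖potentialDeriv β δ j x‖ ≤ 6 * (M * (nearMass (fun z => ‖z‖⁻¹ ^ 2) +
      volume.real (Metric.closedBall (0 : E3) R))) := by
  obtain ⟨h1, h2⟩ := hj.integral_weight_le nearWeight_inv_sq x
  rw [potentialDeriv, norm_neg]
  refine (norm_integral_le_of_norm_le (h1.const_mul 6) (ae_norm_kernelDeriv_le hβ δ j x)).trans ?_
  rw [integral_const_mul]
  linarith

theorem norm_potential_sub_le (hj : IsSource R M j) (hβ : |β| ≤ 1) {δ : ℝ} (hδ : 0 < δ) (x : E3) :
    ‖potential β 0 j x - potential β δ j x‖ ≤ 4 * δ * (M * (nearMass (fun z => ‖z‖⁻¹ ^ 2) +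
      volume.real (Metric.closedBall (0 : E3) R))) := by
  obtain ⟨h1, h2⟩ := hj.integral_weight_le nearWeight_inv_sq x
  rw [potential, potential, ← integral_sub (hj.integrable_kernel hβ 0 x)
    (hj.integrable_kernel hβ δ x)]
  refine (norm_integral_le_of_norm_le (h1.const_mul (4 * δ)) ?_).trans ?_
  · filter_upwards [ae_sub_ne x] with y hy
    rw [← mul_assoc]
    exact (norm_apply_sub_apply_le _ _ _).trans
      (mul_le_mul_of_nonneg_right (norm_softKernel_zero_sub_le hβ hδ hy) (norm_nonneg _))
  · rw [integral_const_mul]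
    exact mul_le_mul_of_nonneg_left h2 (by positivity)

theorem norm_potentialDeriv_zero_sub_le (hj : IsSource R M j) (hβ : |β| ≤ 1) {δ : ℝ} (hδ : 0 < δ)
    (x : E3) : ‖potentialDeriv β 0 j x - potentialDeriv β δ j x‖ ≤
      24 * δ * (M * (nearMass (fun z => ‖z‖⁻¹ ^ 2 * softInv δ z) +
      volume.real (Metric.closedBall (0 : E3) R))) := by
  obtain ⟨h1, h2⟩ := hj.integral_weight_le (nearWeight_inv_sq_softInv hδ) x
  rw [potentialDeriv, potentialDeriv, ← neg_sub', norm_neg,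
    ← integral_sub (hj.integrable_kernelDeriv hβ 0 x) (hj.integrable_kernelDeriv hβ δ x)]
  refine (norm_integral_le_of_norm_le (h1.const_mul (24 * δ)) ?_).trans ?_
  · filter_upwards [ae_sub_ne x] with y hy
    rw [← mul_assoc]
    exact (norm_apply_sub_apply_le _ _ _).trans
      (mul_le_mul_of_nonneg_right (norm_softKernelDeriv_zero_sub_le hβ hδ hy) (norm_nonneg _))
  · rw [integral_const_mul]
    exact mul_le_mul_of_nonneg_left h2 (by positivity)

/-- At scale δ the derivative of the potential is Lipschitz with constant of order log(1/δ): the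
cubes of the kernel estimate are dominated by the weight whose mass `exists_nearMass_le` controls.
-/
theorem norm_potentialDeriv_sub_le (hj : IsSource R M j) (hβ : |β| ≤ 1) {δ : ℝ} (hδ : 0 < δ)
    (x x' : E3) : ‖potentialDeriv β δ j x - potentialDeriv β δ j x'‖ ≤
      60 * ‖x - x'‖ * (M * (nearMass (fun z => ‖z‖⁻¹ ^ 2 * softInv δ z) +
      volume.real (Metric.closedBall (0 : E3) R))) := by
  obtain ⟨h1, h2⟩ := hj.integral_weight_le (nearWeight_inv_sq_softInv hδ) x
  obtain ⟨h1', h2'⟩ := hj.integral_weight_le (nearWeight_inv_sq_softInv hδ) x'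
  have hcube : ∀ z : E3, z ≠ 0 → softInv δ z ^ 3 ≤ ‖z‖⁻¹ ^ 2 * softInv δ z := fun z hz => by
    rw [pow_succ]
    exact mul_le_mul_of_nonneg_right (pow_le_pow_left₀ (softInv_nonneg _ _)
      (softInv_le_inv_norm hz) 2) (softInv_nonneg _ _)
  rw [potentialDeriv, potentialDeriv, ← neg_sub', norm_neg,
    ← integral_sub (hj.integrable_kernelDeriv hβ δ x) (hj.integrable_kernelDeriv hβ δ x')]
  refine (norm_integral_le_of_norm_le ((h1.add h1').const_mul (30 * ‖x - x'‖)) ?_).trans ?_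
  · filter_upwards [ae_sub_ne x, ae_sub_ne x'] with y hy hy'
    refine (norm_apply_sub_apply_le _ _ _).trans ?_
    have h3 := norm_softKernelDeriv_sub_le hβ hδ (y - x) (y - x')
    have h4 : y - x - (y - x') = -(x - x') := by abel
    rw [h4, norm_neg] at h3
    have h5 : 30 * (softInv δ (y - x) ^ 3 + softInv δ (y - x') ^ 3) * ‖x - x'‖ ≤
        30 * (‖y - x‖⁻¹ ^ 2 * softInv δ (y - x) + ‖y - x'‖⁻¹ ^ 2 * softInv δ (y - x')) *
          ‖x - x'‖ := by
      have := hcube _ hy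
      have := hcube _ hy'
      gcongr
    refine (mul_le_mul_of_nonneg_right (h3.trans h5) (norm_nonneg _)).trans (le_of_eq ?_)
    simp only [Pi.add_apply]
    ring
  · have h6 := integral_add h1 h1'
    rw [integral_const_mul]
    simp only [Pi.add_apply]
    rw [h6]
    nlinarith [norm_nonneg (x - x')]

theorem hasFDerivAt_potential_soft (hj : IsSource R M j) (hβ : |β| ≤ 1) {δ : ℝ} (hδ : 0 < δ)
    (x : E3) : HasFDerivAt (potential β δ j) (potentialDeriv β δ j x) x := by
  have hji : Integrable fun y => ‖j y‖ := by
    have h := (hj.integral_weight_le (w := fun _ => 1) ⟨measurable_const, fun _ => zero_le_one,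
      integrableOn_const measure_ball_lt_top.ne, fun _ _ => le_rfl⟩ x).1
    simpa using h
  rw [potentialDeriv, ← integral_neg]
  refine hasFDerivAt_integral_of_dominated_of_fderiv_le (μ := volume)
    (F := fun x y => softKernel β δ (y - x) (j y))
    (F' := fun x y => -softKernelDeriv β δ (y - x) (j y))
    (bound := fun y => 6 * δ⁻¹ ^ 2 * ‖j y‖) univ_mem
    (Eventually.of_forall fun x => hj.aestronglyMeasurable_kernel β δ x)
    (hj.integrable_kernel hβ δ x) (hj.aestronglyMeasurable_kernelDeriv β δ x).neg
    (ae_of_all _ fun y x _ => ?_) (hji.const_mul _) (ae_of_all _ fun y x _ => ?_)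
  · rw [norm_neg]
    refine (ContinuousLinearMap.le_opNorm _ _).trans
      (mul_le_mul_of_nonneg_right ?_ (norm_nonneg _))
    exact (norm_softKernelDeriv_le hβ δ _).trans (mul_le_mul_of_nonneg_left
      (pow_le_pow_left₀ (softInv_nonneg _ _) (softInv_le_inv hδ _) 2) (by norm_num))
  · have h := (hasFDerivAt_softKernel β hδ (y - x) (j y)).comp x ((hasFDerivAt_id x).const_sub y)
    rwa [ContinuousLinearMap.comp_neg, ContinuousLinearMap.comp_id] at h

end IsSource

/-- The potentials of bounded densities in a ball are differentiable, with bounded and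
log-Lipschitz derivatives, uniformly in the density. -/
theorem exists_potential_bounds (R : ℝ) : ∃ C : ℝ, 0 ≤ C ∧ ∀ β : ℝ, |β| ≤ 1 → ∀ (M : ℝ)
    (j : E3 → E3), IsSource R M j →
      (∀ x, HasFDerivAt (potential β 0 j) (potentialDeriv β 0 j x) x) ∧
      (∀ x, ‖potential β 0 j x‖ ≤ C * M) ∧ (∀ x, ‖potentialDeriv β 0 j x‖ ≤ C * M) ∧
      ∀ N, 0 ≤ N → ∀ x x', ‖potentialDeriv β 0 j x - potentialDeriv β 0 j x'‖ ≤
        C * M * (N * ‖x - x'‖ + Real.exp (-N)) := by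
  obtain ⟨K, hK0, hK⟩ := exists_nearMass_le
  set V := volume.real (Metric.closedBall (0 : E3) R) with hV
  have hV0 : 0 ≤ V := measureReal_nonneg
  set m₁ := nearMass fun z => ‖z‖⁻¹ with hm₁
  set m₂ := nearMass fun z => ‖z‖⁻¹ ^ 2 with hm₂
  have hm₁0 : 0 ≤ m₁ := nearMass_nonneg nearWeight_inv
  have hm₂0 : 0 ≤ m₂ := nearMass_nonneg nearWeight_inv_sq
  refine ⟨60 * (3 * K + V) + 36 * (m₂ + V) + 2 * (m₁ + V), by positivity,
    fun β hβ M j hj => ?_⟩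
  have hM := hj.nonneg
  have happ : ∀ N, 0 ≤ N → ∀ x, ‖potentialDeriv β 0 j x - potentialDeriv β (Real.exp (-N)) j x‖ ≤
      24 * Real.exp (-N) * (M * (K * (1 + N) + V)) := fun N hN x =>
    (hj.norm_potentialDeriv_zero_sub_le hβ (Real.exp_pos _) x).trans (by
      have := hK N hN
      gcongr)
  refine ⟨fun x => ?_, fun x => ?_, fun x => ?_, fun N hN x x' => ?_⟩
  -- The singular potential is not differentiated under the integral: regularised potentials
  -- converge pointwise, and their derivatives converge uniformly at the rate e⁻ᴺ (1 + N).
  · refine hasFDerivAt_of_tendstoUniformly (l := atTop) (𝕜 := ℝ)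
      (f := fun N : ℝ => potential β (Real.exp (-N)) j)
      (f' := fun N : ℝ => potentialDeriv β (Real.exp (-N)) j) ?_
      (fun N x => hj.hasFDerivAt_potential_soft hβ (Real.exp_pos _) x) (fun x => ?_) x
    · rw [Metric.tendstoUniformly_iff]
      intro ε hε
      have h1 : Tendsto (fun N : ℝ => 24 * Real.exp (-N) * (M * (K * (1 + N) + V))) atTop
          (𝓝 0) := by
        have h2 := Real.tendsto_pow_mul_exp_neg_atTop_nhds_zero 1
        have h3 := Real.tendsto_pow_mul_exp_neg_atTop_nhds_zero 0
        have h4 := (h2.const_mul (24 * M * K)).add (h3.const_mul (24 * M * (K + V)))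
        simp only [mul_zero, add_zero] at h4
        refine h4.congr fun N => ?_
        simp only [pow_one, pow_zero]
        ring
      filter_upwards [h1.eventually (gt_mem_nhds hε), eventually_ge_atTop 0] with N hN1 hN x
      rw [dist_eq_norm]
      exact (happ N hN x).trans_lt hN1
    · rw [tendsto_iff_norm_sub_tendsto_zero]
      have h3 := (Real.tendsto_pow_mul_exp_neg_atTop_nhds_zero 0).const_mul (4 * (M * (m₂ + V)))
      rw [mul_zero] at h3
      refine squeeze_zero (fun _ => norm_nonneg _) (fun N => ?_) h3
      rw [norm_sub_rev]
      refine (hj.norm_potential_sub_le hβ (Real.exp_pos (-N)) x).trans (le_of_eq ?_)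
      simp only [pow_zero]
      ring
  · refine (hj.norm_potential_le hβ 0 x).trans ?_
    have : 0 ≤ (60 * (3 * K + V) + 36 * (m₂ + V)) * M := by positivity
    linarith
  · refine (hj.norm_potentialDeriv_le hβ 0 x).trans ?_
    have : 0 ≤ (60 * (3 * K + V) + 30 * (m₂ + V) + 2 * (m₁ + V)) * M := by positivity
    linarith
  · have hd : 0 ≤ ‖x - x'‖ := norm_nonneg _
    -- For N ≥ 1 the regularisation scale is e^{-2N}, not e⁻ᴺ: the error e^{-2N} (1 + 2N) is then
    -- below a multiple of e⁻ᴺ, while the Lipschitz constant 1 + 2N is still of order N. For N < 1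
    -- the plain bound on the derivative is enough, since e⁻ᴺ ≥ 1/3.
    rcases le_or_gt 1 N with h1 | h1
    · have h2 := happ (2 * N) (by linarith) x
      have h3 := happ (2 * N) (by linarith) x'
      have h4 := (hj.norm_potentialDeriv_sub_le hβ (Real.exp_pos (-(2 * N))) x x').trans
        (mul_le_mul_of_nonneg_left (mul_le_mul_of_nonneg_left
          (add_le_add_left (hK (2 * N) (by linarith)) _) hM) (by positivity))
      have h5 : K * (1 + 2 * N) + V ≤ (3 * K + V) * N := by nlinarith
      have h6 : N * Real.exp (-(2 * N)) ≤ Real.exp (-N) := by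
        have h7 : Real.exp (-(2 * N)) = Real.exp (-N) * Real.exp (-N) := by
          rw [← Real.exp_add]
          ring_nf
        have h8 : N * Real.exp (-N) ≤ 1 := by
          rw [Real.exp_neg, ← div_eq_mul_inv, div_le_one (Real.exp_pos _)]
          linarith [Real.add_one_le_exp N]
        rw [h7, ← mul_assoc]
        exact mul_le_of_le_one_left (Real.exp_pos _).le h8
      set D₀ := potentialDeriv β 0 j
      set D := potentialDeriv β (Real.exp (-(2 * N))) j
      have h9 : ‖D₀ x - D₀ x'‖ ≤ ‖D₀ x - D x‖ + ‖D x - D x'‖ + ‖D₀ x' - D x'‖ := by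
        have : D₀ x - D₀ x' = (D₀ x - D x) + (D x - D x') - (D₀ x' - D x') := by abel
        rw [this]
        exact (norm_sub_le _ _).trans (add_le_add_left (norm_add_le _ _) _)
      have h10 : Real.exp (-(2 * N)) * (M * (K * (1 + 2 * N) + V)) ≤
          M * (3 * K + V) * Real.exp (-N) := by
        calc _ ≤ Real.exp (-(2 * N)) * (M * ((3 * K + V) * N)) := by gcongr
          _ = M * (3 * K + V) * (N * Real.exp (-(2 * N))) := by ring
          _ ≤ _ := by gcongr
      have h11 : ‖x - x'‖ * (M * (K * (1 + 2 * N) + V)) ≤ M * (3 * K + V) * (N * ‖x - x'‖) := by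
        calc _ ≤ ‖x - x'‖ * (M * ((3 * K + V) * N)) := by gcongr
          _ = _ := by ring
      have h12 : 0 ≤ (36 * (m₂ + V) + 2 * (m₁ + V)) * M * (N * ‖x - x'‖ + Real.exp (-N)) := by
        positivity
      have h13 : 0 ≤ M * (3 * K + V) * Real.exp (-N) := by positivity
      linarith
    · have h2 := hj.norm_potentialDeriv_le hβ 0 x
      have h3 := hj.norm_potentialDeriv_le hβ 0 x'
      have h4 := norm_sub_le (potentialDeriv β 0 j x) (potentialDeriv β 0 j x')
      have h5 : 1 ≤ 3 * Real.exp (-N) := by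
        have h6 : Real.exp (-1) ≤ Real.exp (-N) := Real.exp_le_exp.2 (by linarith)
        have h7 : 1 ≤ 3 * Real.exp (-1) := by
          rw [Real.exp_neg, ← div_eq_mul_inv, le_div_iff₀ (Real.exp_pos _), one_mul]
          linarith [Real.exp_one_lt_d9]
        linarith
      have h8 : 12 * (M * (m₂ + V)) * 1 ≤ 12 * (M * (m₂ + V)) * (3 * Real.exp (-N)) :=
        mul_le_mul_of_nonneg_left h5 (by positivity)
      have h9 : 0 ≤ (60 * (3 * K + V) + 2 * (m₁ + V)) * M * (N * ‖x - x'‖ + Real.exp (-N)) := by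
        positivity
      have h10 : 0 ≤ 36 * (m₂ + V) * M * (N * ‖x - x'‖) := by positivity
      linarith

end VlasovDarwin

namespace VlasovDarwin

open Filter Topology Function

/-! ### Gaussian moments -/

section Gaussian

variable {V : Type*} [NormedAddCommGroup V] [InnerProductSpace ℝ V] [FiniteDimensional ℝ V]
  [MeasurableSpace V] [BorelSpace V] (μ : Measure V) [μ.IsAddHaarMeasure]

theorem integral_inner_mul_gaussian (b : ℝ) (c : V) :
    ∫ u, inner ℝ u c * Real.exp (-b * ‖u‖ ^ 2) ∂μ = 0 := by
  have : μ.IsNegInvariant := Measure.IsAddHaarMeasure.isNegInvariant_of_regular μ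
  have h := integral_neg_eq_self (fun u : V => inner ℝ u c * Real.exp (-b * ‖u‖ ^ 2)) μ
  simp only [inner_neg_left, norm_neg, neg_mul, integral_neg] at h ⊢
  linarith

variable [Nontrivial V]

theorem integrable_norm_pow_mul_gaussian (k : ℕ) {b : ℝ} (hb : 0 < b) :
    Integrable (fun u : V => ‖u‖ ^ k * Real.exp (-b * ‖u‖ ^ 2)) μ := by
  refine (integrable_fun_norm_addHaar μ (f := fun r => r ^ k * Real.exp (-b * r ^ 2))).2 ?_
  have h := (integrable_rpow_mul_exp_neg_mul_sq hb
    (s := ((Module.finrank ℝ V - 1 + k : ℕ) : ℝ)) (by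
      have : (0 : ℝ) ≤ ((Module.finrank ℝ V - 1 + k : ℕ) : ℝ) := Nat.cast_nonneg _
      linarith)).integrableOn (s := Ioi 0)
  refine h.congr_fun (fun y _ => ?_) measurableSet_Ioi
  simp only [Real.rpow_natCast, pow_add, smul_eq_mul, mul_assoc]

theorem integrable_gaussian {b : ℝ} (hb : 0 < b) :
    Integrable (fun u : V => Real.exp (-b * ‖u‖ ^ 2)) μ := by
  simpa using integrable_norm_pow_mul_gaussian μ 0 hb

theorem integrable_inner_mul_gaussian {b : ℝ} (hb : 0 < b) (c : V) :
    Integrable (fun u : V => inner ℝ u c * Real.exp (-b * ‖u‖ ^ 2)) μ := by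
  refine ((integrable_norm_pow_mul_gaussian μ 1 hb).const_mul ‖c‖).mono'
    (by fun_prop) (ae_of_all _ fun u => ?_)
  rw [norm_mul, Real.norm_of_nonneg (Real.exp_pos _).le, pow_one, ← mul_assoc, mul_comm ‖c‖]
  exact mul_le_mul_of_nonneg_right (abs_real_inner_le_norm u c) (Real.exp_pos _).le

theorem integrable_inner_mul_inner_mul_gaussian {b : ℝ} (hb : 0 < b) (c d : V) :
    Integrable (fun u : V => inner ℝ u c * (inner ℝ u d * Real.exp (-b * ‖u‖ ^ 2))) μ := by
  refine ((integrable_norm_pow_mul_gaussian μ 2 hb).const_mul (‖c‖ * ‖d‖)).mono'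
    (by fun_prop) (ae_of_all _ fun u => ?_)
  rw [norm_mul, norm_mul, Real.norm_of_nonneg (Real.exp_pos _).le]
  calc _ ≤ (‖u‖ * ‖c‖) * ((‖u‖ * ‖d‖) * Real.exp (-b * ‖u‖ ^ 2)) := by
        gcongr
        · exact abs_real_inner_le_norm u c
        · exact abs_real_inner_le_norm u d
    _ = _ := by ring

/-- Integration by parts: the factor ⟨u, d⟩ times the Gaussian is, up to -2b, its derivative in the
direction d. -/
theorem integral_inner_mul_inner_mul_gaussian {b : ℝ} (hb : 0 < b) (c d : V) :
    ∫ u, inner ℝ u c * (inner ℝ u d * Real.exp (-b * ‖u‖ ^ 2)) ∂μ =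
      inner ℝ c d / (2 * b) * ∫ u, Real.exp (-b * ‖u‖ ^ 2) ∂μ := by
  have hf : ∀ u : V, HasFDerivAt (fun u : V => inner ℝ u c) (innerSL ℝ c) u := fun u => by
    have := (innerSL ℝ c).hasFDerivAt (x := u)
    refine this.congr_of_eventuallyEq (Eventually.of_forall fun v => ?_)
    simp [real_inner_comm]
  have hg : ∀ u : V, HasFDerivAt (fun u : V => Real.exp (-b * ‖u‖ ^ 2))
      ((-2 * b * Real.exp (-b * ‖u‖ ^ 2)) • innerSL ℝ u) u := fun u => by
    have h1 : HasFDerivAt (fun u : V => -b * ‖u‖ ^ 2) ((-b) • (2 • innerSL ℝ u)) u :=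
      (hasStrictFDerivAt_norm_sq u).hasFDerivAt.const_mul (-b)
    refine h1.exp.congr_fderiv (ContinuousLinearMap.ext fun v => ?_)
    simp
    ring
  have key := integral_mul_fderiv_eq_neg_fderiv_mul_of_integrable (μ := μ)
    (f := fun u : V => inner ℝ u c) (g := fun u : V => Real.exp (-b * ‖u‖ ^ 2)) (v := d)
    ?_ ?_ ?_ (fun u _ => (hf u).differentiableAt) (fun u _ => (hg u).differentiableAt)
  · simp only [(hf _).fderiv, (hg _).fderiv, smul_apply, innerSL_apply_apply, smul_eq_mul] at key
    rw [integral_const_mul] at key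
    have h2 : ∀ u : V, inner ℝ u c * (-2 * b * Real.exp (-b * ‖u‖ ^ 2) * inner ℝ u d) =
        (-2 * b) * (inner ℝ u c * (inner ℝ u d * Real.exp (-b * ‖u‖ ^ 2))) := fun u => by ring
    simp only [h2] at key
    rw [integral_const_mul] at key
    rw [div_mul_eq_mul_div, eq_div_iff (by positivity)]
    linarith
  · simp only [(hf _).fderiv, innerSL_apply_apply]
    exact (integrable_gaussian μ hb).const_mul _
  · simp only [(hg _).fderiv, smul_apply, innerSL_apply_apply, smul_eq_mul]
    refine ((integrable_inner_mul_inner_mul_gaussian μ hb c d).const_mul (-2 * b)).congr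
      (ae_of_all _ fun u => ?_)
    simp only
    ring
  · exact integrable_inner_mul_gaussian μ hb c

end Gaussian

/-! ### Positivity of the Darwin kernel -/

/-- The density, at width `a`, of the representation of the Darwin kernel by Gaussians. -/
noncomputable def gaussKernel (a : ℝ) (z c d : E3) : ℝ :=
  ((1 - a * ‖z‖ ^ 2) * inner ℝ c d + a * inner ℝ z c * inner ℝ z d) * Real.exp (-a * ‖z‖ ^ 2)

theorem integral_norm_sq_mul_gaussian {b : ℝ} (hb : 0 < b) :
    ∫ u : E3, ‖u‖ ^ 2 * Real.exp (-b * ‖u‖ ^ 2) =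
      3 / (2 * b) * ∫ u : E3, Real.exp (-b * ‖u‖ ^ 2) := by
  let e : Fin 3 → E3 := fun i => EuclideanSpace.single i 1
  have h : ∀ u : E3, ‖u‖ ^ 2 * Real.exp (-b * ‖u‖ ^ 2) =
      ∑ i, inner ℝ u (e i) * (inner ℝ u (e i) * Real.exp (-b * ‖u‖ ^ 2)) := fun u => by
    simp only [← mul_assoc, ← Finset.sum_mul]
    congr 1
    rw [EuclideanSpace.norm_sq_eq]
    simp [e, EuclideanSpace.inner_single_right, sq]
  simp only [h]
  rw [integral_finsetSum _ fun i _ => integrable_inner_mul_inner_mul_gaussian volume hb _ _]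
  simp only [integral_inner_mul_inner_mul_gaussian volume hb]
  simp [e]
  ring

/-- The Gaussian kernel as an autocorrelation. -/
theorem integral_autocorrelation {a : ℝ} (ha : 0 < a) (x y c d : E3) :
    ∫ w : E3, (inner ℝ (w - x) (w - y) * inner ℝ c d - inner ℝ (w - x) d * inner ℝ (w - y) c) *
        Real.exp (-(2 * a) * (‖w - x‖ ^ 2 + ‖w - y‖ ^ 2)) =
      (∫ u : E3, Real.exp (-(4 * a) * ‖u‖ ^ 2)) / (4 * a) * gaussKernel a (y - x) c d := by
  have h4 : 0 < 4 * a := by linarith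
  set ζ := (1 / 2 : ℝ) • (y - x) with hζ
  have hz : y - x = (2 : ℝ) • ζ := by
    rw [hζ, smul_smul]
    norm_num
  -- Centred at the midpoint of x and y, the exponent splits by the parallelogram law into a
  -- Gaussian in u and a constant. The polynomial then needs only moments up to order two, and its
  -- odd part integrates to zero.
  rw [← integral_add_right_eq_self _ ((1 / 2 : ℝ) • (x + y))]
  have hx : ∀ u : E3, u + (1 / 2 : ℝ) • (x + y) - x = u + ζ := fun u => by
    rw [hζ]
    module
  have hy : ∀ u : E3, u + (1 / 2 : ℝ) • (x + y) - y = u - ζ := fun u => by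
    rw [hζ]
    module
  simp only [hx, hy]
  have hexp : ∀ u : E3, Real.exp (-(2 * a) * (‖u + ζ‖ ^ 2 + ‖u - ζ‖ ^ 2)) =
      Real.exp (-(4 * a) * ‖u‖ ^ 2) * Real.exp (-(4 * a) * ‖ζ‖ ^ 2) := fun u => by
    rw [← Real.exp_add]
    congr 1
    have := parallelogram_law_with_norm ℝ u ζ
    linear_combination (-(2 * a)) * this
  have hpoly : ∀ u : E3, (inner ℝ (u + ζ) (u - ζ) * inner ℝ c d -
      inner ℝ (u + ζ) d * inner ℝ (u - ζ) c) * Real.exp (-(2 * a) * (‖u + ζ‖ ^ 2 + ‖u - ζ‖ ^ 2)) =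
      Real.exp (-(4 * a) * ‖ζ‖ ^ 2) * (inner ℝ c d * (‖u‖ ^ 2 * Real.exp (-(4 * a) * ‖u‖ ^ 2))
        - inner ℝ u d * (inner ℝ u c * Real.exp (-(4 * a) * ‖u‖ ^ 2))
        + (inner ℝ ζ d * inner ℝ ζ c - ‖ζ‖ ^ 2 * inner ℝ c d) * Real.exp (-(4 * a) * ‖u‖ ^ 2)
        + (inner ℝ ζ c * (inner ℝ u d * Real.exp (-(4 * a) * ‖u‖ ^ 2))
        - inner ℝ ζ d * (inner ℝ u c * Real.exp (-(4 * a) * ‖u‖ ^ 2)))) := fun u => by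
    rw [hexp]
    simp only [inner_add_left, inner_sub_left, inner_sub_right, real_inner_self_eq_norm_sq,
      real_inner_comm u ζ]
    ring
  simp only [hpoly]
  have i0 := integrable_gaussian (volume : Measure E3) h4
  have i1 := integrable_norm_pow_mul_gaussian (volume : Measure E3) 2 h4
  have i2 := integrable_inner_mul_inner_mul_gaussian (volume : Measure E3) h4 d c
  have i3 := fun v : E3 => integrable_inner_mul_gaussian (volume : Measure E3) h4 v
  have j1 := i1.const_mul (inner ℝ c d)
  have j2 := i0.const_mul (inner ℝ ζ d * inner ℝ ζ c - ‖ζ‖ ^ 2 * inner ℝ c d)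
  have j3 := (i3 d).const_mul (inner ℝ ζ c)
  have j4 := (i3 c).const_mul (inner ℝ ζ d)
  have e1 := integral_add ((j1.sub i2).add j2) (j3.sub j4)
  have e2 := integral_add (j1.sub i2) j2
  simp only [Pi.add_apply, Pi.sub_apply] at e1 e2
  rw [integral_const_mul, e1, e2, integral_sub j1 i2, integral_sub j3 j4]
  simp only [integral_const_mul]
  rw [integral_norm_sq_mul_gaussian h4, integral_inner_mul_inner_mul_gaussian volume h4,
    integral_inner_mul_gaussian, integral_inner_mul_gaussian, gaussKernel, hz]
  simp only [norm_smul, inner_smul_left, conj_trivial, Real.norm_ofNat, real_inner_comm c d]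
  have : -a * (2 * ‖ζ‖) ^ 2 = -(4 * a) * ‖ζ‖ ^ 2 := by ring
  rw [this]
  field_simp
  ring

/-- A kernel that is an autocorrelation is positive. -/
theorem integral_autocorrelation_nonneg {X W : Type*} [MeasurableSpace X] [MeasurableSpace W]
    {μ : Measure X} {ν : Measure W} [SFinite μ] [SFinite ν] {F : W → X → ℝ}
    (hF : Integrable (fun q : (X × X) × W => F q.2 q.1.1 * F q.2 q.1.2) ((μ.prod μ).prod ν)) :
    0 ≤ ∫ q : X × X, (∫ w, F w q.1 * F w q.2 ∂ν) ∂(μ.prod μ) := by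
  rw [integral_integral_swap (f := fun (q : X × X) w => F w q.1 * F w q.2) hF]
  refine integral_nonneg fun w => ?_
  simp only [Pi.zero_apply]
  rw [integral_prod_mul (F w) (F w)]
  exact mul_self_nonneg _

/-- Lagrange's identity for p ∧ c and q ∧ d. It writes the integrand of `integral_autocorrelation`
as a sum of products of one function taken at x and at y, as positivity requires; the antisymmetric
components are those of a curl, so the form is a magnetic energy. -/
theorem sum_antisymm_mul (p q c d : E3) :
    ∑ i : Fin 3, ∑ k : Fin 3, (p i * c k - p k * c i) * (q i * d k - q k * d i) =
      2 * (inner ℝ p q * inner ℝ c d - inner ℝ p d * inner ℝ q c) := by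
  simp only [PiLp.inner_apply, Fin.sum_univ_three, RCLike.inner_apply, conj_trivial]
  ring

section Positivity

variable {R M : ℝ} {j : E3 → E3}

theorem IsSource.integrable_norm (hj : IsSource R M j) : Integrable fun y => ‖j y‖ := by
  have h := (hj.integral_weight_le (w := fun _ => 1) ⟨measurable_const, fun _ => zero_le_one,
    integrableOn_const measure_ball_lt_top.ne, fun _ _ => le_rfl⟩ 0).1
  simpa using h

/-- Up to a positive constant the double integral is a sum over i, k of integrals of an
autocorrelation of F i k, and each is the integral over w of a square. -/
theorem integral_gaussKernel_nonneg (hj : IsSource R M j) (hjm : Measurable j) {a : ℝ}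
    (ha : 0 < a) : 0 ≤ ∫ q : E3 × E3, gaussKernel a (q.2 - q.1) (j q.1) (j q.2)
      ∂(volume.prod volume) := by
  let F : Fin 3 → Fin 3 → E3 → E3 → ℝ := fun i k w x =>
    ((w - x) i * j x k - (w - x) k * j x i) * Real.exp (-(2 * a) * ‖w - x‖ ^ 2)
  have hji := hj.integrable_norm
  have hcoord : ∀ (v : E3) (i : Fin 3), |v i| ≤ ‖v‖ := fun v i => by
    simpa using PiLp.norm_apply_le v i
  -- Half of the Gaussian decay is given up to absorb the linear growth of w - x.
  have hexp : ∀ r : ℝ, r * Real.exp (-(2 * a) * r ^ 2) ≤ (1 + a⁻¹) * Real.exp (-a * r ^ 2) := by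
    intro r
    have h1 : Real.exp (-(2 * a) * r ^ 2) = Real.exp (-a * r ^ 2) * Real.exp (-a * r ^ 2) := by
      rw [← Real.exp_add]
      ring_nf
    have h2 : r * Real.exp (-a * r ^ 2) ≤ 1 + a⁻¹ := by
      have h3 : -a * r ^ 2 = -(a * r ^ 2) := by ring
      rw [h3, Real.exp_neg, ← div_eq_mul_inv, div_le_iff₀ (Real.exp_pos _)]
      have h4 := Real.add_one_le_exp (a * r ^ 2)
      have h5 : r ≤ 1 + r ^ 2 := by nlinarith [sq_nonneg (r - 1)]
      have h6 : 1 + r ^ 2 ≤ (1 + a⁻¹) * (a * r ^ 2 + 1) := by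
        have : (1 + a⁻¹) * (a * r ^ 2 + 1) = a * r ^ 2 + 1 + r ^ 2 + a⁻¹ := by field_simp; ring
        rw [this]
        have := mul_nonneg ha.le (sq_nonneg r)
        have := inv_pos.2 ha
        linarith
      refine h5.trans (h6.trans (mul_le_mul_of_nonneg_left h4 ?_))
      have := inv_pos.2 ha
      linarith
    rw [h1, ← mul_assoc]
    exact mul_le_mul_of_nonneg_right h2 (Real.exp_pos _).le
  have hFb : ∀ i k w x, |F i k w x| ≤
      2 * ((1 + a⁻¹) * Real.exp (-a * ‖w - x‖ ^ 2)) * ‖j x‖ := by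
    intro i k w x
    have h1 : |(w - x) i * j x k - (w - x) k * j x i| ≤ 2 * ‖w - x‖ * ‖j x‖ := by
      have h2 : |(w - x) i * j x k| ≤ ‖w - x‖ * ‖j x‖ := by
        rw [abs_mul]
        exact mul_le_mul (hcoord _ _) (hcoord _ _) (abs_nonneg _) (norm_nonneg _)
      have h3 : |(w - x) k * j x i| ≤ ‖w - x‖ * ‖j x‖ := by
        rw [abs_mul]
        exact mul_le_mul (hcoord _ _) (hcoord _ _) (abs_nonneg _) (norm_nonneg _)
      refine (abs_sub _ _).trans ?_
      linarith
    rw [abs_mul, abs_of_pos (Real.exp_pos _)]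
    calc _ ≤ 2 * ‖w - x‖ * ‖j x‖ * Real.exp (-(2 * a) * ‖w - x‖ ^ 2) :=
          mul_le_mul_of_nonneg_right h1 (Real.exp_pos _).le
      _ = 2 * (‖w - x‖ * Real.exp (-(2 * a) * ‖w - x‖ ^ 2)) * ‖j x‖ := by ring
      _ ≤ _ := by
        have := hexp ‖w - x‖
        gcongr
  have hFm : ∀ i k, Measurable fun q : (E3 × E3) × E3 => F i k q.2 q.1.1 * F i k q.2 q.1.2 := by
    intro i k
    have h1 : ∀ i : Fin 3, Measurable fun v : E3 => v i := fun i => by fun_prop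
    have h2 : Measurable fun q : E3 × E3 => F i k q.1 q.2 := by
      have ha := (h1 i).comp (measurable_fst.sub measurable_snd : Measurable fun q : E3 × E3 => q.1 - q.2)
      have hb := (h1 k).comp (measurable_fst.sub measurable_snd : Measurable fun q : E3 × E3 => q.1 - q.2)
      have hc := (h1 i).comp (hjm.comp (measurable_snd : Measurable fun q : E3 × E3 => q.2))
      have hd := (h1 k).comp (hjm.comp (measurable_snd : Measurable fun q : E3 × E3 => q.2))
      exact ((ha.mul hd).sub (hb.mul hc)).mul (by fun_prop)
    exact (h2.comp (measurable_snd.prodMk (measurable_fst.comp measurable_fst))).mul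
      (h2.comp (measurable_snd.prodMk (measurable_snd.comp measurable_fst)))
  have hgauss : Integrable (fun q : (E3 × E3) × E3 =>
      ‖j q.1.1‖ * ‖j q.1.2‖ * Real.exp (-a * ‖q.2 - q.1.1‖ ^ 2))
      (((volume : Measure E3).prod volume).prod volume) := by
    have hm : Measurable fun q : (E3 × E3) × E3 =>
        ‖j q.1.1‖ * ‖j q.1.2‖ * Real.exp (-a * ‖q.2 - q.1.1‖ ^ 2) := by
      have h1 := hjm.comp (measurable_fst.comp (measurable_fst : Measurable fun q : (E3 × E3) × E3 => q.1))
      have h2 := hjm.comp (measurable_snd.comp (measurable_fst : Measurable fun q : (E3 × E3) × E3 => q.1))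
      exact (h1.norm.mul h2.norm).mul (by fun_prop)
    refine (integrable_prod_iff hm.aestronglyMeasurable).2 ⟨ae_of_all _ fun q => ?_, ?_⟩
    · exact ((integrable_gaussian volume ha).comp_sub_right q.1).const_mul (‖j q.1‖ * ‖j q.2‖)
    · have h1 : ∀ q : E3 × E3, ∫ w, ‖‖j q.1‖ * ‖j q.2‖ * Real.exp (-a * ‖w - q.1‖ ^ 2)‖ =
          ‖j q.1‖ * ‖j q.2‖ * ∫ w : E3, Real.exp (-a * ‖w‖ ^ 2) := fun q => by
        have h2 : ∀ w : E3, ‖‖j q.1‖ * ‖j q.2‖ * Real.exp (-a * ‖w - q.1‖ ^ 2)‖ =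
            ‖j q.1‖ * ‖j q.2‖ * Real.exp (-a * ‖w - q.1‖ ^ 2) := fun w =>
          Real.norm_of_nonneg (by positivity)
        simp only [h2]
        rw [integral_const_mul, integral_sub_right_eq_self
          (fun w : E3 => Real.exp (-a * ‖w‖ ^ 2)) q.1]
      simp only [h1]
      exact (hji.mul_prod hji).mul_const _
  have hFi : ∀ i k, Integrable (fun q : (E3 × E3) × E3 => F i k q.2 q.1.1 * F i k q.2 q.1.2)
      (((volume : Measure E3).prod volume).prod volume) := by
    intro i k
    -- Integrability in w needs the Gaussian of only one of the factors; the Gaussian of the other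
    -- is bounded by one.
    refine (hgauss.const_mul ((2 * (1 + a⁻¹)) ^ 2)).mono' (hFm i k).aestronglyMeasurable
      (ae_of_all _ fun q => ?_)
    rw [norm_mul]
    have h1 := hFb i k q.2 q.1.1
    have h2 : |F i k q.2 q.1.2| ≤ 2 * (1 + a⁻¹) * ‖j q.1.2‖ := by
      refine (hFb i k q.2 q.1.2).trans ?_
      have h3 : Real.exp (-a * ‖q.2 - q.1.2‖ ^ 2) ≤ 1 :=
        Real.exp_le_one_iff.2 (by nlinarith [sq_nonneg ‖q.2 - q.1.2‖])
      have h4 : 0 < 1 + a⁻¹ := by positivity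
      calc _ ≤ 2 * ((1 + a⁻¹) * 1) * ‖j q.1.2‖ := by gcongr
        _ = _ := by ring
    refine (mul_le_mul h1 h2 (abs_nonneg _) (by positivity)).trans (le_of_eq ?_)
    ring
  have hsum : ∀ x y w, ∑ i, ∑ k, F i k w x * F i k w y =
      2 * ((inner ℝ (w - x) (w - y) * inner ℝ (j x) (j y) -
        inner ℝ (w - x) (j y) * inner ℝ (w - y) (j x)) *
        Real.exp (-(2 * a) * (‖w - x‖ ^ 2 + ‖w - y‖ ^ 2))) := by
    intro x y w
    rw [← mul_assoc, ← sum_antisymm_mul, Finset.sum_mul]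
    refine Finset.sum_congr rfl fun i _ => ?_
    rw [Finset.sum_mul]
    refine Finset.sum_congr rfl fun k _ => ?_
    simp only [F]
    rw [mul_add, Real.exp_add]
    ring
  have hpos : 0 ≤ ∫ q : E3 × E3, (∑ i, ∑ k, ∫ w, F i k w q.1 * F i k w q.2)
      ∂((volume : Measure E3).prod volume) := by
    have hi : ∀ i k, Integrable (fun q : E3 × E3 => ∫ w, F i k w q.1 * F i k w q.2)
        ((volume : Measure E3).prod volume) := fun i k => (hFi i k).integral_prod_left
    rw [integral_finsetSum _ fun i _ => integrable_finsetSum _ fun k _ => hi i k]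
    refine Finset.sum_nonneg fun i _ => ?_
    rw [integral_finsetSum _ fun k _ => hi i k]
    exact Finset.sum_nonneg fun k _ => integral_autocorrelation_nonneg (hFi i k)
  have hZ : 0 < ∫ u : E3, Real.exp (-(4 * a) * ‖u‖ ^ 2) :=
    integral_exp_pos (integrable_gaussian volume (by linarith))
  have hae : ∀ᵐ q ∂((volume : Measure E3).prod volume),
      (∑ i, ∑ k, ∫ w, F i k w q.1 * F i k w q.2) =
      (2 * ((∫ u : E3, Real.exp (-(4 * a) * ‖u‖ ^ 2)) / (4 * a))) *
        gaussKernel a (q.2 - q.1) (j q.1) (j q.2) := by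
    have h1 : ∀ i k, ∀ᵐ q ∂((volume : Measure E3).prod volume),
        Integrable fun w => F i k w q.1 * F i k w q.2 := fun i k => (hFi i k).prod_right_ae
    have h2 : ∀ᵐ q ∂((volume : Measure E3).prod volume), ∀ i k,
        Integrable fun w => F i k w q.1 * F i k w q.2 :=
      ae_all_iff.2 fun i => ae_all_iff.2 fun k => h1 i k
    filter_upwards [h2] with q hq
    rw [mul_assoc, ← integral_autocorrelation ha, ← integral_const_mul]
    simp only [← hsum]
    rw [integral_finsetSum _ fun i _ => integrable_finsetSum _ fun k _ => hq i k]
    refine Finset.sum_congr rfl fun i _ => ?_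
    rw [integral_finsetSum _ fun k _ => hq i k]
  rw [integral_congr_ae hae, integral_const_mul] at hpos
  exact nonneg_of_mul_nonneg_right hpos (by positivity)

end Positivity

end VlasovDarwin

/-! ### From Gaussian kernels to the Darwin kernel -/

namespace VlasovDarwin

open Filter Topology Function

theorem inner_softKernel_zero (z c d : E3) : inner ℝ (softKernel 1 0 z c) d =
    ‖z‖⁻¹ * (inner ℝ c d + ‖z‖⁻¹ ^ 2 * (inner ℝ z c * inner ℝ z d)) := by
  rw [softKernel, smul_apply, dirTensor_apply, softDir, softInv_zero]
  simp only [inner_smul_left, inner_add_left, conj_trivial]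
  ring

theorem gaussKernel_sq (τ : ℝ) (z c d : E3) : gaussKernel (τ ^ 2) z c d =
    inner ℝ c d * Real.exp (-‖z‖ ^ 2 * ‖τ‖ ^ 2) + (inner ℝ z c * inner ℝ z d -
      ‖z‖ ^ 2 * inner ℝ c d) * (inner ℝ τ 1 * (inner ℝ τ 1 * Real.exp (-‖z‖ ^ 2 * ‖τ‖ ^ 2))) := by
  have h : -τ ^ 2 * ‖z‖ ^ 2 = -‖z‖ ^ 2 * ‖τ‖ ^ 2 := by
    rw [Real.norm_eq_abs, sq_abs]
    ring
  rw [gaussKernel, h]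
  simp only [RCLike.inner_apply, conj_trivial, one_mul]
  ring

/-- The Darwin kernel as a superposition of Gaussian kernels. -/
theorem integral_gaussKernel {z : E3} (hz : z ≠ 0) (c d : E3) :
    Integrable (fun τ : ℝ => gaussKernel (τ ^ 2) z c d) ∧
    ∫ τ : ℝ, gaussKernel (τ ^ 2) z c d = √Real.pi / 2 * inner ℝ (softKernel 1 0 z c) d := by
  have hr : 0 < ‖z‖ := norm_pos_iff.2 hz
  have hb : 0 < ‖z‖ ^ 2 := by positivity
  have i1 := (integrable_gaussian (volume : Measure ℝ) hb).const_mul (inner ℝ c d)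
  have i2 := (integrable_inner_mul_inner_mul_gaussian (volume : Measure ℝ) hb 1 1).const_mul
    (inner ℝ z c * inner ℝ z d - ‖z‖ ^ 2 * inner ℝ c d)
  simp only [gaussKernel_sq]
  refine ⟨i1.add i2, ?_⟩
  rw [integral_add i1 i2, integral_const_mul, integral_const_mul,
    integral_inner_mul_inner_mul_gaussian volume hb]
  have h1 : ∫ τ : ℝ, Real.exp (-‖z‖ ^ 2 * ‖τ‖ ^ 2) = √Real.pi * ‖z‖⁻¹ := by
    simp only [Real.norm_eq_abs, sq_abs]
    rw [integral_gaussian, Real.sqrt_div' _ (sq_nonneg _), Real.sqrt_sq hr.le, div_eq_mul_inv]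
  rw [h1, inner_softKernel_zero]
  simp only [RCLike.inner_apply, conj_trivial, one_mul]
  field_simp
  ring

/-- The polynomial prefactor in τ²|z|² is absorbed by half of the exponent. What remains integrates
in τ to a multiple of 1/|z|, the size of the Darwin kernel itself. -/
theorem abs_gaussKernel_le (τ : ℝ) (z c d : E3) :
    |gaussKernel (τ ^ 2) z c d| ≤ 4 * (‖c‖ * ‖d‖) * Real.exp (-(‖z‖ ^ 2 / 2) * ‖τ‖ ^ 2) := by
  set t := τ ^ 2 * ‖z‖ ^ 2 with ht
  have ht0 : 0 ≤ t := by positivity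
  have h1 : -(‖z‖ ^ 2 / 2) * ‖τ‖ ^ 2 = -(t / 2) := by
    rw [Real.norm_eq_abs, sq_abs]
    ring
  have h2 : -τ ^ 2 * ‖z‖ ^ 2 = -t := by ring
  have hcd := abs_real_inner_le_norm c d
  have hzc := abs_real_inner_le_norm z c
  have hzd := abs_real_inner_le_norm z d
  have h3 : |(1 - τ ^ 2 * ‖z‖ ^ 2) * inner ℝ c d + τ ^ 2 * inner ℝ z c * inner ℝ z d| ≤
      (1 + 2 * t) * (‖c‖ * ‖d‖) := by
    have h4 : |(1 - t) * inner ℝ c d| ≤ (1 + t) * (‖c‖ * ‖d‖) := by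
      rw [abs_mul]
      exact mul_le_mul (abs_le.2 ⟨by linarith, by linarith⟩) hcd (abs_nonneg _) (by linarith)
    have h5 : |τ ^ 2 * inner ℝ z c * inner ℝ z d| ≤ t * (‖c‖ * ‖d‖) := by
      rw [abs_mul, abs_mul, abs_of_nonneg (sq_nonneg τ)]
      calc _ ≤ τ ^ 2 * (‖z‖ * ‖c‖) * (‖z‖ * ‖d‖) := by gcongr
        _ = _ := by ring
    refine (abs_add_le _ _).trans ?_
    linarith
  have h6 : (1 + 2 * t) * Real.exp (-t) ≤ 4 * Real.exp (-(t / 2)) := by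
    have h7 : Real.exp (-t) = Real.exp (-(t / 2)) * Real.exp (-(t / 2)) := by
      rw [← Real.exp_add]
      ring_nf
    have h8 : (1 + 2 * t) * Real.exp (-(t / 2)) ≤ 4 := by
      rw [Real.exp_neg, ← div_eq_mul_inv, div_le_iff₀ (Real.exp_pos _)]
      linarith [Real.add_one_le_exp (t / 2)]
    rw [h7, ← mul_assoc]
    exact mul_le_mul_of_nonneg_right h8 (Real.exp_pos _).le
  rw [gaussKernel, abs_mul, abs_of_pos (Real.exp_pos _), h1, h2]
  calc _ ≤ (1 + 2 * t) * (‖c‖ * ‖d‖) * Real.exp (-t) :=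
        mul_le_mul_of_nonneg_right h3 (Real.exp_pos _).le
    _ = (1 + 2 * t) * Real.exp (-t) * (‖c‖ * ‖d‖) := by ring
    _ ≤ 4 * Real.exp (-(t / 2)) * (‖c‖ * ‖d‖) := by gcongr
    _ = _ := by ring

theorem ae_prod_sub_ne : ∀ᵐ q ∂((volume : Measure E3).prod volume), q.2 - q.1 ≠ 0 := by
  have hs : MeasurableSet {q : E3 × E3 | ¬q.2 - q.1 ≠ 0} :=
    ((measurable_snd.sub measurable_fst) (measurableSet_singleton 0).compl).compl
  refine (Measure.measure_prod_null hs).2 (ae_of_all _ fun x => ?_)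
  have : (Prod.mk x ⁻¹' {q : E3 × E3 | ¬q.2 - q.1 ≠ 0}) ⊆ {x} := fun y hy => by
    simpa [sub_eq_zero] using hy
  exact measure_mono_null this (measure_singleton x)

variable {R M : ℝ} {j : E3 → E3}

theorem integrable_norm_mul_norm_div (hj : IsSource R M j) (hjm : Measurable j) :
    Integrable (fun q : E3 × E3 => ‖j q.1‖ * (‖q.2 - q.1‖⁻¹ * ‖j q.2‖))
      ((volume : Measure E3).prod volume) := by
  have hm : AEStronglyMeasurable (fun q : E3 × E3 => ‖j q.1‖ * (‖q.2 - q.1‖⁻¹ * ‖j q.2‖))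
      ((volume : Measure E3).prod volume) := by
    have h1 := (hjm.comp (measurable_fst : Measurable fun q : E3 × E3 => q.1)).norm
    have h2 := (hjm.comp (measurable_snd : Measurable fun q : E3 × E3 => q.2)).norm
    exact (h1.mul ((by fun_prop : Measurable fun q : E3 × E3 => ‖q.2 - q.1‖⁻¹).mul
      h2)).aestronglyMeasurable
  have hw := fun x => hj.integral_weight_le nearWeight_inv x
  refine (integrable_prod_iff hm).2 ⟨ae_of_all _ fun x => (hw x).1.const_mul ‖j x‖, ?_⟩
  refine (hj.integrable_norm.mul_const (M * (nearMass (fun z => ‖z‖⁻¹) +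
    volume.real (Metric.closedBall (0 : E3) R)))).mono' hm.norm.integral_prod_right'
    (ae_of_all _ fun x => ?_)
  rw [Real.norm_of_nonneg (integral_nonneg fun y => norm_nonneg _)]
  have h1 : ∀ y, ‖‖j x‖ * (‖y - x‖⁻¹ * ‖j y‖)‖ = ‖j x‖ * (‖y - x‖⁻¹ * ‖j y‖) := fun y =>
    Real.norm_of_nonneg (by positivity)
  simp only [h1]
  rw [integral_const_mul]
  exact mul_le_mul_of_nonneg_left (hw x).2 (norm_nonneg _)

theorem continuous_gaussKernel :
    Continuous fun p : ℝ × E3 × E3 × E3 => gaussKernel p.1 p.2.1 p.2.2.1 p.2.2.2 := by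
  unfold gaussKernel
  fun_prop

/-- This absolute integrability in (x, y, τ) justifies exchanging the superposition in τ with the
double integral in space; it reduces to the integrability of |j(x)| |j(y)| / |y - x|. -/
theorem integrable_gaussKernel (hj : IsSource R M j) (hjm : Measurable j) :
    Integrable (fun q : (E3 × E3) × ℝ =>
      gaussKernel (q.2 ^ 2) (q.1.2 - q.1.1) (j q.1.1) (j q.1.2))
      (((volume : Measure E3).prod volume).prod volume) := by
  have hH := integrable_norm_mul_norm_div hj hjm
  have hmap : Measurable fun q : (E3 × E3) × ℝ =>
      (q.2 ^ 2, q.1.2 - q.1.1, j q.1.1, j q.1.2) := by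
    have h1 : Measurable fun q : (E3 × E3) × ℝ => j q.1.1 :=
      hjm.comp (measurable_fst.comp measurable_fst)
    have h2 : Measurable fun q : (E3 × E3) × ℝ => j q.1.2 :=
      hjm.comp (measurable_snd.comp measurable_fst)
    exact (measurable_snd.pow_const 2).prodMk (((measurable_snd.comp measurable_fst).sub
      (measurable_fst.comp measurable_fst)).prodMk (h1.prodMk h2))
  have hGm : Measurable fun q : (E3 × E3) × ℝ =>
      gaussKernel (q.2 ^ 2) (q.1.2 - q.1.1) (j q.1.1) (j q.1.2) :=
    continuous_gaussKernel.measurable.comp hmap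
  refine (integrable_prod_iff hGm.aestronglyMeasurable).2 ⟨?_, ?_⟩
  · exact ae_prod_sub_ne.mono fun q hq => (integral_gaussKernel hq (j q.1) (j q.2)).1
  · refine (hH.const_mul (4 * √(2 * Real.pi))).mono'
      hGm.aestronglyMeasurable.norm.integral_prod_right' ?_
    filter_upwards [ae_prod_sub_ne] with q hq
    have hr : 0 < ‖q.2 - q.1‖ := norm_pos_iff.2 hq
    have hb : 0 < ‖q.2 - q.1‖ ^ 2 / 2 := by positivity
    rw [Real.norm_of_nonneg (integral_nonneg fun y => norm_nonneg _)]
    refine (integral_mono (integral_gaussKernel hq (j q.1) (j q.2)).1.norm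
      ((integrable_gaussian (volume : Measure ℝ) hb).const_mul (4 * (‖j q.1‖ * ‖j q.2‖)))
      fun τ => abs_gaussKernel_le τ _ _ _).trans (le_of_eq ?_)
    rw [integral_const_mul]
    simp only [Real.norm_eq_abs, sq_abs]
    have h1 : Real.pi / (‖q.2 - q.1‖ ^ 2 / 2) = 2 * Real.pi / ‖q.2 - q.1‖ ^ 2 := by field_simp
    rw [integral_gaussian, h1, Real.sqrt_div' _ (sq_nonneg _), Real.sqrt_sq hr.le]
    field_simp

theorem integral_inner_potential_nonneg_of_measurable (hj : IsSource R M j) (hjm : Measurable j) :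
    0 ≤ ∫ x, inner ℝ (j x) (potential 1 0 j x) := by
  have hH := integrable_norm_mul_norm_div hj hjm
  have hm1 := hjm.comp (measurable_fst : Measurable fun q : E3 × E3 => q.1)
  have hm2 := hjm.comp (measurable_snd : Measurable fun q : E3 × E3 => q.2)
  have hz : Measurable fun q : E3 × E3 => q.2 - q.1 := measurable_snd.sub measurable_fst
  have hG := integrable_gaussKernel hj hjm
  have hpos : 0 ≤ ∫ τ : ℝ, ∫ q : E3 × E3, gaussKernel (τ ^ 2) (q.2 - q.1) (j q.1) (j q.2)
      ∂((volume : Measure E3).prod volume) := by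
    refine integral_nonneg_of_ae ?_
    -- Positivity of the Gaussian form was proved for widths τ² > 0, so the single value τ = 0 is
    -- discarded.
    filter_upwards [Measure.ae_ne volume (0 : ℝ)] with τ hτ
    exact integral_gaussKernel_nonneg hj hjm (by positivity)
  rw [← integral_integral_swap (f := fun (q : E3 × E3) τ =>
    gaussKernel (τ ^ 2) (q.2 - q.1) (j q.1) (j q.2)) hG] at hpos
  have hcongr : ∫ q : E3 × E3, (∫ τ : ℝ, gaussKernel (τ ^ 2) (q.2 - q.1) (j q.1) (j q.2))
      ∂((volume : Measure E3).prod volume) = √Real.pi / 2 *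
      ∫ q : E3 × E3, inner ℝ (j q.1) (softKernel 1 0 (q.2 - q.1) (j q.2))
        ∂((volume : Measure E3).prod volume) := by
    rw [← integral_const_mul]
    refine integral_congr_ae ?_
    filter_upwards [ae_prod_sub_ne] with q hq
    rw [(integral_gaussKernel hq (j q.1) (j q.2)).2, inner_softKernel_zero,
      real_inner_comm (softKernel 1 0 (q.2 - q.1) (j q.2)) (j q.1), inner_softKernel_zero,
      real_inner_comm (j q.1) (j q.2)]
    ring
  rw [hcongr] at hpos
  have hpos2 := nonneg_of_mul_nonneg_right hpos (by positivity)
  have hKi : Integrable (fun q : E3 × E3 => inner ℝ (j q.1) (softKernel 1 0 (q.2 - q.1) (j q.2)))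
      ((volume : Measure E3).prod volume) := by
    have hm3 : AEStronglyMeasurable (fun q : E3 × E3 => softKernel 1 0 (q.2 - q.1) (j q.2))
        ((volume : Measure E3).prod volume) := aestronglyMeasurable_clm_apply
      ((stronglyMeasurable_softKernel 1 0).comp_measurable hz).aestronglyMeasurable
      hm2.aestronglyMeasurable
    refine (hH.const_mul 2).mono' (hm1.aestronglyMeasurable.inner hm3) ?_
    filter_upwards [ae_prod_sub_ne] with q hq
    have h1 := (softKernel 1 0 (q.2 - q.1)).le_opNorm (j q.2)
    have h2 := (norm_softKernel_le (β := 1) (by simp) 0 (q.2 - q.1)).trans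
      (mul_le_mul_of_nonneg_left (softInv_le_inv_norm hq) (by norm_num))
    calc _ ≤ ‖j q.1‖ * ‖softKernel 1 0 (q.2 - q.1) (j q.2)‖ := abs_real_inner_le_norm _ _
      _ ≤ ‖j q.1‖ * (2 * ‖q.2 - q.1‖⁻¹ * ‖j q.2‖) := by
        refine mul_le_mul_of_nonneg_left (h1.trans ?_) (norm_nonneg _)
        exact mul_le_mul_of_nonneg_right h2 (norm_nonneg _)
      _ = _ := by ring
  rw [integral_prod _ hKi] at hpos2
  refine hpos2.trans (le_of_eq ?_)
  congr 1 with x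
  exact integral_inner (hj.integrable_kernel (by simp) 0 x) (j x)

/-- The Darwin kernel is positive. -/
theorem integral_inner_potential_nonneg (hj : IsSource R M j) :
    0 ≤ ∫ x, inner ℝ (j x) (potential 1 0 j x) := by
  obtain ⟨j', hj'm, hjj'⟩ := hj.aestronglyMeasurable
  have hj' : IsSource R M j' := by
    refine ⟨hj'm.aestronglyMeasurable, hj.nonneg, ?_, ?_⟩
    · filter_upwards [hjj', hj.bound] with y h1 h2
      rwa [← h1]
    · filter_upwards [hjj', hj.support] with y h1 h2
      rwa [← h1]
  have hpot : ∀ x, potential 1 0 j x = potential 1 0 j' x := fun x =>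
    integral_congr_ae (hjj'.mono fun y hy => by simp only [hy])
  refine (integral_inner_potential_nonneg_of_measurable hj' hj'm.measurable).trans (le_of_eq ?_)
  refine integral_congr_ae (hjj'.mono fun x hx => ?_)
  simp only [hx, hpot]

end VlasovDarwin

namespace VlasovDarwin

open Filter Topology Function

/-! ### Velocity moments of phase space densities -/

/-- A bounded function on phase space that vanishes outside a ball. -/
structure IsBoundedDensity (R M : ℝ) (g : Phase → ℝ) : Prop where
  aestronglyMeasurable : AEStronglyMeasurable g volume
  nonneg : 0 ≤ M
  bound : ∀ᵐ z, ‖g z‖ ≤ M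
  support : ∀ᵐ z : Phase, R < ‖z‖ → g z = 0

/-- The density `∫ g(y, p) u(y, p) dp`. -/
noncomputable def moment (g : Phase → ℝ) (u : Phase → E3) (y : E3) : E3 :=
  ∫ p : E3, g (y, p) • u (y, p)

theorem currentDensity_eq (f : ℝ → Phase → ℝ) (A : ℝ → E3 → E3) (t : ℝ) :
    currentDensity f A t = moment (f t) (velocity A t) := rfl

variable {R M K : ℝ} {g : Phase → ℝ} {u : Phase → E3}

namespace IsBoundedDensity

theorem ae_norm_smul_le (hg : IsBoundedDensity R M g) (hK : ∀ z, ‖u z‖ ≤ K) :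
    ∀ᵐ z : Phase, ‖g z • u z‖ ≤ (Metric.closedBall (0 : E3) R).indicator (fun _ => 1) z.1 *
      (Metric.closedBall (0 : E3) R).indicator (fun _ => M * K) z.2 := by
  filter_upwards [hg.bound, hg.support] with z h1 h2
  by_cases hz : R < ‖z‖
  · rw [h2 hz, zero_smul, norm_zero]
    exact mul_nonneg (indicator_nonneg (fun _ _ => zero_le_one) _)
      (indicator_nonneg (fun _ _ => mul_nonneg hg.nonneg ((norm_nonneg _).trans (hK 0))) _)
  · rw [not_lt] at hz
    rw [indicator_of_mem (by simpa using (norm_fst_le z).trans hz),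
      indicator_of_mem (by simpa using (norm_snd_le z).trans hz), norm_smul, one_mul]
    exact mul_le_mul h1 (hK z) (norm_nonneg _) hg.nonneg

theorem integrable_indicator_ball (R c : ℝ) :
    Integrable ((Metric.closedBall (0 : E3) R).indicator fun _ => c) :=
  (integrable_indicator_iff measurableSet_closedBall).2
    (integrableOn_const measure_closedBall_lt_top.ne)

theorem isSource_moment (hg : IsBoundedDensity R M g) (hu : AEStronglyMeasurable u volume)
    (hK : ∀ z, ‖u z‖ ≤ K) :
    IsSource R (M * K * volume.real (Metric.closedBall (0 : E3) R)) (moment g u) := by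
  have hK0 : 0 ≤ K := (norm_nonneg _).trans (hK 0)
  have hae := Measure.ae_ae_of_ae_prod (μ := (volume : Measure E3)) (ν := (volume : Measure E3))
    (hg.ae_norm_smul_le hK)
  have hind : ∫ p, (Metric.closedBall (0 : E3) R).indicator (fun _ => M * K) p =
      M * K * volume.real (Metric.closedBall (0 : E3) R) := by
    rw [integral_indicator measurableSet_closedBall, setIntegral_const, smul_eq_mul, mul_comm]
  refine ⟨?_, mul_nonneg (mul_nonneg hg.nonneg hK0) measureReal_nonneg, ?_, ?_⟩
  · exact AEStronglyMeasurable.integral_prod_right' (μ := (volume : Measure E3))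
      (ν := (volume : Measure E3)) (f := fun z : E3 × E3 => g z • u z)
      (hg.aestronglyMeasurable.smul hu)
  · filter_upwards [hae] with y hy
    refine (norm_integral_le_of_norm_le (integrable_indicator_ball R (M * K))
      (hy.mono fun p hp => hp.trans ?_)).trans hind.le
    refine mul_le_of_le_one_left (indicator_nonneg (fun _ _ => mul_nonneg hg.nonneg hK0) _) ?_
    exact indicator_le_self' (fun _ _ => zero_le_one) _
  · filter_upwards [hae] with y hy hR
    refine integral_eq_zero_of_ae (hy.mono fun p hp => ?_)
    rw [indicator_of_notMem (by simpa using hR), zero_mul] at hp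
    exact norm_le_zero_iff.1 hp

variable {F : Type*} [NormedAddCommGroup F] [NormedSpace ℝ F] {L : E3 → E3 →L[ℝ] F}
  {w : E3 → ℝ} {a : ℝ} {x : E3}

theorem integrable_pairing_bound (hw : NearWeight w) (a b R : ℝ) (x : E3) :
    Integrable fun z : Phase => (Metric.closedBall (0 : E3) R).indicator
      (fun y => a * w (y - x)) z.1 * (Metric.closedBall (0 : E3) R).indicator (fun _ => b) z.2 :=
  ((integrable_indicator_iff measurableSet_closedBall).2
    ((hw.integrableOn_translate x R).1.const_mul a)).mul_prod (integrable_indicator_ball R b)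

theorem ae_norm_pairing_le (hg : IsBoundedDensity R M g) (hK : ∀ z, ‖u z‖ ≤ K)
    (hw : NearWeight w) (ha : 0 ≤ a) (hL : ∀ y, ‖L y‖ ≤ a * w (y - x)) :
    ∀ᵐ z : Phase, ‖g z • L z.1 (u z)‖ ≤ (Metric.closedBall (0 : E3) R).indicator
      (fun y => a * w (y - x)) z.1 *
        (Metric.closedBall (0 : E3) R).indicator (fun _ => M * K) z.2 := by
  have hw0 : ∀ y, 0 ≤ a * w (y - x) := fun y => mul_nonneg ha (hw.nonneg _)
  filter_upwards [hg.ae_norm_smul_le hK] with z hz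
  rw [← map_smul]
  refine ((L z.1).le_opNorm _).trans ((mul_le_mul (hL z.1) hz (norm_nonneg _) (hw0 _)).trans ?_)
  rw [← mul_assoc]
  refine mul_le_mul_of_nonneg_right ?_ (indicator_nonneg (fun _ _ =>
    mul_nonneg hg.nonneg ((norm_nonneg _).trans (hK 0))) _)
  by_cases h : z.1 ∈ Metric.closedBall (0 : E3) R
  · simp [indicator_of_mem h]
  · simp [indicator_of_notMem h]

theorem integrable_pairing (hg : IsBoundedDensity R M g) (hu : AEStronglyMeasurable u volume)
    (hK : ∀ z, ‖u z‖ ≤ K) (hw : NearWeight w) (ha : 0 ≤ a) (hLm : StronglyMeasurable L)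
    (hL : ∀ y, ‖L y‖ ≤ a * w (y - x)) : Integrable fun z : Phase => g z • L z.1 (u z) :=
  (integrable_pairing_bound hw a (M * K) R x).mono'
    (hg.aestronglyMeasurable.smul (aestronglyMeasurable_clm_apply
      (hLm.comp_measurable measurable_fst).aestronglyMeasurable hu))
    (hg.ae_norm_pairing_le hK hw ha hL)

theorem integrable_smul (hg : IsBoundedDensity R M g) (hu : AEStronglyMeasurable u volume)
    (hK : ∀ z, ‖u z‖ ≤ K) : Integrable fun z : Phase => g z • u z :=
  hg.integrable_pairing (x := 0) (w := fun _ => 1) (a := 1)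
    (L := fun _ => ContinuousLinearMap.id ℝ E3) hu hK
    ⟨measurable_const, fun _ => zero_le_one, integrableOn_const measure_ball_lt_top.ne,
      fun _ _ => le_rfl⟩ zero_le_one stronglyMeasurable_const
    (fun _ => by simp)

/-- Fubini turns an integral against a velocity moment into a pairing on phase space. Only there
does weak-* continuity of the density say anything, since the moments themselves are integrals over
p. -/
theorem integral_moment [CompleteSpace F] (hg : IsBoundedDensity R M g)
    (hu : AEStronglyMeasurable u volume)
    (hK : ∀ z, ‖u z‖ ≤ K) (hw : NearWeight w) (ha : 0 ≤ a) (hLm : StronglyMeasurable L)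
    (hL : ∀ y, ‖L y‖ ≤ a * w (y - x)) :
    ∫ y, L y (moment g u y) = ∫ z : Phase, g z • L z.1 (u z) := by
  have h1 := hg.integrable_pairing hu hK hw ha hLm hL
  have h2 : ∀ᵐ y : E3, Integrable fun p => g (y, p) • u (y, p) :=
    Integrable.prod_right_ae (μ := (volume : Measure E3)) (ν := (volume : Measure E3))
      (f := fun z : E3 × E3 => g z • u z) (hg.integrable_smul hu hK)
  refine Eq.trans ?_ (integral_prod (μ := (volume : Measure E3)) (ν := (volume : Measure E3)) _
    h1).symm
  refine integral_congr_ae (h2.mono fun y hy => ?_)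
  simp only [moment]
  rw [← ContinuousLinearMap.integral_comp_comm _ hy]
  simp only [map_smul]

end IsBoundedDensity

theorem norm_softKernel_zero_le {β : ℝ} (hβ : |β| ≤ 1) (x y : E3) :
    ‖softKernel β 0 (y - x)‖ ≤ 2 * ‖y - x‖⁻¹ := by
  simpa [softInv_zero] using norm_softKernel_le hβ 0 (y - x)

theorem norm_softKernelDeriv_zero_flip_le {β : ℝ} (hβ : |β| ≤ 1) (x h y : E3) :
    ‖(softKernelDeriv β 0 (y - x)).flip h‖ ≤ 6 * ‖h‖ * ‖y - x‖⁻¹ ^ 2 := by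
  refine ((softKernelDeriv β 0 (y - x)).flip.le_opNorm h).trans ?_
  rw [ContinuousLinearMap.opNorm_flip]
  have h1 := norm_softKernelDeriv_le hβ 0 (y - x)
  rw [softInv_zero] at h1
  exact (mul_le_mul_of_nonneg_right h1 (norm_nonneg h)).trans (le_of_eq (by ring))

namespace IsBoundedDensity

variable {β : ℝ}

theorem potential_moment (hg : IsBoundedDensity R M g) (hu : AEStronglyMeasurable u volume)
    (hK : ∀ z, ‖u z‖ ≤ K) (hβ : |β| ≤ 1) (x : E3) :
    potential β 0 (moment g u) x = ∫ z : Phase, g z • softKernel β 0 (z.1 - x) (u z) :=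
  hg.integral_moment (L := fun y => softKernel β 0 (y - x)) hu hK nearWeight_inv (by norm_num)
    ((stronglyMeasurable_softKernel β 0).comp_measurable (measurable_id.sub_const x))
    (norm_softKernel_zero_le hβ x)

theorem stronglyMeasurable_softKernelDeriv_flip (β : ℝ) (x h : E3) :
    StronglyMeasurable fun y => (softKernelDeriv β 0 (y - x)).flip h := by
  have h1 : Continuous fun D : E3 →L[ℝ] E3 →L[ℝ] E3 => D.flip h := by
    rw [continuous_clm_apply]
    intro c
    simp only [ContinuousLinearMap.flip_apply]
    fun_prop
  exact h1.comp_stronglyMeasurable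
    ((stronglyMeasurable_softKernelDeriv β 0).comp_measurable (measurable_id.sub_const x))

theorem potentialDeriv_moment (hg : IsBoundedDensity R M g) (hu : AEStronglyMeasurable u volume)
    (hK : ∀ z, ‖u z‖ ≤ K) (hβ : |β| ≤ 1) (x h : E3) :
    potentialDeriv β 0 (moment g u) x h =
      -∫ z : Phase, g z • (softKernelDeriv β 0 (z.1 - x)).flip h (u z) := by
  have h1 := hg.integral_moment (L := fun y => (softKernelDeriv β 0 (y - x)).flip h) hu hK
    nearWeight_inv_sq (by positivity) (stronglyMeasurable_softKernelDeriv_flip β x h)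
    (norm_softKernelDeriv_zero_flip_le hβ x h)
  rw [← h1, potentialDeriv, neg_apply,
    ContinuousLinearMap.integral_apply ((hg.isSource_moment hu hK).integrable_kernelDeriv hβ 0 x)]
  rfl

end IsBoundedDensity

theorem continuousOn_of_inner {X : Type*} [TopologicalSpace X] {S : Set X} {F : X → E3}
    (h : ∀ v : E3, ContinuousOn (fun t => inner ℝ v (F t)) S) : ContinuousOn F S := by
  have h1 : ∀ t, F t = ∑ i, inner ℝ (EuclideanSpace.basisFun (Fin 3) ℝ i) (F t) •
      EuclideanSpace.basisFun (Fin 3) ℝ i := fun t =>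
    ((EuclideanSpace.basisFun (Fin 3) ℝ).sum_repr' (F t)).symm
  rw [funext h1]
  exact continuousOn_finsetSum _ fun i _ => (h _).smul continuousOn_const

/-- Pairings of a weak-* continuous density with a singular kernel are continuous in time. -/
theorem WeakStarContinuous.continuousOn_integral_pairing {T t₁ : ℝ} {f : ℝ → Phase → ℝ}
    (hf : WeakStarContinuous T f) (ht₁ : t₁ ∈ Ico 0 T)
    (hfb : ∀ t ∈ Icc 0 t₁, IsBoundedDensity R M (f t)) {L : E3 → E3 →L[ℝ] E3} {w : E3 → ℝ}
    {a : ℝ} {x : E3} {v : ℝ → Phase → E3} (hv : ∀ t ∈ Icc 0 t₁, AEStronglyMeasurable (v t) volume)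
    (hK : ∀ t ∈ Icc 0 t₁, ∀ z, ‖v t z‖ ≤ K) (hvc : ∀ z, ContinuousOn (fun t => v t z) (Icc 0 t₁))
    (hw : NearWeight w) (ha : 0 ≤ a) (hLm : StronglyMeasurable L)
    (hL : ∀ y, ‖L y‖ ≤ a * w (y - x)) :
    ContinuousOn (fun t => ∫ z, f t z • L z.1 (v t z)) (Icc 0 t₁) := by
  have h0 : (0 : ℝ) ∈ Icc 0 t₁ := ⟨le_rfl, ht₁.1⟩
  have hK0 : 0 ≤ K := (norm_nonneg _).trans (hK 0 h0 0)
  have hw0 : ∀ y, 0 ≤ a * w (y - x) := fun y => mul_nonneg ha (hw.nonneg _)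
  refine continuousOn_of_inner fun e => ?_
  let B := Metric.closedBall (0 : E3) R
  -- The density vanishes outside the ball, so the indicators leave the pairing unchanged; they give
  -- the test functions an integrable majorant on all of phase space.
  let Ξ : ℝ → Phase → ℝ := fun t z =>
    B.indicator (fun _ => (1 : ℝ)) z.1 * B.indicator (fun _ => (1 : ℝ)) z.2 *
      inner ℝ e (L z.1 (v t z))
  have heq : ∀ t ∈ Icc 0 t₁, inner ℝ e (∫ z, f t z • L z.1 (v t z)) = ∫ z, f t z * Ξ t z := by
    intro t ht
    rw [← integral_inner ((hfb t ht).integrable_pairing (hv t ht) (hK t ht) hw ha hLm hL)]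
    refine integral_congr_ae ((hfb t ht).support.mono fun z hz => ?_)
    simp only [inner_smul_right]
    by_cases hR : R < ‖z‖
    · rw [hz hR, zero_mul, zero_mul]
    · rw [not_lt] at hR
      simp only [Ξ]
      rw [indicator_of_mem (by simpa [B] using (norm_fst_le z).trans hR),
        indicator_of_mem (by simpa [B] using (norm_snd_le z).trans hR), one_mul, one_mul]
  refine ContinuousOn.congr ?_ heq
  have hBm : Measurable (B.indicator fun _ => (1 : ℝ)) :=
    measurable_const.indicator measurableSet_closedBall
  refine hf.continuousOn_pairing (σ := fun t => t) ht₁ continuousOn_id (fun t ht => ht)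
    (IsBoundedDensity.integrable_pairing_bound hw a (‖e‖ * K) R x) (fun t ht => ?_)
    (fun t ht z => ?_) (fun z => ?_)
  · exact ((hBm.comp measurable_fst).mul (hBm.comp measurable_snd)).aestronglyMeasurable.mul
      (aestronglyMeasurable_const.inner (aestronglyMeasurable_clm_apply
        (hLm.comp_measurable measurable_fst).aestronglyMeasurable (hv t ht)))
  · by_cases h1 : z.1 ∈ B
    · by_cases h2 : z.2 ∈ B
      · simp only [Ξ]
        rw [indicator_of_mem h1, indicator_of_mem h2, indicator_of_mem h1, indicator_of_mem h2,
          one_mul, one_mul]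
        calc ‖inner ℝ e (L z.1 (v t z))‖ ≤ ‖e‖ * ‖L z.1 (v t z)‖ := abs_real_inner_le_norm _ _
          _ ≤ ‖e‖ * (a * w (z.1 - x) * K) := by
            refine mul_le_mul_of_nonneg_left (((L z.1).le_opNorm _).trans ?_) (norm_nonneg _)
            exact mul_le_mul (hL _) (hK t ht z) (norm_nonneg _) (hw0 _)
          _ = _ := by ring
      · simp only [Ξ]
        rw [indicator_of_notMem h2, indicator_of_notMem h2]
        simp
    · simp only [Ξ]
      rw [indicator_of_notMem h1, indicator_of_notMem h1]
      simp
  · exact continuousOn_const.mul (continuousOn_const.inner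
      ((L z.1).continuous.comp_continuousOn (hvc z)))

end VlasovDarwin

namespace VlasovDarwin

open Filter Topology Function

/-! ### The relativistic velocity -/

theorem relVel_eq_softDir : relVel = softDir 1 := by
  funext a
  simp [relVel, softDir, softInv]

theorem norm_relVel_le (a : E3) : ‖relVel a‖ ≤ 1 := by
  rw [relVel_eq_softDir]
  exact norm_softDir_le 1 a

theorem norm_relVel_sub_le (a b : E3) : ‖relVel a - relVel b‖ ≤ 2 * ‖a - b‖ := by
  rw [relVel_eq_softDir]
  refine (norm_softDir_sub_le one_pos a b).trans ?_
  have h := softInv_le_inv one_pos a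
  rw [inv_one] at h
  exact mul_le_mul_of_nonneg_right (by linarith) (norm_nonneg _)

/-- The derivative of the relativistic velocity. -/
noncomputable def relVelDeriv (a : E3) : E3 →L[ℝ] E3 :=
  softInv 1 a • ContinuousLinearMap.id ℝ E3 + ((-softInv 1 a ^ 3) • innerSL ℝ a).smulRight a

theorem relVelDeriv_apply (a h : E3) :
    relVelDeriv a h = softInv 1 a • h - (softInv 1 a ^ 3 * inner ℝ a h) • a := by
  simp [relVelDeriv, sub_eq_add_neg]

theorem hasFDerivAt_relVel (a : E3) : HasFDerivAt relVel (relVelDeriv a) a := by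
  rw [relVel_eq_softDir]
  exact hasFDerivAt_softDir one_pos a

theorem norm_relVelDeriv_le (a : E3) : ‖relVelDeriv a‖ ≤ 2 :=
  (hasFDerivAt_relVel a).le_of_lip' (by norm_num)
    (Eventually.of_forall fun b => norm_relVel_sub_le b a)

/-- The velocity is the gradient of √(1 + |a|²), so its derivative is a Hessian. This symmetry is
what makes the characteristic field skew in `RegularPotentials.skewField`. -/
theorem adjoint_relVelDeriv (a : E3) :
    ContinuousLinearMap.adjoint (relVelDeriv a) = relVelDeriv a := by
  refine ((ContinuousLinearMap.eq_adjoint_iff _ _).2 fun x y => ?_).symm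
  rw [relVelDeriv_apply, relVelDeriv_apply]
  simp only [inner_sub_left, inner_sub_right, inner_smul_left, inner_smul_right, conj_trivial,
    real_inner_comm a x]
  ring

theorem continuous_softInv {δ : ℝ} (hδ : 0 < δ) : Continuous (softInv δ) :=
  continuous_iff_continuousAt.2 fun z => (hasFDerivAt_softInv hδ z).continuousAt

theorem continuous_relVelDeriv : Continuous relVelDeriv := by
  have h := continuous_softInv one_pos
  rw [continuous_clm_apply]
  intro c
  simp only [relVelDeriv_apply]
  fun_prop

theorem continuous_relVel : Continuous relVel :=
  continuous_iff_continuousAt.2 fun z => (hasFDerivAt_relVel z).continuousAt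

/-- The relativistic velocity is firmly monotone. -/
theorem norm_relVel_sub_sq_le (a b : E3) :
    ‖relVel a - relVel b‖ ^ 2 ≤ inner ℝ (relVel a - relVel b) (a - b) := by
  -- γ is the Lorentz factor √(1 + |a|²).
  have key : ∀ a : E3, ∃ γ, 1 ≤ γ ∧ a = γ • relVel a ∧ γ ^ 2 * (1 - ‖relVel a‖ ^ 2) = 1 := by
    intro a
    have hp : 0 < 1 + ‖a‖ ^ 2 := by positivity
    have hs := Real.sqrt_pos.2 hp
    have hq := Real.sq_sqrt hp.le
    refine ⟨√(1 + ‖a‖ ^ 2), Real.one_le_sqrt.2 (by nlinarith [sq_nonneg ‖a‖]), ?_, ?_⟩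
    · rw [relVel, smul_smul, mul_inv_cancel₀ hs.ne', one_smul]
    · rw [relVel, norm_smul, norm_inv, Real.norm_of_nonneg hs.le, mul_pow, inv_pow, hq]
      field_simp
      ring
  obtain ⟨γ, hγ, ha, hX⟩ := key a
  obtain ⟨γ', hγ', hb, hY⟩ := key b
  have hab : a - b = γ • relVel a - γ' • relVel b := by rw [← ha, ← hb]
  rw [hab]
  set v := relVel a
  set w := relVel b
  rw [← real_inner_self_eq_norm_sq]
  simp only [inner_sub_left, inner_sub_right, inner_smul_right, real_inner_self_eq_norm_sq,
    real_inner_comm v w]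
  have h0 : 0 ≤ ‖v - w‖ ^ 2 := sq_nonneg _
  rw [norm_sub_sq_real] at h0
  -- The inner product ⟨v - w, γ v - γ' w⟩ is half of (γ + γ') ‖v - w‖² + (γ - γ')(‖v‖² - ‖w‖²). The
  -- second term is nonnegative because γ increases with the speed, and in the first γ, γ' ≥ 1.
  have hXY : 0 ≤ (γ - γ') * (‖v‖ ^ 2 - ‖w‖ ^ 2) := by
    have h1 : (γ * γ') ^ 2 * (‖v‖ ^ 2 - ‖w‖ ^ 2) = (γ - γ') * (γ + γ') := by
      linear_combination γ' ^ 2 * (-hX) + γ ^ 2 * hY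
    have h2 : 0 < (γ * γ') ^ 2 := by positivity
    have h3 : (γ * γ') ^ 2 * ((γ - γ') * (‖v‖ ^ 2 - ‖w‖ ^ 2)) = (γ - γ') ^ 2 * (γ + γ') := by
      linear_combination (γ - γ') * h1
    have h4 : 0 ≤ (γ - γ') ^ 2 * (γ + γ') := by positivity
    rw [← h3] at h4
    exact nonneg_of_mul_nonneg_right h4 h2
  have h1 : 0 ≤ (γ - 1) * (‖v‖ ^ 2 - 2 * inner ℝ v w + ‖w‖ ^ 2) := mul_nonneg (by linarith) h0
  have h2 : 0 ≤ (γ' - 1) * (‖v‖ ^ 2 - 2 * inner ℝ v w + ‖w‖ ^ 2) := mul_nonneg (by linarith) h0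
  nlinarith

/-! ### Potentials induced by a compactly supported density -/

theorem IsCompactDensity.exists_isBoundedDensity {T t₁ : ℝ} {g : ℝ → Phase → ℝ}
    (hg : IsCompactDensity T g) (ht₁ : t₁ ∈ Ico 0 T) :
    ∃ R M : ℝ, ∀ t ∈ Icc 0 t₁, IsBoundedDensity R M (g t) := by
  obtain ⟨R, hR⟩ := hg.support t₁ ht₁
  obtain ⟨M, hM, hb⟩ := hg.weakStar.exists_bound ht₁
  exact ⟨R, M, fun t ht => ⟨(hg.weakStar.memLp t ⟨ht.1, ht.2.trans_lt ht₁.2⟩).1, hM, hb t ht,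
    hR t ht⟩⟩

theorem darwinKernel_eq (x y j : E3) : darwinKernel x y j = softKernel 1 0 (y - x) j := by
  rw [darwinKernel, softKernel, smul_apply, dirTensor_apply, softDir, softInv_zero, one_mul]
  rfl

theorem norm_velocity_le (A : ℝ → E3 → E3) (t : ℝ) (z : Phase) : ‖velocity A t z‖ ≤ 1 :=
  norm_relVel_le _

theorem measurable_velocity {A : ℝ → E3 → E3} {t : ℝ} (h : Measurable (A t)) :
    Measurable (velocity A t) :=
  continuous_relVel.measurable.comp (measurable_snd.sub (h.comp measurable_fst))

variable {T : ℝ} {g : ℝ → Phase → ℝ} {Φ : ℝ → E3 → ℝ} {A : ℝ → E3 → E3}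

theorem IsInducedPotentials.vector_eq_potential (h : IsInducedPotentials T g Φ A) {t : ℝ}
    (ht : t ∈ Ico 0 T) (x : E3) :
    A t x = (1 / 2 : ℝ) • potential 1 0 (moment (g t) (velocity A t)) x := by
  rw [h.vector_eq t ht x]
  simp only [darwinKernel_eq, currentDensity_eq]
  rfl

/-- A unit vector. -/
noncomputable def unitVec : E3 := EuclideanSpace.single 0 1

theorem norm_unitVec : ‖unitVec‖ = 1 := by simp [unitVec]

theorem moment_const_eq (g : Phase → ℝ) (y e : E3) :
    moment g (fun _ => e) y = (∫ p : E3, g (y, p)) • e := integral_smul_const _ _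

/-- With β = 0 the kernel is a multiple of the identity, so the potential of the vector density ρ e,
with e a unit vector, is Φ e. In this way one theory of vector potentials serves both Φ and A. -/
theorem IsInducedPotentials.scalar_eq_potential (h : IsInducedPotentials T g Φ A) {t : ℝ}
    (ht : t ∈ Ico 0 T) {R M : ℝ} (hg : IsBoundedDensity R M (g t)) (x : E3) :
    Φ t x = inner ℝ unitVec (potential 0 0 (moment (g t) fun _ => unitVec) x) := by
  have hs := hg.isSource_moment (u := fun _ => unitVec) aestronglyMeasurable_const
    (fun _ => norm_unitVec.le)
  rw [h.scalar_eq t ht x, potential, ← integral_inner (hs.integrable_kernel (by simp) 0 x)]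
  congr 1 with y
  simp only [softKernel, smul_apply, dirTensor_apply, moment_const_eq, softInv_zero, zero_mul,
    zero_smul, add_zero, inner_smul_right, real_inner_self_eq_norm_sq, norm_unitVec,
    chargeDensity]
  ring

end VlasovDarwin

namespace VlasovDarwin

open Filter Topology Function

/-! ### Continuity in time of the induced potentials -/

namespace IsBoundedDensity

variable {R M K : ℝ} {g : Phase → ℝ} {u u' : Phase → E3}

theorem integrable (hg : IsBoundedDensity R M g) : Integrable g := by
  have h := (hg.integrable_smul (u := fun _ => unitVec) aestronglyMeasurable_const
    (fun _ => norm_unitVec.le)).norm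
  simp only [norm_smul, norm_unitVec, mul_one] at h
  exact (integrable_norm_iff hg.aestronglyMeasurable).1 h

theorem potential_sub {β : ℝ} (hg : IsBoundedDensity R M g) (hu : AEStronglyMeasurable u volume)
    (hu' : AEStronglyMeasurable u' volume) (hK : ∀ z, ‖u z‖ ≤ 1) (hK' : ∀ z, ‖u' z‖ ≤ 1)
    (hβ : |β| ≤ 1) (x : E3) :
    potential β 0 (moment g fun z => u z - u' z) x =
      potential β 0 (moment g u) x - potential β 0 (moment g u') x := by
  have hm : StronglyMeasurable fun y => softKernel β 0 (y - x) :=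
    (stronglyMeasurable_softKernel β 0).comp_measurable (measurable_id.sub_const x)
  have h1 := hg.integrable_pairing (L := fun y => softKernel β 0 (y - x)) hu hK nearWeight_inv
    (by norm_num) hm (norm_softKernel_zero_le hβ x)
  have h2 := hg.integrable_pairing (L := fun y => softKernel β 0 (y - x)) hu' hK' nearWeight_inv
    (by norm_num) hm (norm_softKernel_zero_le hβ x)
  rw [hg.potential_moment (u := fun z => u z - u' z) (K := 1 + 1) (hu.sub hu') (fun z => norm_sub_le_of_le (hK z) (hK' z)) hβ,
    hg.potential_moment hu hK hβ, hg.potential_moment hu' hK' hβ]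
  refine Eq.trans ?_ (integral_sub h1 h2)
  congr 1 with z : 1
  rw [map_sub, smul_sub]

/-- A potential is small where the quadratic mean of the velocities is. -/
theorem norm_potential_le_quadratic (hg : IsBoundedDensity R M g) (hg0 : 0 ≤ᵐ[volume] g)
    (hu : AEStronglyMeasurable u volume) (hK : ∀ z, ‖u z‖ ≤ K) (x : E3) {ε : ℝ} (hε : 0 < ε) :
    ‖potential 1 0 (moment g u) x‖ ≤ ε * (∫ z : Phase, (Metric.closedBall (0 : E3) R).indicator
      (fun y => 1 * ‖y - x‖⁻¹ ^ 2) z.1 *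
        (Metric.closedBall (0 : E3) R).indicator (fun _ => M * 1) z.2) +
      ε⁻¹ * ∫ z, g z * ‖u z‖ ^ 2 := by
  have hi1 := integrable_pairing_bound nearWeight_inv_sq 1 (M * 1) R x
  have hi2 : Integrable fun z => g z * ‖u z‖ ^ 2 :=
    hg.integrable.mul_bdd (c := K ^ 2) (hu.norm.pow 2) (ae_of_all _ fun z => by
      rw [norm_pow, norm_norm]
      exact pow_le_pow_left₀ (norm_nonneg _) (hK z) 2)
  rw [hg.potential_moment hu hK (by simp), ← integral_const_mul, ← integral_const_mul,
    ← integral_add (hi1.const_mul ε) (hi2.const_mul ε⁻¹)]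
  refine norm_integral_le_of_norm_le ((hi1.const_mul ε).add (hi2.const_mul ε⁻¹)) ?_
  have hb := hg.ae_norm_pairing_le (u := fun _ => unitVec) (K := 1) (x := x) (a := 1)
    (L := fun y => (‖y - x‖⁻¹ ^ 2) • ContinuousLinearMap.id ℝ E3) (fun _ => norm_unitVec.le)
    nearWeight_inv_sq zero_le_one (fun y => by
      rw [norm_smul, norm_pow, norm_inv, norm_norm, one_mul]
      exact mul_le_of_le_one_right (by positivity) ContinuousLinearMap.norm_id_le)
  filter_upwards [hb, hg0] with z hz h0
  simp only [Pi.zero_apply] at h0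
  rw [smul_apply, ContinuousLinearMap.id_apply, norm_smul, norm_smul, norm_unitVec, mul_one,
    norm_pow, norm_inv, norm_norm, Real.norm_of_nonneg h0] at hz
  have h1 := ((softKernel 1 0 (z.1 - x)).le_opNorm (u z)).trans
    (mul_le_mul_of_nonneg_right (norm_softKernel_zero_le (β := 1) (by simp) x z.1) (norm_nonneg _))
  rw [norm_smul, Real.norm_of_nonneg h0]
  set a := ‖z.1 - x‖⁻¹
  set c := ‖u z‖
  -- Young's inequality separates the kernel from the velocity. The squared kernel |y - x|⁻² is
  -- still locally integrable in dimension three.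
  have h2 : 2 * a * c ≤ ε * a ^ 2 + ε⁻¹ * c ^ 2 := by
    have h3 : ε * a ^ 2 + ε⁻¹ * c ^ 2 - 2 * a * c = ε⁻¹ * (ε * a - c) ^ 2 := by
      field_simp
      ring
    have : 0 ≤ ε⁻¹ * (ε * a - c) ^ 2 := by positivity
    linarith
  calc _ ≤ g z * (ε * a ^ 2 + ε⁻¹ * c ^ 2) := mul_le_mul_of_nonneg_left (h1.trans h2) h0
    _ = ε * (g z * a ^ 2) + ε⁻¹ * (g z * c ^ 2) := by ring
    _ ≤ _ := add_le_add (mul_le_mul_of_nonneg_left hz hε.le) le_rfl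

/-- The energy estimate behind the continuity of the vector potential. -/
theorem integral_quadratic_le {R' M' : ℝ} (hg : IsBoundedDensity R M g) (hg0 : 0 ≤ᵐ[volume] g)
    (hu : AEStronglyMeasurable u volume) (hK : ∀ z, ‖u z‖ ≤ K)
    (hm : IsSource R' M' (moment g u)) {D H : E3 → E3} (hH : Continuous H) {C : ℝ}
    (hHC : ∀ y, ‖H y‖ ≤ C) (hD : ∀ y, D y = (1 / 2 : ℝ) • (potential 1 0 (moment g u) y + H y))
    (hpc : Continuous (potential 1 0 (moment g u)))
    (hmono : ∀ z, ‖u z‖ ^ 2 ≤ -inner ℝ (u z) (D z.1)) :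
    ∫ z, g z * ‖u z‖ ^ 2 ≤ M' * ∫ y in Metric.closedBall (0 : E3) R', ‖H y‖ := by
  obtain ⟨P, hP⟩ : ∃ P, ∀ y, ‖potential 1 0 (moment g u) y‖ ≤ P :=
    ⟨_, fun y => hm.norm_potential_le (by simp) 0 y⟩
  have hDc : Continuous D := by
    rw [funext hD]
    fun_prop
  have hDb : ∀ y, ‖D y‖ ≤ P + C := fun y => by
    rw [hD y, norm_smul]
    have := norm_add_le_of_le (hP y) (hHC y)
    norm_num
    linarith [norm_nonneg (potential 1 0 (moment g u) y + H y)]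
  have hPC : 0 ≤ P + C := (norm_nonneg _).trans (hDb 0)
  have hone : NearWeight fun _ => 1 := ⟨measurable_const, fun _ => zero_le_one,
    integrableOn_const measure_ball_lt_top.ne, fun _ _ => le_rfl⟩
  have hLm : StronglyMeasurable fun y => innerSL ℝ (D y) :=
    ((innerSL ℝ).continuous.comp hDc).stronglyMeasurable
  have hL : ∀ y : E3, ‖innerSL ℝ (D y)‖ ≤ (P + C) * 1 := fun y => by
    rw [innerSL_apply_norm, mul_one]
    exact hDb y
  have hpair := hg.integral_moment (x := 0) hu hK hone hPC hLm hL
  have hint := hg.integrable_pairing (x := 0) hu hK hone hPC hLm hL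
  have hi2 : Integrable fun z => g z * ‖u z‖ ^ 2 :=
    hg.integrable.mul_bdd (c := K ^ 2) (hu.norm.pow 2) (ae_of_all _ fun z => by
      rw [norm_pow, norm_norm]
      exact pow_le_pow_left₀ (norm_nonneg _) (hK z) 2)
  -- Monotonicity pairs u with -D. As D depends on position only, integrating over p replaces u by
  -- its moment.
  have h1 : ∫ z, g z * ‖u z‖ ^ 2 ≤ -∫ z, g z • innerSL ℝ (D z.1) (u z) := by
    rw [← integral_neg]
    refine integral_mono_ae hi2 hint.neg (hg0.mono fun z hz => ?_)
    simp only [Pi.zero_apply] at hz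
    have := mul_le_mul_of_nonneg_left (hmono z) hz
    simp only [innerSL_apply_apply, smul_eq_mul]
    rw [real_inner_comm]
    linarith
  rw [← hpair] at h1
  have hmi : Integrable (moment g u) := (integrable_norm_iff hm.aestronglyMeasurable).1
    hm.integrable_norm
  have hi3 : Integrable fun y => inner ℝ (moment g u y) (potential 1 0 (moment g u) y) :=
    (hm.integrable_norm.mul_const P).mono' (hm.aestronglyMeasurable.inner
      hpc.aestronglyMeasurable) (ae_of_all _ fun y => (abs_real_inner_le_norm _ _).trans
        (mul_le_mul_of_nonneg_left (hP y) (norm_nonneg _)))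
  have hi4 : Integrable fun y => inner ℝ (moment g u y) (H y) :=
    (hm.integrable_norm.mul_const C).mono' (hm.aestronglyMeasurable.inner
      hH.aestronglyMeasurable) (ae_of_all _ fun y => (abs_real_inner_le_norm _ _).trans
        (mul_le_mul_of_nonneg_left (hHC y) (norm_nonneg _)))
  have h2 : ∫ y, innerSL ℝ (D y) (moment g u y) =
      (1 / 2) * ((∫ y, inner ℝ (moment g u y) (potential 1 0 (moment g u) y)) +
        ∫ y, inner ℝ (moment g u y) (H y)) := by
    rw [← integral_add hi3 hi4, ← integral_const_mul]
    congr 1 with y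
    rw [innerSL_apply_apply, hD, real_inner_comm, inner_smul_right, inner_add_right]
  have hHi : IntegrableOn (fun y => ‖H y‖) (Metric.closedBall (0 : E3) R') :=
    hH.norm.continuousOn.integrableOn_compact (isCompact_closedBall _ _)
  have h3 : -∫ y, inner ℝ (moment g u y) (H y) ≤
      M' * ∫ y in Metric.closedBall (0 : E3) R', ‖H y‖ := by
    rw [← integral_neg, ← integral_indicator measurableSet_closedBall, ← integral_const_mul]
    refine integral_mono_ae hi4.neg
      (((integrable_indicator_iff measurableSet_closedBall).2 hHi).const_mul M') ?_
    filter_upwards [hm.bound, hm.support] with y hy hys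
    by_cases hR : y ∈ Metric.closedBall (0 : E3) R'
    · rw [indicator_of_mem hR]
      exact (neg_le_abs _).trans ((abs_real_inner_le_norm _ _).trans
        (mul_le_mul_of_nonneg_right hy (norm_nonneg _)))
    · rw [indicator_of_notMem hR, hys (by simpa using hR)]
      simp
  -- The interaction of the moment with its own potential enters with a negative sign; being
  -- nonnegative it can be dropped, which leaves the pairing with H alone.
  have h4 := integral_inner_potential_nonneg hm
  have h5 : 0 ≤ M' * ∫ y in Metric.closedBall (0 : E3) R', ‖H y‖ :=
    mul_nonneg hm.nonneg (integral_nonneg fun _ => norm_nonneg _)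
  rw [h2] at h1
  linarith

end IsBoundedDensity

variable {T t₁ : ℝ} {g : ℝ → Phase → ℝ} {Φ : ℝ → E3 → ℝ} {A : ℝ → E3 → E3} {R M : ℝ}

theorem IsSource.continuous_potential {R M β : ℝ} {j : E3 → E3} (hj : IsSource R M j)
    (hβ : |β| ≤ 1) : Continuous (potential β 0 j) := by
  obtain ⟨C, -, hC⟩ := exists_potential_bounds R
  exact continuous_iff_continuousAt.2 fun x => ((hC β hβ M j hj).1 x).continuousAt

namespace IsInducedPotentials

/-- A(t) - A(s) is half the potential of the moment of u = v_A(t) - v_A(s) plus half of H, the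
change of the potential when the velocity is frozen at time s. By weak-* continuity H tends to zero.
The other part depends on the unknown difference and is controlled through its sign: increasing A
decreases v, so the energy estimate bounds ∫ g |u|² by ∫ |H| over a ball, and a small quadratic mean
of u makes its potential small. No smallness or contraction is required. -/
theorem continuousOn_vector (h : IsInducedPotentials T g Φ A) (hg : IsCompactDensity T g)
    (ht₁ : t₁ ∈ Ico 0 T) (hb : ∀ t ∈ Icc 0 t₁, IsBoundedDensity R M (g t)) (x : E3) :
    ContinuousOn (fun t => A t x) (Icc 0 t₁) := by
  intro s hs
  have hIco : ∀ t ∈ Icc 0 t₁, t ∈ Ico 0 T := fun t ht => ⟨ht.1, ht.2.trans_lt ht₁.2⟩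
  have hvm : ∀ t ∈ Icc 0 t₁, AEStronglyMeasurable (velocity A t) volume := fun t ht =>
    (measurable_velocity (h.measurable_vector t (hIco t ht))).aestronglyMeasurable
  set V := volume.real (Metric.closedBall (0 : E3) R)
  let u : ℝ → Phase → E3 := fun t z => velocity A t z - velocity A s z
  have hum : ∀ t ∈ Icc 0 t₁, AEStronglyMeasurable (u t) volume := fun t ht =>
    (hvm t ht).sub (hvm s hs)
  have hu2 : ∀ t z, ‖u t z‖ ≤ 1 + 1 := fun t z =>
    norm_sub_le_of_le (norm_velocity_le A t z) (norm_velocity_le A s z)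
  let H : ℝ → E3 → E3 := fun t y => potential 1 0 (moment (g t) (velocity A s)) y -
    potential 1 0 (moment (g s) (velocity A s)) y
  have hm : ∀ t ∈ Icc 0 t₁, IsSource R (M * (1 + 1) * V) (moment (g t) (u t)) := fun t ht =>
    (hb t ht).isSource_moment (hum t ht) (hu2 t)
  have hms : ∀ t ∈ Icc 0 t₁, IsSource R (M * 1 * V) (moment (g t) (velocity A s)) := fun t ht =>
    (hb t ht).isSource_moment (hvm s hs) (norm_velocity_le A s)
  have hHc : ∀ t ∈ Icc 0 t₁, Continuous (H t) := fun t ht =>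
    ((hms t ht).continuous_potential (by simp)).sub ((hms s hs).continuous_potential (by simp))
  obtain ⟨C, hC⟩ : ∃ C, ∀ t ∈ Icc 0 t₁, ∀ y, ‖H t y‖ ≤ C :=
    ⟨_, fun t ht y => norm_sub_le_of_le ((hms t ht).norm_potential_le (by simp) 0 y)
      ((hms s hs).norm_potential_le (by simp) 0 y)⟩
  have hD : ∀ t ∈ Icc 0 t₁, ∀ y, A t y - A s y =
      (1 / 2 : ℝ) • (potential 1 0 (moment (g t) (u t)) y + H t y) := fun t ht y => by
    rw [h.vector_eq_potential (hIco t ht), h.vector_eq_potential (hIco s hs),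
      (hb t ht).potential_sub (hvm t ht) (hvm s hs) (norm_velocity_le A t) (norm_velocity_le A s)
        (by simp)]
    simp only [H]
    module
  have hH0 : ∀ y, Tendsto (fun t => H t y) (𝓝[Icc 0 t₁] s) (𝓝 0) := fun y => by
    have h1 := hg.weakStar.continuousOn_integral_pairing (x := y) ht₁ hb
      (v := fun _ => velocity A s) (L := fun x' => softKernel 1 0 (x' - y))
      (fun _ _ => hvm s hs) (fun _ _ => norm_velocity_le A s) (fun _ => continuousOn_const)
      nearWeight_inv (by norm_num : (0 : ℝ) ≤ 2)
      ((stronglyMeasurable_softKernel 1 0).comp_measurable (measurable_id.sub_const y))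
      (norm_softKernel_zero_le (by simp) y)
    have h2 : ContinuousOn (fun t => H t y) (Icc 0 t₁) := by
      refine ContinuousOn.congr (h1.sub (continuousOn_const
        (c := potential 1 0 (moment (g s) (velocity A s)) y))) fun t ht => ?_
      simp only [H]
      rw [(hb t ht).potential_moment (hvm s hs) (norm_velocity_le A s) (by simp)]
      rfl
    have h3 := (h2 s hs).tendsto
    simpa only [H, sub_self] using h3
  have hE : ∀ t ∈ Icc 0 t₁, ∫ z, g t z * ‖u t z‖ ^ 2 ≤
      M * (1 + 1) * V * ∫ y in Metric.closedBall (0 : E3) R, ‖H t y‖ := fun t ht =>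
    (hb t ht).integral_quadratic_le (hg.nonneg t (hIco t ht)) (hum t ht) (hu2 t) (hm t ht)
      (hHc t ht) (hC t ht) (hD t ht) ((hm t ht).continuous_potential (by simp)) fun z => by
        have h1 := norm_relVel_sub_sq_le (z.2 - A t z.1) (z.2 - A s z.1)
        have h2 : z.2 - A t z.1 - (z.2 - A s z.1) = -(A t z.1 - A s z.1) := by abel
        rw [h2, inner_neg_right] at h1
        exact h1
  have hHi : Tendsto (fun t => ∫ y in Metric.closedBall (0 : E3) R, ‖H t y‖) (𝓝[Icc 0 t₁] s)
      (𝓝 0) := by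
    have h1 := tendsto_integral_filter_of_dominated_convergence
      (μ := volume.restrict (Metric.closedBall (0 : E3) R)) (l := 𝓝[Icc 0 t₁] s)
      (F := fun t y => ‖H t y‖) (f := fun _ => 0) (fun _ => C)
      (eventually_mem_nhdsWithin.mono fun t ht => (hHc t ht).norm.aestronglyMeasurable)
      (eventually_mem_nhdsWithin.mono fun t ht => ae_of_all _ fun y => by
        rw [norm_norm]
        exact hC t ht y)
      (integrableOn_const measure_closedBall_lt_top.ne)
      (ae_of_all _ fun y => by simpa using (hH0 y).norm)
    simpa using h1
  have hEt : Tendsto (fun t => ∫ z, g t z * ‖u t z‖ ^ 2) (𝓝[Icc 0 t₁] s) (𝓝 0) := by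
    refine tendsto_of_tendsto_of_tendsto_of_le_of_le' tendsto_const_nhds
      (by simpa using hHi.const_mul (M * (1 + 1) * V)) ?_ (eventually_mem_nhdsWithin.mono hE)
    refine eventually_mem_nhdsWithin.mono fun t ht =>
      integral_nonneg_of_ae ((hg.nonneg t (hIco t ht)).mono fun z hz => ?_)
    exact mul_nonneg hz (sq_nonneg _)
  have hpot : Tendsto (fun t => potential 1 0 (moment (g t) (u t)) x) (𝓝[Icc 0 t₁] s) (𝓝 0) := by
    obtain ⟨Q, hQ⟩ : ∃ Q : ℝ, Q = ∫ z : Phase, (Metric.closedBall (0 : E3) R).indicator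
      (fun y => 1 * ‖y - x‖⁻¹ ^ 2) z.1 *
        (Metric.closedBall (0 : E3) R).indicator (fun _ => M * 1) z.2 := ⟨_, rfl⟩
    rw [NormedAddGroup.tendsto_nhds_zero]
    intro ε hε
    -- This weight in Young's inequality makes the kernel term at most ε/2; with the weight fixed, t
    -- is taken close to s for the quadratic term.
    have hδ : 0 < ε / (2 * (|Q| + 1)) := by positivity
    have h1 := (hEt.const_mul (ε / (2 * (|Q| + 1)))⁻¹).eventually_lt_const
      (u := ε / 2) (by rw [mul_zero]; positivity)
    filter_upwards [h1, eventually_mem_nhdsWithin] with t h2 ht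
    have h3 := (hb t ht).norm_potential_le_quadratic (hg.nonneg t (hIco t ht)) (hum t ht) (hu2 t)
      x hδ
    rw [← hQ] at h3
    have h4 : ε / (2 * (|Q| + 1)) * Q ≤ ε / 2 := by
      rw [div_mul_eq_mul_div, div_le_div_iff₀ (by positivity) (by norm_num)]
      nlinarith [le_abs_self Q]
    linarith
  have hlim : Tendsto (fun t => A t x - A s x) (𝓝[Icc 0 t₁] s) (𝓝 0) := by
    have h1 := (hpot.add (hH0 x)).const_smul (1 / 2 : ℝ)
    rw [add_zero, smul_zero] at h1
    exact h1.congr' (eventually_mem_nhdsWithin.mono fun t ht => (hD t ht x).symm)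
  exact tendsto_sub_nhds_zero_iff.1 hlim

theorem continuousOn_velocity (h : IsInducedPotentials T g Φ A) (hg : IsCompactDensity T g)
    (ht₁ : t₁ ∈ Ico 0 T) (hb : ∀ t ∈ Icc 0 t₁, IsBoundedDensity R M (g t)) (z : Phase) :
    ContinuousOn (fun t => velocity A t z) (Icc 0 t₁) :=
  continuous_relVel.comp_continuousOn
    (continuousOn_const.sub (h.continuousOn_vector hg ht₁ hb z.1))

end IsInducedPotentials

theorem IsCompactDensity.continuousOn_potentialDeriv (hg : IsCompactDensity T g)
    (ht₁ : t₁ ∈ Ico 0 T) (hb : ∀ t ∈ Icc 0 t₁, IsBoundedDensity R M (g t)) {β : ℝ}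
    (hβ : |β| ≤ 1) {v : ℝ → Phase → E3}
    (hv : ∀ t ∈ Icc 0 t₁, AEStronglyMeasurable (v t) volume)
    (hK : ∀ t ∈ Icc 0 t₁, ∀ z, ‖v t z‖ ≤ 1) (hvc : ∀ z, ContinuousOn (fun t => v t z) (Icc 0 t₁))
    (x : E3) : ContinuousOn (fun t => potentialDeriv β 0 (moment (g t) (v t)) x) (Icc 0 t₁) := by
  rw [continuousOn_clm_apply]
  intro e
  refine ContinuousOn.congr (hg.weakStar.continuousOn_integral_pairing (x := x) ht₁ hb
    (L := fun y => (softKernelDeriv β 0 (y - x)).flip e) hv hK hvc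
    nearWeight_inv_sq (by positivity) (IsBoundedDensity.stronglyMeasurable_softKernelDeriv_flip β
      x e) (norm_softKernelDeriv_zero_flip_le hβ x e)).neg fun t ht => ?_
  exact (hb t ht).potentialDeriv_moment (hv t ht) (hK t ht) hβ x e

end VlasovDarwin

namespace VlasovDarwin

open Filter Topology Function

/-! ### The characteristic field of regular potentials -/

section LogLip

variable {E F : Type*} [NormedAddCommGroup E] [NormedAddCommGroup F]

/-- The modulus in space is uniform in time, so continuity in each variable separately suffices: N
is fixed first to make C e⁻ᴺ small, then the point is moved. -/
theorem continuousOn_uncurry_of_logLip {I : Set ℝ} {C : ℝ} {f : ℝ → E → F}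
    (hc : ∀ z, ContinuousOn (fun t => f t z) I)
    (h : ∀ t ∈ I, ∀ N, 0 ≤ N → ∀ z w, ‖f t z - f t w‖ ≤ C * (N * ‖z - w‖ + Real.exp (-N))) :
    ContinuousOn (uncurry f) (I ×ˢ univ) := by
  rintro ⟨s, z⟩ ⟨hs, -⟩
  refine tendsto_sub_nhds_zero_iff.1 (NormedAddGroup.tendsto_nhds_zero.2 fun ε hε => ?_)
  obtain ⟨N, hN0, hN⟩ : ∃ N : ℝ, 0 ≤ N ∧ C * Real.exp (-N) < ε / 3 := by
    have h1 : Tendsto (fun N => C * Real.exp (-N)) atTop (𝓝 (C * 0)) :=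
      (Real.tendsto_exp_atBot.comp tendsto_neg_atTop_atBot).const_mul C
    rw [mul_zero] at h1
    exact ((eventually_ge_atTop 0).and (h1.eventually_lt_const (by positivity))).exists
  have h1 : Tendsto (fun q : ℝ × E => C * (N * ‖q.2 - z‖)) (𝓝[I ×ˢ univ] (s, z)) (𝓝 0) := by
    have : Continuous fun q : ℝ × E => C * (N * ‖q.2 - z‖) := by fun_prop
    have h2 := (this.tendsto (s, z)).mono_left (nhdsWithin_le_nhds (s := I ×ˢ univ))
    simpa using h2
  have h2 : Tendsto (fun q : ℝ × E => ‖f q.1 z - f s z‖) (𝓝[I ×ˢ univ] (s, z)) (𝓝 0) := by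
    have h3 : Tendsto (fun q : ℝ × E => q.1) (𝓝[I ×ˢ univ] (s, z)) (𝓝[I] s) :=
      tendsto_nhdsWithin_iff.2 ⟨(continuous_fst.tendsto (s, z)).mono_left nhdsWithin_le_nhds,
        eventually_mem_nhdsWithin.mono fun q hq => hq.1⟩
    exact tendsto_iff_norm_sub_tendsto_zero.1 (((hc z) s hs).tendsto.comp h3)
  filter_upwards [h1.eventually_lt_const (u := ε / 3) (by positivity),
    h2.eventually_lt_const (u := ε / 3) (by positivity), eventually_mem_nhdsWithin]
    with q h3 h4 hq
  have h5 := h q.1 hq.1 N hN0 q.2 z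
  calc ‖uncurry f q - uncurry f (s, z)‖ = ‖(f q.1 q.2 - f q.1 z) + (f q.1 z - f s z)‖ := by
        simp [uncurry]
    _ ≤ ‖f q.1 q.2 - f q.1 z‖ + ‖f q.1 z - f s z‖ := norm_add_le _ _
    _ < ε := by linarith

theorem continuous_of_logLip {C : ℝ} {f : E → F}
    (h : ∀ N, 0 ≤ N → ∀ z w, ‖f z - f w‖ ≤ C * (N * ‖z - w‖ + Real.exp (-N))) :
    Continuous f := by
  have h1 := continuousOn_uncurry_of_logLip (I := univ) (f := fun _ => f)
    (fun _ => continuousOn_const) fun _ _ => h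
  rw [univ_prod_univ, continuousOn_univ] at h1
  exact h1.comp (Continuous.prodMk_right 0)

/-- The Lipschitz bound serves for N ≥ 1; for N ≤ 1 the bound 2 serves, as 6 e⁻ᴺ ≥ 6/e ≥ 2. -/
theorem le_logLip_of_lipschitz {δ L d N : ℝ} (hL : 0 ≤ L) (hd : 0 ≤ d) (hN : 0 ≤ N)
    (h1 : δ ≤ L * d) (h2 : δ ≤ 2) : δ ≤ (L + 6) * (N * d + Real.exp (-N)) := by
  have he := Real.exp_pos (-N)
  rcases le_total 1 N with h | h
  · have h3 : 1 * d ≤ N * d := mul_le_mul_of_nonneg_right h hd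
    have h4 : L * d ≤ L * (N * d) := mul_le_mul_of_nonneg_left (by linarith) hL
    have h5 : 0 ≤ N * d := mul_nonneg hN hd
    nlinarith [mul_nonneg hL he.le]
  · have h3 : Real.exp (-1) ≤ Real.exp (-N) := Real.exp_le_exp.2 (by linarith)
    have h4 : (1 : ℝ) / 3 ≤ Real.exp (-1) := by
      rw [Real.exp_neg, ← one_div]
      exact one_div_le_one_div_of_le (Real.exp_pos 1) (Real.exp_one_lt_d9.le.trans (by norm_num))
    have h5 : 0 ≤ N * d := mul_nonneg hN hd
    nlinarith [mul_nonneg hL he.le, mul_nonneg hL h5]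

end LogLip

/-- Potentials with bounded log-Lipschitz derivatives that are continuous in time. -/
structure RegularPotentials (I : Set ℝ) (K : ℝ) (Φ : ℝ → E3 → ℝ) (A : ℝ → E3 → E3)
    (G : ℝ → E3 → E3) (D : ℝ → E3 → E3 →L[ℝ] E3) : Prop where
  nonneg : 0 ≤ K
  hasGradientAt : ∀ t ∈ I, ∀ x, HasGradientAt (Φ t) (G t x) x
  hasFDerivAt : ∀ t ∈ I, ∀ x, HasFDerivAt (A t) (D t x) x
  norm_gradient_le : ∀ t ∈ I, ∀ x, ‖G t x‖ ≤ K
  norm_deriv_le : ∀ t ∈ I, ∀ x, ‖D t x‖ ≤ K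
  gradient_logLip : ∀ t ∈ I, ∀ N, 0 ≤ N → ∀ x y,
    ‖G t x - G t y‖ ≤ K * (N * ‖x - y‖ + Real.exp (-N))
  deriv_logLip : ∀ t ∈ I, ∀ N, 0 ≤ N → ∀ x y,
    ‖D t x - D t y‖ ≤ K * (N * ‖x - y‖ + Real.exp (-N))
  continuousOn_vector : ∀ x, ContinuousOn (fun t => A t x) I
  continuousOn_gradient : ∀ x, ContinuousOn (fun t => G t x) I
  continuousOn_deriv : ∀ x, ContinuousOn (fun t => D t x) I

namespace RegularPotentials

open ContinuousLinearMap (adjoint)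

variable {I : Set ℝ} {K : ℝ} {Φ : ℝ → E3 → ℝ} {A : ℝ → E3 → E3} {G : ℝ → E3 → E3}
  {D : ℝ → E3 → E3 →L[ℝ] E3}

theorem contDiff (h : RegularPotentials I K Φ A G D) {t : ℝ} (ht : t ∈ I) :
    ContDiff ℝ 1 (Φ t) ∧ ContDiff ℝ 1 (A t) := by
  constructor
  · refine contDiff_one_iff_fderiv.2
      ⟨fun x => (h.hasGradientAt t ht x).hasFDerivAt.differentiableAt, ?_⟩
    rw [funext fun x => (h.hasGradientAt t ht x).hasFDerivAt.fderiv]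
    exact (InnerProductSpace.toDual ℝ E3).continuous.comp
      (continuous_of_logLip (h.gradient_logLip t ht))
  · refine contDiff_one_iff_fderiv.2 ⟨fun x => (h.hasFDerivAt t ht x).differentiableAt, ?_⟩
    rw [funext fun x => (h.hasFDerivAt t ht x).fderiv]
    exact continuous_of_logLip (h.deriv_logLip t ht)

theorem gradient_coord (h : RegularPotentials I K Φ A G D) {t : ℝ} (ht : t ∈ I) (x : E3)
    (i : Fin 3) : gradient (fun y => A t y i) x =
      adjoint (D t x) (EuclideanSpace.basisFun (Fin 3) ℝ i) := by
  refine HasGradientAt.gradient ?_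
  have h1 := (EuclideanSpace.proj (𝕜 := ℝ) i).hasFDerivAt.comp x (h.hasFDerivAt t ht x)
  refine hasGradientAt_iff_hasFDerivAt.2 (h1.congr_fderiv (ContinuousLinearMap.ext fun y => ?_))
  rw [InnerProductSpace.toDual_apply_apply, ContinuousLinearMap.adjoint_inner_left,
    EuclideanSpace.basisFun_apply, EuclideanSpace.inner_single_left, map_one, one_mul]
  rfl

/-- The sum ∑ vⁱ ∇Aⁱ is the adjoint of the derivative of A applied to v, by expanding v in the
standard basis. This form makes both the modulus and the skew structure visible. -/
theorem force_eq (h : RegularPotentials I K Φ A G D) {t : ℝ} (ht : t ∈ I) (z : Phase) :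
    force Φ A t z = -G t z.1 + adjoint (D t z.1) (velocity A t z) := by
  rw [force, (h.hasGradientAt t ht z.1).gradient]
  congr 1
  conv_rhs => rw [← (EuclideanSpace.basisFun (Fin 3) ℝ).sum_repr (velocity A t z)]
  rw [map_sum]
  refine Finset.sum_congr rfl fun i _ => ?_
  rw [h.gradient_coord ht, map_smul, EuclideanSpace.basisFun_repr]

theorem norm_vector_sub_le (h : RegularPotentials I K Φ A G D) {t : ℝ} (ht : t ∈ I) (x y : E3) :
    ‖A t x - A t y‖ ≤ K * ‖x - y‖ :=
  convex_univ.norm_image_sub_le_of_norm_hasFDerivWithin_le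
    (fun x _ => (h.hasFDerivAt t ht x).hasFDerivWithinAt) (fun x _ => h.norm_deriv_le t ht x)
    (mem_univ y) (mem_univ x)

theorem norm_velocity_sub_le (h : RegularPotentials I K Φ A G D) {t : ℝ} (ht : t ∈ I)
    (z w : Phase) : ‖velocity A t z - velocity A t w‖ ≤ 2 * (1 + K) * ‖z - w‖ := by
  have h1 := norm_relVel_sub_le (z.2 - A t z.1) (w.2 - A t w.1)
  have h2 : z.2 - A t z.1 - (w.2 - A t w.1) = (z.2 - w.2) - (A t z.1 - A t w.1) := by abel
  have h3 : ‖z.2 - w.2‖ ≤ ‖z - w‖ := norm_snd_le (z - w)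
  have h4 := (h.norm_vector_sub_le ht z.1 w.1).trans
    (mul_le_mul_of_nonneg_left (norm_fst_le (z - w)) h.nonneg)
  rw [h2] at h1
  refine h1.trans ?_
  linarith [norm_sub_le_of_le h3 h4]

/-- The velocity is bounded and Lipschitz; the force is a bounded log-Lipschitz term plus a product
of a bounded log-Lipschitz operator with the velocity. Boundedness of the factors is what keeps the
product log-Lipschitz. -/
theorem exists_logLipField (h : RegularPotentials I K Φ A G D) :
    ∃ C, LogLipField I C (charField Φ A) := by
  have hK := h.nonneg
  set B := 2 * (1 + K) + 6 with hB
  have hB0 : 0 ≤ B := by positivity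
  have hadj : ∀ L : E3 →L[ℝ] E3, ‖adjoint L‖ = ‖L‖ := fun L =>
    LinearIsometryEquiv.norm_map _ L
  have hlog : ∀ t ∈ I, ∀ N, 0 ≤ N → ∀ z w, ‖charField Φ A t z - charField Φ A t w‖ ≤
      (2 * K + (K + 1) * B) * (N * ‖z - w‖ + Real.exp (-N)) := by
    intro t ht N hN z w
    set ℓ := N * ‖z - w‖ + Real.exp (-N) with hℓ
    have hℓ0 : 0 ≤ ℓ := by positivity
    have hx : K * (N * ‖z.1 - w.1‖ + Real.exp (-N)) ≤ K * ℓ := by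
      have h1 : ‖z.1 - w.1‖ ≤ ‖z - w‖ := norm_fst_le (z - w)
      exact mul_le_mul_of_nonneg_left (add_le_add (mul_le_mul_of_nonneg_left h1 hN) le_rfl) hK
    have hv : ‖velocity A t z - velocity A t w‖ ≤ B * ℓ :=
      le_logLip_of_lipschitz (by positivity) (norm_nonneg _) hN (h.norm_velocity_sub_le ht z w)
        (by linarith [norm_sub_le_of_le (norm_velocity_le A t z) (norm_velocity_le A t w)])
    have hf : ‖force Φ A t z - force Φ A t w‖ ≤ K * ℓ + (K * ℓ + K * (B * ℓ)) := by
      rw [h.force_eq ht, h.force_eq ht]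
      have h0 : -G t z.1 + adjoint (D t z.1) (velocity A t z) -
          (-G t w.1 + adjoint (D t w.1) (velocity A t w)) =
          -(G t z.1 - G t w.1) + (adjoint (D t z.1 - D t w.1) (velocity A t z) +
            adjoint (D t w.1) (velocity A t z - velocity A t w)) := by
        rw [map_sub adjoint, sub_apply, map_sub]
        abel
      rw [h0]
      refine norm_add_le_of_le ?_ (norm_add_le_of_le ?_ ?_)
      · rw [norm_neg]
        exact (h.gradient_logLip t ht N hN _ _).trans hx
      · refine (ContinuousLinearMap.le_opNorm _ _).trans ?_
        rw [hadj]
        have h1 := (h.deriv_logLip t ht N hN z.1 w.1).trans hx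
        exact (mul_le_mul h1 (norm_velocity_le A t z) (norm_nonneg _)
          (mul_nonneg hK hℓ0)).trans (mul_one _).le
      · refine (ContinuousLinearMap.le_opNorm _ _).trans ?_
        rw [hadj]
        exact mul_le_mul (h.norm_deriv_le t ht w.1) hv (norm_nonneg _) hK
    have hKB := mul_nonneg (mul_nonneg hK hB0) hℓ0
    have hKℓ := mul_nonneg hK hℓ0
    have hBℓ := mul_nonneg hB0 hℓ0
    refine max_le ?_ ?_
    · refine hv.trans ?_
      linarith
    · refine hf.trans ?_
      linarith
  refine ⟨2 * K + (K + 1) * B, by positivity, continuousOn_uncurry_of_logLip (fun z => ?_) hlog,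
    fun t ht z => max_le ?_ ?_, hlog⟩
  · have hv : ContinuousOn (fun t => velocity A t z) I :=
      continuous_relVel.comp_continuousOn (continuousOn_const.sub (h.continuousOn_vector z.1))
    refine hv.prodMk (ContinuousOn.congr (f := fun t => -G t z.1 +
      adjoint (D t z.1) (velocity A t z)) ?_ fun t ht => h.force_eq ht z)
    exact (h.continuousOn_gradient z.1).neg.add
      ((adjoint.continuous.comp_continuousOn (h.continuousOn_deriv z.1)).clm_apply hv)
  · refine (norm_velocity_le A t z).trans ?_
    have := mul_nonneg hK hB0
    linarith
  · change ‖force Φ A t z‖ ≤ _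
    rw [h.force_eq ht]
    have h1 : ‖adjoint (D t z.1) (velocity A t z)‖ ≤ K * 1 := by
      refine (ContinuousLinearMap.le_opNorm _ _).trans ?_
      rw [hadj]
      exact mul_le_mul (h.norm_deriv_le t ht z.1) (norm_velocity_le A t z) (norm_nonneg _) hK
    have h2 : ‖-G t z.1‖ ≤ K := by
      rw [norm_neg]
      exact h.norm_gradient_le t ht z.1
    have := mul_nonneg hK hB0
    linarith [norm_add_le_of_le h2 h1]

/-- Writing v' for the derivative of the relativistic velocity, ∂ₓv = -v' DA and the p-derivative of
DA* v is DA* v'. Since v' is symmetric, the latter is (v' DA)* = -(∂ₓv)*. Differentiating the force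
in p only requires no second derivative of the potentials. -/
theorem skewField (h : RegularPotentials I K Φ A G D) :
    SkewField I (2 * K) (charField Φ A)
      (fun t z => -(relVelDeriv (z.2 - A t z.1)).comp (D t z.1)) := by
  refine ⟨mul_nonneg zero_le_two h.nonneg, fun t ht z => ?_, fun t ht z => ?_, fun t ht z => ?_,
    fun z => ?_⟩
  · have h1 := (hasFDerivAt_relVel (z.2 - A t z.1)).comp z.1
      ((h.hasFDerivAt t ht z.1).const_sub z.2)
    exact h1.congr_fderiv (ContinuousLinearMap.comp_neg _ _)
  · have h1 := (hasFDerivAt_relVel (z.2 - A t z.1)).comp z.2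
      ((hasFDerivAt_id z.2).sub_const (A t z.1))
    have h2 := ((adjoint (D t z.1)).hasFDerivAt.comp z.2 h1).const_add (-G t z.1)
    have h3 : (fun p => (charField Φ A t (z.1, p)).2) =
        fun p => -G t z.1 + adjoint (D t z.1) (relVel (p - A t z.1)) :=
      funext fun p => h.force_eq ht (z.1, p)
    rw [h3]
    refine h2.congr_fderiv ?_
    rw [map_neg, neg_neg, ContinuousLinearMap.adjoint_comp, adjoint_relVelDeriv,
      ContinuousLinearMap.comp_id]
  · rw [norm_neg]
    exact (ContinuousLinearMap.opNorm_comp_le _ _).trans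
      (mul_le_mul (norm_relVelDeriv_le _) (h.norm_deriv_le t ht z.1) (norm_nonneg _) zero_le_two)
  · exact ((continuous_relVelDeriv.comp_continuousOn
      (continuousOn_const.sub (h.continuousOn_vector z.1))).clm_comp
        (h.continuousOn_deriv z.1)).neg

end RegularPotentials

/-! ### The flow of the induced potentials -/

/-- Induced potentials are regular on compact time intervals. -/
theorem IsInducedPotentials.exists_regularPotentials {T t₁ : ℝ} {g : ℝ → Phase → ℝ}
    {Φ : ℝ → E3 → ℝ} {A : ℝ → E3 → E3} (h : IsInducedPotentials T g Φ A)
    (hg : IsCompactDensity T g) (ht₁ : t₁ ∈ Ico 0 T) :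
    ∃ K G D, RegularPotentials (Icc 0 t₁) K Φ A G D := by
  obtain ⟨R, M, hb⟩ := hg.exists_isBoundedDensity ht₁
  have hIco : ∀ t ∈ Icc 0 t₁, t ∈ Ico 0 T := fun t ht => ⟨ht.1, ht.2.trans_lt ht₁.2⟩
  have hvm : ∀ t ∈ Icc 0 t₁, AEStronglyMeasurable (velocity A t) volume := fun t ht =>
    (measurable_velocity (h.measurable_vector t (hIco t ht))).aestronglyMeasurable
  obtain ⟨C, hC0, hC⟩ := exists_potential_bounds R
  set M' := M * 1 * volume.real (Metric.closedBall (0 : E3) R)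
  have hsA : ∀ t ∈ Icc 0 t₁, IsSource R M' (moment (g t) (velocity A t)) := fun t ht =>
    (hb t ht).isSource_moment (hvm t ht) (norm_velocity_le A t)
  have hsΦ : ∀ t ∈ Icc 0 t₁, IsSource R M' (moment (g t) fun _ => unitVec) := fun t ht =>
    (hb t ht).isSource_moment aestronglyMeasurable_const fun _ => norm_unitVec.le
  have hM' : 0 ≤ M' := (hsA 0 ⟨le_rfl, ht₁.1⟩).nonneg
  have hβ1 : |(1 : ℝ)| ≤ 1 := by simp
  have hβ0 : |(0 : ℝ)| ≤ 1 := by simp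
  let DA : ℝ → E3 → E3 →L[ℝ] E3 := fun t x =>
    (1 / 2 : ℝ) • potentialDeriv 1 0 (moment (g t) (velocity A t)) x
  let DΦ : ℝ → E3 → E3 →L[ℝ] E3 := fun t x =>
    potentialDeriv 0 0 (moment (g t) fun _ => unitVec) x
  have hadj : ∀ L : E3 →L[ℝ] E3, ‖ContinuousLinearMap.adjoint L unitVec‖ ≤ ‖L‖ := fun L => by
    refine (ContinuousLinearMap.le_opNorm _ _).trans ?_
    rw [norm_unitVec, mul_one]
    exact (LinearIsometryEquiv.norm_map _ L).le
  have hhalf : ∀ L : E3 →L[ℝ] E3, ‖(1 / 2 : ℝ) • L‖ ≤ ‖L‖ := fun L => by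
    rw [norm_smul]
    norm_num
    linarith [norm_nonneg L]
  refine ⟨C * M', fun t x => ContinuousLinearMap.adjoint (DΦ t x) unitVec, DA,
    mul_nonneg hC0 hM', fun t ht x => ?_, fun t ht x => ?_, fun t ht x => ?_, fun t ht x => ?_,
    fun t ht N hN x y => ?_, fun t ht N hN x y => ?_, fun x => ?_, fun x => ?_, fun x => ?_⟩
  · have h1 := (innerSL ℝ unitVec).hasFDerivAt.comp x ((hC 0 hβ0 M' _ (hsΦ t ht)).1 x)
    rw [funext (h.scalar_eq_potential (hIco t ht) (hb t ht))]
    refine hasGradientAt_iff_hasFDerivAt.2 (h1.congr_fderiv (ContinuousLinearMap.ext fun y => ?_))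
    rw [InnerProductSpace.toDual_apply_apply, ContinuousLinearMap.adjoint_inner_left]
    rfl
  · rw [funext (h.vector_eq_potential (hIco t ht))]
    exact ((hC 1 hβ1 M' _ (hsA t ht)).1 x).const_smul (1 / 2 : ℝ)
  · exact (hadj _).trans ((hC 0 hβ0 M' _ (hsΦ t ht)).2.2.1 x)
  · exact (hhalf _).trans ((hC 1 hβ1 M' _ (hsA t ht)).2.2.1 x)
  · rw [← sub_apply, ← map_sub]
    exact (hadj _).trans ((hC 0 hβ0 M' _ (hsΦ t ht)).2.2.2 N hN x y)
  · have h1 : DA t x - DA t y = (1 / 2 : ℝ) • (potentialDeriv 1 0 (moment (g t) (velocity A t)) x -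
        potentialDeriv 1 0 (moment (g t) (velocity A t)) y) := (smul_sub _ _ _).symm
    rw [h1]
    exact (hhalf _).trans ((hC 1 hβ1 M' _ (hsA t ht)).2.2.2 N hN x y)
  · exact h.continuousOn_vector hg ht₁ hb x
  · exact (ContinuousLinearMap.adjoint.continuous.comp_continuousOn
      (hg.continuousOn_potentialDeriv ht₁ hb hβ0 (fun _ _ => aestronglyMeasurable_const)
        (fun _ _ _ => norm_unitVec.le) (fun _ => continuousOn_const) x)).clm_apply
      continuousOn_const
  · exact (hg.continuousOn_potentialDeriv ht₁ hb hβ1 hvm (fun t _ => norm_velocity_le A t)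
      (h.continuousOn_velocity hg ht₁ hb) x).const_smul (1 / 2 : ℝ)

/-- Constants exist only on compact subintervals of [0, T[. The flow is glued from these, while
conservation of volume between two times is checked on [0, max s t]. -/
theorem exists_liouvilleFlow {T : ℝ} {g : ℝ → Phase → ℝ} {Φ : ℝ → E3 → ℝ} {A : ℝ → E3 → E3}
    (hg : IsCompactDensity T g) (h : IsInducedPotentials T g Φ A) :
    ∃ Z, LiouvilleFlow T (charField Φ A) Z := by
  have hf : ∀ t₁ ∈ Ico 0 T, ∃ C, LogLipField (Icc 0 t₁) C (charField Φ A) := fun t₁ ht₁ => by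
    obtain ⟨K, G, D, hr⟩ := h.exists_regularPotentials hg ht₁
    exact hr.exists_logLipField
  obtain ⟨Z, hZ⟩ := exists_isOdeFlow hf
  refine ⟨Z, hf, hZ, fun s hs t ht => ?_⟩
  have hm : max s t ∈ Ico 0 T := ⟨hs.1.trans (le_max_left _ _), max_lt hs.2 ht.2⟩
  obtain ⟨K, G, D, hr⟩ := h.exists_regularPotentials hg hm
  obtain ⟨C, hC⟩ := hr.exists_logLipField
  exact (hZ.mono (J := Icc 0 (max s t)) fun r hr => ⟨hr.1, hr.2.trans_lt hm.2⟩).measurePreserving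
    hC hr.skewField ⟨ht.1, le_max_right _ _⟩ ⟨hs.1, le_max_left _ _⟩

theorem LiouvilleFlow.isCharacteristicFlow {T : ℝ} {Φ : ℝ → E3 → ℝ} {A : ℝ → E3 → E3}
    {Z : ℝ → ℝ → Phase → Phase} (h : LiouvilleFlow T (charField Φ A) Z) :
    IsCharacteristicFlow T Φ A Z := by
  refine ⟨h.flow.initial, h.flow.solves, fun t ht z J hJ hJT htJ ζ hζ hζt s hs => ?_⟩
  have hm : max t s ∈ Ico 0 T := ⟨ht.1.trans (le_max_left _ _), max_lt ht.2 (hJT hs).2⟩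
  obtain ⟨C, hC⟩ := h.field _ hm
  have hsub : uIcc t s ⊆ J := hJ.uIcc_subset htJ hs
  have hsub' : uIcc t s ⊆ Icc 0 (max t s) := fun r hr => ⟨(hJT (hsub hr)).1, hr.2⟩
  exact hC.unique hsub' (fun r hr => (hζ r (hsub hr)).mono hsub)
    (fun r hr => (h.flow.solves t ht z r (hJT (hsub hr))).mono (hsub.trans hJT))
    (hζt.trans (h.flow.initial t ht z).symm)

end VlasovDarwin

/-! ### Assembly -/

open VlasovDarwin

theorem lemma6 (T : ℝ) (hT : 0 < T)
    (g : ℝ → Phase → ℝ) (hg : IsCompactDensity T g)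
    (Φ : ℝ → E3 → ℝ) (A : ℝ → E3 → E3) (hpot : IsInducedPotentials T g Φ A) :
    (∀ t ∈ Ico 0 T, ContDiff ℝ 1 (Φ t) ∧ ContDiff ℝ 1 (A t)) ∧
    ∃ Z : ℝ → ℝ → Phase → Phase,
      IsCharacteristicFlow T Φ A Z ∧
      (∀ r ∈ Ico 0 T, ∀ s ∈ Ico 0 T, ∀ t ∈ Ico 0 T, ∀ z, Z r s (Z s t z) = Z r t z) ∧
      (∀ s ∈ Ico 0 T, ∀ t ∈ Ico 0 T, MeasurePreserving (Z s t) volume volume) ∧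
      ∀ f₀ : Phase → ℝ, MemLp f₀ 1 volume → MemLp f₀ ⊤ volume → 0 ≤ᵐ[volume] f₀ →
        IsWeakSolution T Φ A f₀ (fun t z => f₀ (Z 0 t z)) ∧
        (∀ f : ℝ → Phase → ℝ, IsWeakSolution T Φ A f₀ f →
          ∀ t ∈ Ico 0 T, ∀ᵐ z : Phase, f t z = f₀ (Z 0 t z)) ∧
        (∀ t ∈ Ico 0 T,
          densityMeasure (fun z => f₀ (Z 0 t z)) = (densityMeasure f₀).map (Z t 0)) := by
  obtain ⟨Z, hZ⟩ := exists_liouvilleFlow hg hpot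
  refine ⟨fun t ht => ?_, Z, hZ.isCharacteristicFlow, fun r hr s hs t ht z => hZ.comp hr hs ht z,
    hZ.preserving, fun f₀ h1 hf₀ h0 => ⟨?_, fun f hf t ht => ?_, fun t ht => ?_⟩⟩
  · obtain ⟨K, G, D, hr⟩ := hpot.exists_regularPotentials hg ht
    exact hr.contDiff ⟨ht.1, le_rfl⟩
  · exact hZ.isWeakSolution hT h1 hf₀ h0
  · exact hZ.ae_eq_comp hT hf.weakStar hf₀ hf.equation ht
  · exact hZ.densityMeasure_eq_map ht f₀
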